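/- Let $r_0,q_0,g_0:\mathbb R\to\mathbb C$ be Schwartz functions (only their restrictions to $[0,\infty)$ matter) with $q_0(0)=g_0(0)$. For $\operatorname{Im}k\le 0$ put $\hat f(k)=\int_0^\infty e^{-ikx}f(x)\,dx$, and put $\tilde f(w,t)=\int_0^t e^{-iw\tau}f(\tau)\,d\tau$. Let $\mu(k)=(1+k^2)^{1/2}=\sqrt{|1+k^2|}\,e^{i(\theta_1+\theta_2-\pi)/2}$, where $\theta_1,\theta_2\in[0,2\pi)$ are the angles of $k+i$ and $k-i$ measured counterclockwise from the direction $-i$ (branch cut $i[-1,1]$, $\mu(k)\sim k$ at infinity), and $\omega=\omega(k)=k/\mu(k)$. Let $\mathcal C$ be a closed contour in the open upper half-plane that winds once counterclockwise around $i$. For $x>0$, $t\ge 0$ define $$\begin{aligned} r(x,t)&=\frac1{2\pi}\int_{\mathbb R}e^{ikx}\,\tfrac12\big[(e^{i\omega t}+e^{-i\omega t})\hat r_0(k)-\mu(k)(e^{i\omega t}-e^{-i\omega t})\hat q_0(k)\big]dk\\ &\quad+\frac1{2\pi}\int_{\mathcal C}e^{ikx}\,\tfrac12\big[(e^{i\omega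 t}+e^{-i\omega t})\hat r_0(-k)+\mu(k)(e^{i\omega t}-e^{-i\omega t})\hat q_0(-k)\big]dk\\ &\quad+\frac1{2\pi}\int_{\mathcal C}e^{ikx}\Big\{e^{i\omega t}\tilde g_0(\omega,t)+e^{-i\omega t}\tilde g_0(-\omega,t)+i\omega\big[e^{i\omega t}\widetilde{g_0'}(\omega,t)-e^{-i\omega t}\widetilde{g_0'}(-\omega,t)\big]\Big\}dk,\\ q(x,t)&=\frac1{2\pi}\int_{\mathbb R}e^{ikx}\,\tfrac12\big[(e^{i\omega t}+e^{-i\omega t})\hat q_0(k)-\tfrac1{\mu(k)}(e^{i\omega t}-e^{-i\omega t})\hat r_0(k)\big]dk\\ &\quad-\frac1{2\pi}\int_{\mathcal C}e^{ikx}\,\tfrac12\big[(e^{i\omega t}+e^{-i\omega t})\hat q_0(-k)+\tfrac1{\mu(k)}(e^{i\omega t}-e^{-i\omega t})\hat r_0(-k)\big]dk\\ &\quad-\frac1{2\pi}\int_{\mathcal C}e^{ikx}\Big\{\tfrac1{\mu(k)}\big[e^{i\omega t}\tilde g_0(\omega,t)-e^{-i\omega t}\tilde g_0(-\omega,t)\big]+\tfrac{ik}{1+k^2}\big[e^{i\omega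 t}\widetilde{g_0'}(\omega,t)+e^{-i\omega t}\widetilde{g_0'}(-\omega,t)\big]\Big\}dk. \end{aligned}$$ Here the integral over $\mathbb R$ in $q$ is a (convergent) improper integral. The integrand over $\mathbb R$ in $r$ need not decay at infinity, and its integral is understood as $\lim_{\varepsilon\to0^+}\int_{\mathbb R}e^{-\varepsilon k^2}(\cdots)\,dk$; this limit exists, and it equals the improper integral, which converges, whenever $q_0(0)\sin t=0$. Then $r,q$ extend continuously to $x\ge0$, $t\ge 0$ (the values at $x=0$ being the limits as $x\to0^+$), and the extension is a classical solution of the linearized classical Boussinesq problem $$r_t+q_x=0,\quad q_t+r_x-q_{xxt}=0\quad(x>0,\ t>0),$$ $$r(x,0)=r_0(x),\quad q(x,0)=q_0(x)\quad(x\ge0),\qquad q(0,t)=g_0(t)\quad(t\ge0),$$ with $r\in C^1$ and $q\in C^3$ for $x>0$, $t>0$. -/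

import Mathlib

open Complex MeasureTheory Filter Topology Set
open scoped SchwartzMap

noncomputable section

namespace Boussinesq

/-- The angle in `[0, 2π)`, measured counterclockwise, from the downward vertical direction `-i`
to the vector `z` (note that `z = |z| e^{i(θ - π/2)}` iff `i z = |z| e^{iθ}`). -/
def angleFromDown (z : ℂ) : ℝ := toIcoMod Real.two_pi_pos 0 (arg (I * z))

/-- The square root `μ(k) = (1 + k²)^{1/2} = √|1 + k²| e^{i(θ₁ + θ₂ - π)/2}` with branch cut
`i[-1, 1]`; here `θ₁`, `θ₂` are the angles of `k + i` and `k - i`. On the cut this is the limit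
from the right, and `μ(k) ~ k` at infinity. -/
def mu (k : ℂ) : ℂ :=
  (Real.sqrt ‖1 + k ^ 2‖ : ℂ) *
    exp (I * (((angleFromDown (k + I) + angleFromDown (k - I) - Real.pi) / 2 : ℝ) : ℂ))

/-- The dispersion relation `ω(k) = k / μ(k)`. -/
def omega (k : ℂ) : ℂ := k / mu k

/-- Half-line Fourier transform `∫₀^∞ e^{-ikx} f(x) dx` (used for `Im k ≤ 0`). -/
def halfLineFourier (f : ℝ → ℂ) (k : ℂ) : ℂ := ∫ x in Ioi (0 : ℝ), exp (-I * k * x) * f x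

/-- Time transform `∫₀^t e^{-iwτ} f(τ) dτ`. -/
def timeTransform (f : ℝ → ℂ) (w : ℂ) (t : ℝ) : ℂ := ∫ τ in (0 : ℝ)..t, exp (-I * w * τ) * f τ

/-- Integral of `F` along the curve `γ : [0, 1] → ℂ`. -/
def contourIntegral (γ : ℝ → ℂ) (F : ℂ → ℂ) : ℂ :=
  ∫ u in (0 : ℝ)..1, F (γ u) * derivWithin γ (Icc 0 1) u

/-- `γ : [0, 1] → ℂ` is a closed contour in the open upper half-plane going once counterclockwise
around `i`. The parametrization is `C¹` but its speed may vanish, so corners are allowed. -/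
structure IsContourAroundI (γ : ℝ → ℂ) : Prop where
  contDiffOn : ContDiffOn ℝ 1 γ (Icc 0 1)
  closed : γ 0 = γ 1
  im_pos : ∀ u ∈ Icc (0 : ℝ) 1, 0 < (γ u).im
  ne_I : ∀ u ∈ Icc (0 : ℝ) 1, γ u ≠ I
  winding : contourIntegral γ (fun k => 1 / (k - I)) = 2 * Real.pi * I

/-- The improper integral of `F` over `ℝ`, both ends independently, converges to `J`. -/
def HasImproperIntegral (F : ℝ → ℂ) (J : ℂ) : Prop :=
  Tendsto (fun p : ℝ × ℝ => ∫ k in p.1..p.2, F k) (atBot ×ˢ atTop) (𝓝 J)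

/-- The integral of `F` over `ℝ`, summed with Gaussian cut-off
`lim_{ε → 0+} ∫ e^{-ε k²} F(k) dk`, is `J`. -/
def HasGaussIntegral (F : ℝ → ℂ) (J : ℂ) : Prop :=
  Tendsto (fun ε : ℝ => ∫ k : ℝ, (Real.exp (-ε * k ^ 2) : ℂ) * F k) (𝓝[>] 0) (𝓝 J)

/-- Integrand over `ℝ` in the formula for `r`. -/
def lineIntegrandR (r₀ q₀ : ℝ → ℂ) (x t : ℝ) (k : ℝ) : ℂ :=
  exp (I * k * x) * (1 / 2 *
    ((exp (I * omega k * t) + exp (-I * omega k * t)) * halfLineFourier r₀ k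
      - mu k * (exp (I * omega k * t) - exp (-I * omega k * t)) * halfLineFourier q₀ k))

/-- Integrand over `ℝ` in the formula for `q`. -/
def lineIntegrandQ (r₀ q₀ : ℝ → ℂ) (x t : ℝ) (k : ℝ) : ℂ :=
  exp (I * k * x) * (1 / 2 *
    ((exp (I * omega k * t) + exp (-I * omega k * t)) * halfLineFourier q₀ k
      - 1 / mu k * (exp (I * omega k * t) - exp (-I * omega k * t)) * halfLineFourier r₀ k))

/-- First contour integrand in the formula for `r` (initial data). -/
def contourIntegrandR₁ (r₀ q₀ : ℝ → ℂ) (x t : ℝ) (k : ℂ) : ℂ :=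
  exp (I * k * x) * (1 / 2 *
    ((exp (I * omega k * t) + exp (-I * omega k * t)) * halfLineFourier r₀ (-k)
      + mu k * (exp (I * omega k * t) - exp (-I * omega k * t)) * halfLineFourier q₀ (-k)))

/-- Second contour integrand in the formula for `r` (boundary data). -/
def contourIntegrandR₂ (g₀ : ℝ → ℂ) (x t : ℝ) (k : ℂ) : ℂ :=
  exp (I * k * x) *
    ((exp (I * omega k * t) * timeTransform g₀ (omega k) t
        + exp (-I * omega k * t) * timeTransform g₀ (-omega k) t)
      + I * omega k * (exp (I * omega k * t) * timeTransform (deriv g₀) (omega k) t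
        - exp (-I * omega k * t) * timeTransform (deriv g₀) (-omega k) t))

/-- First contour integrand in the formula for `q` (initial data). -/
def contourIntegrandQ₁ (r₀ q₀ : ℝ → ℂ) (x t : ℝ) (k : ℂ) : ℂ :=
  exp (I * k * x) * (1 / 2 *
    ((exp (I * omega k * t) + exp (-I * omega k * t)) * halfLineFourier q₀ (-k)
      + 1 / mu k * (exp (I * omega k * t) - exp (-I * omega k * t)) * halfLineFourier r₀ (-k)))

/-- Second contour integrand in the formula for `q` (boundary data). -/
def contourIntegrandQ₂ (g₀ : ℝ → ℂ) (x t : ℝ) (k : ℂ) : ℂ :=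
  exp (I * k * x) *
    (1 / mu k * (exp (I * omega k * t) * timeTransform g₀ (omega k) t
        - exp (-I * omega k * t) * timeTransform g₀ (-omega k) t)
      + I * k / (1 + k ^ 2) * (exp (I * omega k * t) * timeTransform (deriv g₀) (omega k) t
        + exp (-I * omega k * t) * timeTransform (deriv g₀) (-omega k) t))

/-- `v` is the value at `(x, t)` of the formula for `r`. The integrand over `ℝ` is bounded but
tends to a nonzero multiple of `e^{ikx}` at infinity when `q₀(0) sin t ≠ 0`, so its integral is
taken with a Gaussian cut-off; when `q₀(0) sin t = 0` it converges also as an improper integral,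
to the same value. -/
def IsFormulaValueR (r₀ q₀ g₀ : ℝ → ℂ) (γ : ℝ → ℂ) (x t : ℝ) (v : ℂ) : Prop :=
  ∃ J : ℂ, HasGaussIntegral (lineIntegrandR r₀ q₀ x t) J ∧
    (q₀ 0 * (Real.sin t : ℂ) = 0 → HasImproperIntegral (lineIntegrandR r₀ q₀ x t) J) ∧
    v = 1 / (2 * Real.pi) * J
      + 1 / (2 * Real.pi) * contourIntegral γ (contourIntegrandR₁ r₀ q₀ x t)
      + 1 / (2 * Real.pi) * contourIntegral γ (contourIntegrandR₂ g₀ x t)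

/-- `v` is the value at `(x, t)` of the formula for `q`, the integral over `ℝ` being a convergent
improper integral. -/
def IsFormulaValueQ (r₀ q₀ g₀ : ℝ → ℂ) (γ : ℝ → ℂ) (x t : ℝ) (v : ℂ) : Prop :=
  ∃ J : ℂ, HasImproperIntegral (lineIntegrandQ r₀ q₀ x t) J ∧
    v = 1 / (2 * Real.pi) * J
      - 1 / (2 * Real.pi) * contourIntegral γ (contourIntegrandQ₁ r₀ q₀ x t)
      - 1 / (2 * Real.pi) * contourIntegral γ (contourIntegrandQ₂ g₀ x t)

/-- `(r, q)` is a classical solution of `r_t + q_x = 0`, `q_t + r_x - q_{xxt} = 0` in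
`x > 0`, `t > 0` with `r(x,0) = r₀(x)`, `q(x,0) = q₀(x)` for `x ≥ 0` and `q(0,t) = g₀(t)` for
`t ≥ 0`: both functions are continuous on the closed quadrant, and `r` is `C¹`, `q` is `C³` in the
open one (so the order of derivatives in `q_{xxt}` is immaterial). -/
structure IsClassicalSolution (r₀ q₀ g₀ : ℝ → ℂ) (r q : ℝ → ℝ → ℂ) : Prop where
  continuousOn_r : ContinuousOn (fun p : ℝ × ℝ => r p.1 p.2) (Ici 0 ×ˢ Ici 0)
  continuousOn_q : ContinuousOn (fun p : ℝ × ℝ => q p.1 p.2) (Ici 0 ×ˢ Ici 0)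
  contDiffOn_r : ContDiffOn ℝ 1 (fun p : ℝ × ℝ => r p.1 p.2) (Ioi 0 ×ˢ Ioi 0)
  contDiffOn_q : ContDiffOn ℝ 3 (fun p : ℝ × ℝ => q p.1 p.2) (Ioi 0 ×ˢ Ioi 0)
  eq_one : ∀ x t : ℝ, 0 < x → 0 < t →
    deriv (fun s => r x s) t + deriv (fun y => q y t) x = 0
  eq_two : ∀ x t : ℝ, 0 < x → 0 < t →
    deriv (fun s => q x s) t + deriv (fun y => r y t) x
      - deriv (fun s => iteratedDeriv 2 (fun y => q y s) x) t = 0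
  initial_r : ∀ x : ℝ, 0 ≤ x → r x 0 = r₀ x
  initial_q : ∀ x : ℝ, 0 ≤ x → q x 0 = q₀ x
  boundary_q : ∀ t : ℝ, 0 ≤ t → q 0 t = g₀ t

end Boussinesq

end

noncomputable section

namespace Boussinesq

/-! ### The square root `μ` -/

/-! The branch cut is only apparent. Every combination of `e^{iωt}`, `e^{-iωt}`, `μ` in the formulas
is even in the choice of the square root, so it can be written with `cos(ωt)` and `sin(ωt)/ω`, which
are entire in `ω² = k²/(1+k²)`. In the closed upper half-plane the only singularity is then `k = i`,
usually an essential one, and `𝒞` encircles it.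

Repeated integration by parts splits `f̂` into a jet part, rational with its only pole at `i`, and a
tail that is `O(k⁻⁶)` on the lower half-plane (`halfLineFourier_eq_jet_add_tail`). For `x > 0` the
jet part of the line integral is moved to `𝒞` by Jordan's lemma. In `r` its amplitude tends to
`-q₀(0) sin t`, and this constant is harmless because `∫ e^{ikx} dk` has Gaussian value `0` for `x ≠
0` (`hasGaussIntegral_of_tendsto`). Moving contours past an essential singularity is reduced by
Taylor expansion in `ω²` to poles, and from there to the winding number of `1/(k-i)`
(`rectContour_entire`).

What remains are plane waves over the line with rapidly decaying amplitudes, plus plane waves over a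
compact curve. Both may be differentiated under the integral on all of `ℝ²`, so `r` and `q` are `C³`
up to and beyond the boundary (`SmoothAmplitude.contDiff`). Mode by mode the amplitudes solve the
Fourier-transformed system with source terms in `g₀` and `g₀'`; these integrate to multiples of `∫_𝒞
e^{ikx} dk` and `∫_𝒞 ik e^{ikx} dk`, which vanish by Cauchy.

At `t = 0` the contour integrands are holomorphic and drop out, and Fourier inversion of the data
cut off at `0` is left (`hasGaussIntegral_halfLineFourier`). At `x = 0` the substitution `k → -k`
turns the line integral of the tails into a contour integral that cancels the tails of `q̂₀(-k)` and
`r̂₀(-k)`. The rest is odd in `k`, so its contour integral is `πi` times the limit of `k F(k)` at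
infinity (`contourIntegral_of_odd`). There `ω² → 1`, the forcing contributes `g₀(t) - g₀(0) cos t`,
the jets contribute `q₀(0) cos t`, and compatibility leaves `g₀(t)` (`solQ_boundary`). -/

theorem exp_angleFromDown (z : ℂ) : (‖z‖ : ℂ) * exp (I * angleFromDown z) = I * z := by
  have h : angleFromDown z = arg (I * z) - toIcoDiv Real.two_pi_pos 0 (arg (I * z)) • (2 * Real.pi) :=
    rfl
  have h2 : (I * angleFromDown z : ℂ)
      = arg (I * z) * I - (toIcoDiv Real.two_pi_pos 0 (arg (I * z)) : ℤ) * (2 * Real.pi * I) := by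
    rw [h]; push_cast [zsmul_eq_mul]; ring
  have h3 := norm_mul_exp_arg_mul_I (I * z)
  rw [norm_mul, norm_I, one_mul] at h3
  rw [h2, exp_sub, exp_int_mul_two_pi_mul_I, div_one, h3]

/-- The phase `-π/2` squares to `-1`, and `-(i(k+i))(i(k-i)) = 1 + k²`. This is the only property of
`μ` used later, so the choice of branch plays no role in the proof. -/
theorem mu_sq (k : ℂ) : mu k ^ 2 = 1 + k ^ 2 := by
  have h1 := exp_angleFromDown (k + I)
  have h2 := exp_angleFromDown (k - I)
  have hn : ‖1 + k ^ 2‖ = ‖k + I‖ * ‖k - I‖ := by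
    rw [← norm_mul]; congr 1; ring_nf; rw [I_sq]; ring
  have hs : ((Real.sqrt ‖1 + k ^ 2‖ : ℝ) : ℂ) ^ 2 = (‖k + I‖ : ℂ) * ‖k - I‖ := by
    rw [← ofReal_pow, Real.sq_sqrt (norm_nonneg _), hn]; push_cast; rfl
  have he : exp (I * (((angleFromDown (k + I) + angleFromDown (k - I) - Real.pi) / 2 : ℝ) : ℂ)) ^ 2
      = exp (I * angleFromDown (k + I)) * exp (I * angleFromDown (k - I)) * (-1) := by
    rw [← exp_nat_mul, ← exp_add, ← exp_neg_pi_mul_I, ← exp_add]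
    congr 1; push_cast; ring
  rw [mu, mul_pow, hs, he]
  calc _ = (‖k + I‖ * exp (I * angleFromDown (k + I))) *
        (‖k - I‖ * exp (I * angleFromDown (k - I))) * (-1) := by ring
    _ = 1 + k ^ 2 := by
      rw [h1, h2]
      linear_combination (-k ^ 2 + I ^ 2 - 1) * I_sq

/-- `ω² = k² / (1 + k²)` as a rational function of the wave number. -/
def omegaSq (k : ℂ) : ℂ := k ^ 2 / (1 + k ^ 2)

theorem omega_sq (k : ℂ) : omega k ^ 2 = omegaSq k := by
  rw [omega, div_pow, mu_sq, omegaSq]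

/-! ### Entire functions `cos √w` and `sin √w / √w` -/

/-- The entire function `w ↦ cos √w`. -/
def cosSqrt (w : ℂ) : ℂ := ∑' n : ℕ, (-1) ^ n * w ^ n / ((2 * n).factorial : ℂ)

/-- The entire function `w ↦ sin √w / √w`. -/
def sincSqrt (w : ℂ) : ℂ := ∑' n : ℕ, (-1) ^ n * w ^ n / ((2 * n + 1).factorial : ℂ)

theorem cosSqrt_sq (w : ℂ) : cosSqrt (w ^ 2) = cos w := by
  rw [cosSqrt, ← (hasSum_cos w).tsum_eq]
  simp only [pow_mul]

theorem mul_sincSqrt_sq (w : ℂ) : w * sincSqrt (w ^ 2) = sin w := by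
  rw [sincSqrt, ← (hasSum_sin w).tsum_eq, ← tsum_mul_left]
  congr 1; ext n
  rw [← pow_mul, pow_succ w]; ring

/-- On each disc the series is dominated by the exponential series, so it converges uniformly there
to a holomorphic function. -/
theorem differentiable_tsum_of_le_factorial {c : ℕ → ℂ} (hc : ∀ n, ‖c n‖ ≤ 1 / (n.factorial : ℝ)) :
    Differentiable ℂ (fun w : ℂ => ∑' n : ℕ, c n * w ^ n) := by
  intro w
  have hd : DifferentiableOn ℂ (fun w : ℂ => ∑' n : ℕ, c n * w ^ n) (Metric.ball 0 (‖w‖ + 1)) := by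
    refine differentiableOn_tsum_of_summable_norm
      (Real.summable_pow_div_factorial (‖w‖ + 1)) (fun n => ?_) Metric.isOpen_ball (fun n v hv => ?_)
    · fun_prop
    · rw [mem_ball_zero_iff] at hv
      rw [norm_mul, norm_pow, div_eq_inv_mul, ← one_div]
      gcongr
      exact hc n
  exact hd.differentiableAt (Metric.isOpen_ball.mem_nhds (by simp))

theorem differentiable_cosSqrt : Differentiable ℂ cosSqrt := by
  have h : cosSqrt = fun w : ℂ => ∑' n : ℕ, ((-1) ^ n / ((2 * n).factorial : ℂ)) * w ^ n := by
    ext w; rw [cosSqrt]; congr 1; ext n; ring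
  rw [h]
  refine differentiable_tsum_of_le_factorial fun n => ?_
  rw [norm_div, norm_pow, norm_neg, norm_one, one_pow, norm_natCast]
  gcongr; omega

theorem differentiable_sincSqrt : Differentiable ℂ sincSqrt := by
  have h : sincSqrt = fun w : ℂ => ∑' n : ℕ, ((-1) ^ n / ((2 * n + 1).factorial : ℂ)) * w ^ n := by
    ext w; rw [sincSqrt]; congr 1; ext n; ring
  rw [h]
  refine differentiable_tsum_of_le_factorial fun n => ?_
  rw [norm_div, norm_pow, norm_neg, norm_one, one_pow, norm_natCast]
  gcongr; omega

theorem sincSqrt_zero : sincSqrt 0 = 1 := by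
  rw [sincSqrt, tsum_eq_single 0]
  · simp
  · intro n hn; simp [hn]

/-- `cos (ω t)` as a function of `z = ω²`. -/
def cosTime (z : ℂ) (t : ℝ) : ℂ := cosSqrt (z * t ^ 2)

/-- `sin (ω t) / ω` as a function of `z = ω²`. -/
def sinTime (z : ℂ) (t : ℝ) : ℂ := t * sincSqrt (z * t ^ 2)

theorem cosTime_sq (w : ℂ) (t : ℝ) : cosTime (w ^ 2) t = cos (w * t) := by
  rw [cosTime, ← mul_pow, cosSqrt_sq]

theorem mul_sinTime_sq (w : ℂ) (t : ℝ) : w * sinTime (w ^ 2) t = sin (w * t) := by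
  rw [sinTime, ← mul_pow, ← mul_assoc, mul_sincSqrt_sq]

@[simp] theorem cosTime_zero (z : ℂ) : cosTime z 0 = 1 := by
  simpa [cosTime] using cosSqrt_sq 0

@[simp] theorem sinTime_zero (z : ℂ) : sinTime z 0 = 0 := by
  simp [sinTime]

theorem cosTime_one (t : ℝ) : cosTime 1 t = Real.cos t := by
  simpa using cosTime_sq 1 t

theorem sinTime_one (t : ℝ) : sinTime 1 t = Real.sin t := by
  simpa using mul_sinTime_sq 1 t

/-- Identities in the variable `z = ω²` are verified by choosing a square root and using the
trigonometric functions of it. -/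
theorem exists_sq_eq (z : ℂ) : ∃ w : ℂ, w ^ 2 = z :=
  IsAlgClosed.exists_pow_nat_eq z two_pos

theorem cosTime_sq_add (z : ℂ) (t : ℝ) : cosTime z t ^ 2 + z * sinTime z t ^ 2 = 1 := by
  obtain ⟨w, rfl⟩ := exists_sq_eq z
  rw [← mul_pow, mul_sinTime_sq, cosTime_sq, cos_sq_add_sin_sq]

theorem exp_omega_mul (k : ℂ) (t : ℝ) :
    exp (I * omega k * t) = cosTime (omegaSq k) t + I * omega k * sinTime (omegaSq k) t := by
  rw [← omega_sq, mul_assoc, mul_assoc, mul_sinTime_sq, cosTime_sq, mul_comm I, exp_mul_I,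
    mul_comm I]

theorem exp_neg_omega_mul (k : ℂ) (t : ℝ) :
    exp (-I * omega k * t) = cosTime (omegaSq k) t - I * omega k * sinTime (omegaSq k) t := by
  rw [← omega_sq, mul_assoc, mul_assoc I, mul_sinTime_sq, cosTime_sq, neg_mul, mul_comm I, ← neg_mul,
    exp_mul_I, cos_neg, sin_neg]
  ring

theorem continuous_cosTime : Continuous (fun p : ℂ × ℝ => cosTime p.1 p.2) := by
  have := differentiable_cosSqrt.continuous
  unfold cosTime; fun_prop

theorem continuous_sinTime : Continuous (fun p : ℂ × ℝ => sinTime p.1 p.2) := by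
  have := differentiable_sincSqrt.continuous
  unfold sinTime; fun_prop

theorem differentiable_cosTime (t : ℝ) : Differentiable ℂ (fun z => cosTime z t) := by
  have := differentiable_cosSqrt
  unfold cosTime; fun_prop

theorem differentiable_sinTime (t : ℝ) : Differentiable ℂ (fun z => sinTime z t) := by
  have := differentiable_sincSqrt
  unfold sinTime; fun_prop

theorem hasDerivAt_cosTime (z : ℂ) (t : ℝ) :
    HasDerivAt (cosTime z) (-z * sinTime z t) t := by
  obtain ⟨w, rfl⟩ := exists_sq_eq z
  have h : cosTime (w ^ 2) = fun s : ℝ => cos (w * s) := funext fun s => cosTime_sq w s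
  have h2 : HasDerivAt (fun s : ℂ => cos (w * s)) (-sin (w * t) * w) (t : ℂ) := by
    simpa using ((hasDerivAt_id (t : ℂ)).const_mul w).ccos
  rw [h]
  convert! h2.comp_ofReal using 1
  rw [← mul_sinTime_sq]; ring

theorem hasDerivAt_sinTime (z : ℂ) (t : ℝ) :
    HasDerivAt (sinTime z) (cosTime z t) t := by
  -- The formula `sin(ws)/w` needs `w ≠ 0`; at `z = 0` the function is `s` itself.
  rcases eq_or_ne z 0 with rfl | hz
  · have h : sinTime 0 = fun s : ℝ => (s : ℂ) := by
      ext s; simp [sinTime, sincSqrt_zero]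
    have h2 : cosTime 0 t = 1 := by simpa [cosTime] using cosSqrt_sq 0
    rw [h, h2]
    exact (hasDerivAt_id (t : ℂ)).comp_ofReal
  obtain ⟨w, rfl⟩ := exists_sq_eq z
  have hw : w ≠ 0 := by rintro rfl; simp at hz
  have h : sinTime (w ^ 2) = fun s : ℝ => w⁻¹ * sin (w * s) := by
    ext s; rw [← mul_sinTime_sq]; field_simp
  have h2 : HasDerivAt (fun s : ℂ => w⁻¹ * sin (w * s)) (w⁻¹ * (cos (w * t) * w)) (t : ℂ) := by
    simpa using (((hasDerivAt_id (t : ℂ)).const_mul w).csin).const_mul w⁻¹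
  rw [h]
  convert! h2.comp_ofReal using 1
  rw [cosTime_sq]; field_simp

/-! ### Duhamel integrals -/

theorem differentiable_intervalIntegral_of_continuous {Φ Φ' : ℂ → ℝ → ℂ}
    (hΦ : Continuous (fun p : ℂ × ℝ => Φ p.1 p.2)) (hΦ' : Continuous (fun p : ℂ × ℝ => Φ' p.1 p.2))
    (hd : ∀ z τ, HasDerivAt (fun z => Φ z τ) (Φ' z τ) z) (a b : ℝ) :
    Differentiable ℂ (fun z => ∫ τ in a..b, Φ z τ) := by
  intro z
  obtain ⟨M, hM⟩ := ((isCompact_closedBall z 1).prod (isCompact_uIcc (a := a) (b := b))).exists_bound_of_continuousOn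
    hΦ'.continuousOn
  have h := intervalIntegral.hasDerivAt_integral_of_dominated_loc_of_deriv_le (μ := volume)
    (F := Φ) (F' := Φ') (x₀ := z) (a := a) (b := b) (bound := fun _ => M)
    (Metric.closedBall_mem_nhds z one_pos)
    (Eventually.of_forall fun w => (by fun_prop : Continuous (Φ w)).aestronglyMeasurable)
    ((by fun_prop : Continuous (Φ z)).intervalIntegrable _ _)
    ((by fun_prop : Continuous (Φ' z)).aestronglyMeasurable)
    (ae_of_all _ fun τ hτ w hw => hM (w, τ) ⟨hw, uIoc_subset_uIcc hτ⟩)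
    intervalIntegrable_const (ae_of_all _ fun τ _ w _ => hd w τ)
  exact h.2.differentiableAt

/-- `∫₀^t cos (ω τ) g(τ) dτ` as a function of `z = ω²`. -/
def cosInt (g : ℝ → ℂ) (z : ℂ) (t : ℝ) : ℂ := ∫ τ in (0 : ℝ)..t, cosTime z τ * g τ

/-- `∫₀^t sin (ω τ) / ω g(τ) dτ` as a function of `z = ω²`. -/
def sinInt (g : ℝ → ℂ) (z : ℂ) (t : ℝ) : ℂ := ∫ τ in (0 : ℝ)..t, sinTime z τ * g τ

/-- `∫₀^t cos (ω (t - τ)) g(τ) dτ` as a function of `z = ω²`. -/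
def cosConv (g : ℝ → ℂ) (z : ℂ) (t : ℝ) : ℂ :=
  cosTime z t * cosInt g z t + z * sinTime z t * sinInt g z t

/-- `∫₀^t sin (ω (t - τ)) / ω g(τ) dτ` as a function of `z = ω²`. -/
def sinConv (g : ℝ → ℂ) (z : ℂ) (t : ℝ) : ℂ :=
  sinTime z t * cosInt g z t - cosTime z t * sinInt g z t

section Duhamel

variable {g : ℝ → ℂ}

theorem continuous_cosTime_right (z : ℂ) : Continuous (cosTime z) :=
  continuous_iff_continuousAt.2 fun t => (hasDerivAt_cosTime z t).continuousAt

theorem continuous_sinTime_right (z : ℂ) : Continuous (sinTime z) :=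
  continuous_iff_continuousAt.2 fun t => (hasDerivAt_sinTime z t).continuousAt

theorem continuous_cosTime_mul (hg : Continuous g) :
    Continuous (fun p : ℂ × ℝ => cosTime p.1 p.2 * g p.2) :=
  continuous_cosTime.mul (hg.comp continuous_snd)

theorem continuous_sinTime_mul (hg : Continuous g) :
    Continuous (fun p : ℂ × ℝ => sinTime p.1 p.2 * g p.2) :=
  continuous_sinTime.mul (hg.comp continuous_snd)

theorem continuous_cosInt (hg : Continuous g) :
    Continuous (fun p : ℂ × ℝ => cosInt g p.1 p.2) := by
  have h : Continuous (fun q : (ℂ × ℝ) × ℝ => cosTime q.1.1 q.2 * g q.2) := by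
    have := differentiable_cosSqrt.continuous
    unfold cosTime
    fun_prop
  unfold cosInt
  exact intervalIntegral.continuous_parametric_intervalIntegral_of_continuous
    (f := fun (p : ℂ × ℝ) τ => cosTime p.1 τ * g τ) h continuous_snd

theorem continuous_sinInt (hg : Continuous g) :
    Continuous (fun p : ℂ × ℝ => sinInt g p.1 p.2) := by
  have h : Continuous (fun q : (ℂ × ℝ) × ℝ => sinTime q.1.1 q.2 * g q.2) := by
    have := differentiable_sincSqrt.continuous
    unfold sinTime
    fun_prop
  unfold sinInt
  exact intervalIntegral.continuous_parametric_intervalIntegral_of_continuous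
    (f := fun (p : ℂ × ℝ) τ => sinTime p.1 τ * g τ) h continuous_snd

theorem continuous_cosConv (hg : Continuous g) :
    Continuous (fun p : ℂ × ℝ => cosConv g p.1 p.2) := by
  have h1 := continuous_cosInt hg
  have h2 := continuous_sinInt hg
  have h3 := continuous_cosTime
  have h4 := continuous_sinTime
  unfold cosConv
  fun_prop

theorem continuous_sinConv (hg : Continuous g) :
    Continuous (fun p : ℂ × ℝ => sinConv g p.1 p.2) := by
  have h1 := continuous_cosInt hg
  have h2 := continuous_sinInt hg
  have h3 := continuous_cosTime
  have h4 := continuous_sinTime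
  unfold sinConv
  fun_prop

theorem differentiable_cosInt (hg : Continuous g) (t : ℝ) :
    Differentiable ℂ (fun z => cosInt g z t) := by
  have hc : Continuous (deriv cosSqrt) := 
    (differentiable_cosSqrt.contDiff (n := 1)).continuous_deriv le_rfl
  refine differentiable_intervalIntegral_of_continuous
    (Φ' := fun z τ => deriv cosSqrt (z * τ ^ 2) * τ ^ 2 * g τ)
    (continuous_cosTime_mul hg) (by fun_prop) (fun z τ => ?_) 0 t
  have h1 : HasDerivAt (fun z : ℂ => z * (τ : ℂ) ^ 2) ((τ : ℂ) ^ 2) z := by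
    simpa using (hasDerivAt_id z).mul_const ((τ : ℂ) ^ 2)
  exact ((differentiable_cosSqrt _).hasDerivAt.comp z h1).mul_const (g τ)

theorem differentiable_sinInt (hg : Continuous g) (t : ℝ) :
    Differentiable ℂ (fun z => sinInt g z t) := by
  have hc : Continuous (deriv sincSqrt) := 
    (differentiable_sincSqrt.contDiff (n := 1)).continuous_deriv le_rfl
  refine differentiable_intervalIntegral_of_continuous
    (Φ' := fun z τ => τ * (deriv sincSqrt (z * τ ^ 2) * τ ^ 2) * g τ)
    (continuous_sinTime_mul hg) (by fun_prop) (fun z τ => ?_) 0 t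
  have h1 : HasDerivAt (fun z : ℂ => z * (τ : ℂ) ^ 2) ((τ : ℂ) ^ 2) z := by
    simpa using (hasDerivAt_id z).mul_const ((τ : ℂ) ^ 2)
  exact (((differentiable_sincSqrt _).hasDerivAt.comp z h1).const_mul (τ : ℂ)).mul_const (g τ)

theorem differentiable_cosConv (hg : Continuous g) (t : ℝ) :
    Differentiable ℂ (fun z => cosConv g z t) := by
  have h1 := differentiable_cosInt hg t
  have h2 := differentiable_sinInt hg t
  have h3 := differentiable_cosTime t
  have h4 := differentiable_sinTime t
  unfold cosConv
  fun_prop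

theorem differentiable_sinConv (hg : Continuous g) (t : ℝ) :
    Differentiable ℂ (fun z => sinConv g z t) := by
  have h1 := differentiable_cosInt hg t
  have h2 := differentiable_sinInt hg t
  have h3 := differentiable_cosTime t
  have h4 := differentiable_sinTime t
  unfold sinConv
  fun_prop

theorem hasDerivAt_cosInt (hg : Continuous g) (z : ℂ) (t : ℝ) :
    HasDerivAt (cosInt g z) (cosTime z t * g t) t := by
  have h : Continuous (fun τ => cosTime z τ * g τ) :=
    (continuous_cosTime_right _).mul hg
  exact h.integral_hasStrictDerivAt 0 t |>.hasDerivAt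

theorem hasDerivAt_sinInt (hg : Continuous g) (z : ℂ) (t : ℝ) :
    HasDerivAt (sinInt g z) (sinTime z t * g t) t := by
  have h : Continuous (fun τ => sinTime z τ * g τ) :=
    (continuous_sinTime_right _).mul hg
  exact h.integral_hasStrictDerivAt 0 t |>.hasDerivAt

/-- Together with the next lemma this says that `sinConv g z` solves `y'' + z y = g`. The boundary
term of Duhamel's formula is `g(t)` times `cos² + sin² = 1`. -/
theorem hasDerivAt_cosConv (hg : Continuous g) (z : ℂ) (t : ℝ) :
    HasDerivAt (cosConv g z) (g t - z * sinConv g z t) t := by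
  have h := ((hasDerivAt_cosTime z t).mul (hasDerivAt_cosInt hg z t)).add
    (((hasDerivAt_sinTime z t).const_mul z).mul (hasDerivAt_sinInt hg z t))
  convert! h using 1
  rw [sinConv]
  linear_combination (-g t) * cosTime_sq_add z t

theorem hasDerivAt_sinConv (hg : Continuous g) (z : ℂ) (t : ℝ) :
    HasDerivAt (sinConv g z) (cosConv g z t) t := by
  have h := ((hasDerivAt_sinTime z t).mul (hasDerivAt_cosInt hg z t)).sub
    ((hasDerivAt_cosTime z t).mul (hasDerivAt_sinInt hg z t))
  convert! h using 1
  rw [cosConv]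
  ring

@[simp] theorem cosConv_zero (g : ℝ → ℂ) (z : ℂ) : cosConv g z 0 = 0 := by
  simp [cosConv, cosInt]

@[simp] theorem sinConv_zero (g : ℝ → ℂ) (z : ℂ) : sinConv g z 0 = 0 := by
  simp [sinConv, sinInt]

/-- Integration by parts in the Duhamel integral. -/
theorem cosConv_deriv {g' : ℝ → ℂ} (hg : ∀ t, HasDerivAt g (g' t) t) (hg' : Continuous g')
    (z : ℂ) (t : ℝ) :
    cosConv g' z t = g t - cosTime z t * g 0 - z * sinConv g z t := by
  have hgc : Continuous g := continuous_iff_continuousAt.2 fun t => (hg t).continuousAt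
  have hc : Continuous (cosTime z) := continuous_cosTime_right z
  have hs : Continuous (sinTime z) := continuous_sinTime_right z
  have hA : cosInt g' z t = cosTime z t * g t - g 0 + z * sinInt g z t := by
    rw [cosInt, intervalIntegral.integral_mul_deriv_eq_deriv_mul
      (fun x _ => hasDerivAt_cosTime z x) (fun x _ => hg x)
      ((by fun_prop : Continuous fun x => -z * sinTime z x).intervalIntegrable _ _)
      (hg'.intervalIntegrable _ _), sinInt]
    simp only [mul_assoc, intervalIntegral.integral_const_mul, cosTime_zero]
    ring
  have hB : sinInt g' z t = sinTime z t * g t - cosInt g z t := by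
    rw [sinInt, intervalIntegral.integral_mul_deriv_eq_deriv_mul
      (fun x _ => hasDerivAt_sinTime z x) (fun x _ => hg x)
      (hc.intervalIntegrable _ _) (hg'.intervalIntegrable _ _), cosInt, sinTime_zero]
    ring
  rw [cosConv, sinConv, hA, hB]
  linear_combination g t * cosTime_sq_add z t

theorem timeTransform_omega (hg : Continuous g) (k : ℂ) (t : ℝ) :
    timeTransform g (omega k) t = cosInt g (omegaSq k) t - I * omega k * sinInt g (omegaSq k) t := by
  have h1 : Continuous (fun τ => cosTime (omegaSq k) τ * g τ) :=
    (continuous_cosTime_right _).mul hg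
  have h2 : Continuous (fun τ => sinTime (omegaSq k) τ * g τ) :=
    (continuous_sinTime_right _).mul hg
  rw [timeTransform, cosInt, sinInt, ← intervalIntegral.integral_const_mul,
    ← intervalIntegral.integral_sub (h1.intervalIntegrable _ _)
      ((h2.const_mul _).intervalIntegrable _ _)]
  congr 1; ext τ
  rw [exp_neg_omega_mul]; ring

theorem timeTransform_neg_omega (hg : Continuous g) (k : ℂ) (t : ℝ) :
    timeTransform g (-omega k) t = cosInt g (omegaSq k) t + I * omega k * sinInt g (omegaSq k) t := by
  have h1 : Continuous (fun τ => cosTime (omegaSq k) τ * g τ) :=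
    (continuous_cosTime_right _).mul hg
  have h2 : Continuous (fun τ => sinTime (omegaSq k) τ * g τ) :=
    (continuous_sinTime_right _).mul hg
  rw [timeTransform, cosInt, sinInt, ← intervalIntegral.integral_const_mul,
    ← intervalIntegral.integral_add (h1.intervalIntegrable _ _)
      ((h2.const_mul _).intervalIntegrable _ _)]
  congr 1; ext τ
  rw [show -I * -omega k * (τ : ℂ) = I * omega k * τ by ring, exp_omega_mul]; ring

end Duhamel

/-! ### The integrands in terms of `ω²` -/

theorem mu_ne_zero {k : ℂ} (hk : 1 + k ^ 2 ≠ 0) : mu k ≠ 0 := by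
  intro h; rw [← mu_sq, h] at hk; simp at hk

theorem mu_mul_omega {k : ℂ} (hk : 1 + k ^ 2 ≠ 0) : mu k * omega k = k := by
  have := mu_ne_zero hk
  rw [omega]; field_simp

theorem one_div_mu_mul_omega (k : ℂ) : 1 / mu k * omega k = k / (1 + k ^ 2) := by
  rw [omega, ← mu_sq]; ring

/-- The difference of exponentials is `2iω · sin(ωt)/ω`, and the factor `ω` combines with `μ` to
give `k`, so no square root survives. -/
theorem lineIntegrandR_eq (r₀ q₀ : ℝ → ℂ) (x t k : ℝ) :
    lineIntegrandR r₀ q₀ x t k = exp (I * k * x) * (cosTime (omegaSq k) t * halfLineFourier r₀ k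
      - I * k * sinTime (omegaSq k) t * halfLineFourier q₀ k) := by
  have hk : (1 : ℂ) + (k : ℂ) ^ 2 ≠ 0 := by
    norm_cast; positivity
  rw [lineIntegrandR, exp_omega_mul, exp_neg_omega_mul]
  linear_combination (-exp (I * k * x) * I * sinTime (omegaSq k) t * halfLineFourier q₀ k)
    * mu_mul_omega hk

theorem lineIntegrandQ_eq (r₀ q₀ : ℝ → ℂ) (x t k : ℝ) :
    lineIntegrandQ r₀ q₀ x t k = exp (I * k * x) * (cosTime (omegaSq k) t * halfLineFourier q₀ k
      - I * (k / (1 + k ^ 2)) * sinTime (omegaSq k) t * halfLineFourier r₀ k) := by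
  rw [lineIntegrandQ, exp_omega_mul, exp_neg_omega_mul]
  linear_combination (-exp (I * k * x) * I * sinTime (omegaSq k) t * halfLineFourier r₀ k)
    * one_div_mu_mul_omega (k : ℂ)

theorem contourIntegrandR₁_eq (r₀ q₀ : ℝ → ℂ) (x t : ℝ) {k : ℂ} (hk : 1 + k ^ 2 ≠ 0) :
    contourIntegrandR₁ r₀ q₀ x t k = exp (I * k * x) * (cosTime (omegaSq k) t * halfLineFourier r₀ (-k)
      + I * k * sinTime (omegaSq k) t * halfLineFourier q₀ (-k)) := by
  rw [contourIntegrandR₁, exp_omega_mul, exp_neg_omega_mul]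
  linear_combination (exp (I * k * x) * I * sinTime (omegaSq k) t * halfLineFourier q₀ (-k))
    * mu_mul_omega hk

theorem contourIntegrandQ₁_eq (r₀ q₀ : ℝ → ℂ) (x t : ℝ) (k : ℂ) :
    contourIntegrandQ₁ r₀ q₀ x t k = exp (I * k * x) * (cosTime (omegaSq k) t * halfLineFourier q₀ (-k)
      + I * (k / (1 + k ^ 2)) * sinTime (omegaSq k) t * halfLineFourier r₀ (-k)) := by
  rw [contourIntegrandQ₁, exp_omega_mul, exp_neg_omega_mul]
  linear_combination (exp (I * k * x) * I * sinTime (omegaSq k) t * halfLineFourier r₀ (-k))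
    * one_div_mu_mul_omega k

/-- Multiplying out `e^{±iωt}` and the transforms at `±ω` gives kernels in `ω(t-τ)`: the sum yields
twice the cosine convolution, while the difference yields a sine whose factor `ω` joins the
prefactor `iω` to make `-2ω²`. -/
theorem contourIntegrandR₂_eq {g₀ : ℝ → ℂ} (hg : Continuous g₀) (hg' : Continuous (deriv g₀))
    (x t : ℝ) (k : ℂ) :
    contourIntegrandR₂ g₀ x t k = exp (I * k * x) *
      (2 * cosConv g₀ (omegaSq k) t - 2 * omegaSq k * sinConv (deriv g₀) (omegaSq k) t) := by
  rw [contourIntegrandR₂, exp_omega_mul, exp_neg_omega_mul, timeTransform_omega hg,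
    timeTransform_neg_omega hg, timeTransform_omega hg', timeTransform_neg_omega hg',
    cosConv, sinConv, ← omega_sq]
  linear_combination (exp (I * k * x) * omega k ^ 2 * (-2 * sinTime (omega k ^ 2) t * sinInt g₀ (omega k ^ 2) t
    + 2 * (sinTime (omega k ^ 2) t * cosInt (deriv g₀) (omega k ^ 2) t
    - cosTime (omega k ^ 2) t * sinInt (deriv g₀) (omega k ^ 2) t))) * I_sq

theorem contourIntegrandQ₂_eq {g₀ : ℝ → ℂ} (hg : Continuous g₀) (hg' : Continuous (deriv g₀))
    (x t : ℝ) (k : ℂ) :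
    contourIntegrandQ₂ g₀ x t k = exp (I * k * x) *
      (2 * I * (k / (1 + k ^ 2)) * (sinConv g₀ (omegaSq k) t + cosConv (deriv g₀) (omegaSq k) t)) := by
  rw [contourIntegrandQ₂, exp_omega_mul, exp_neg_omega_mul, timeTransform_omega hg,
    timeTransform_neg_omega hg, timeTransform_omega hg', timeTransform_neg_omega hg',
    cosConv, sinConv]
  have h := omega_sq k
  linear_combination (2 * I * exp (I * k * x) * (sinTime (omegaSq k) t * cosInt g₀ (omegaSq k) t
    - cosTime (omegaSq k) t * sinInt g₀ (omegaSq k) t)) * one_div_mu_mul_omega k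
    + (exp (I * k * x) * I * k / (1 + k ^ 2) * (-2 * I ^ 2 * sinTime (omegaSq k) t * sinInt (deriv g₀) (omegaSq k) t)) * h
    + (exp (I * k * x) * I * k / (1 + k ^ 2) * (-2 * omegaSq k * sinTime (omegaSq k) t * sinInt (deriv g₀) (omegaSq k) t)) * I_sq

/-! ### The half-line Fourier transform of a Schwartz function -/

theorem norm_exp_neg_I_mul_le {k : ℂ} (hk : k.im ≤ 0) {x : ℝ} (hx : 0 ≤ x) :
    ‖exp (-I * k * x)‖ ≤ 1 := by
  rw [norm_exp, Real.exp_le_one_iff]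
  simp
  nlinarith

theorem one_add_I_mul_ne_zero {k : ℂ} (hk : k ≠ I) : 1 + I * k ≠ 0 := by
  intro h
  apply hk
  linear_combination (-I) * h + k * I_sq

theorem ne_I_of_im_nonpos {k : ℂ} (hk : k.im ≤ 0) : k ≠ I := by
  rintro rfl; norm_num at hk

section HalfLine

variable (f : 𝓢(ℝ, ℂ))

theorem norm_halfLine_integrand_le {k : ℂ} (hk : k.im ≤ 0) :
    ∀ᵐ x : ℝ ∂volume.restrict (Ioi 0), ‖exp (-I * k * x) * f x‖ ≤ ‖f x‖ := by
  filter_upwards [ae_restrict_mem measurableSet_Ioi] with x hx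
  rw [norm_mul]
  exact mul_le_of_le_one_left (norm_nonneg _) (norm_exp_neg_I_mul_le hk (le_of_lt hx))

theorem integrableOn_halfLine {k : ℂ} (hk : k.im ≤ 0) :
    IntegrableOn (fun x : ℝ => exp (-I * k * x) * f x) (Ioi 0) :=
  Integrable.mono f.integrable.integrableOn (by fun_prop) (norm_halfLine_integrand_le f hk)

theorem norm_halfLineFourier_le {k : ℂ} (hk : k.im ≤ 0) :
    ‖halfLineFourier f k‖ ≤ ∫ x in Ioi (0 : ℝ), ‖f x‖ :=
  norm_integral_le_of_norm_le f.integrable.integrableOn.norm (norm_halfLine_integrand_le f hk)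

theorem continuousOn_halfLineFourier :
    ContinuousOn (halfLineFourier f) {k : ℂ | k.im ≤ 0} := by
  refine continuousOn_of_dominated (bound := fun x => ‖f x‖) (fun k _ => by fun_prop)
    (fun k hk => norm_halfLine_integrand_le f hk) f.integrable.integrableOn.norm
    (ae_of_all _ fun x => by fun_prop)

/-- Differentiation under the integral, dominated for `Im k < 0` by the integrable function `|x|
|f(x)|`. -/
theorem differentiableOn_halfLineFourier :
    DifferentiableOn ℂ (halfLineFourier f) {k : ℂ | k.im < 0} := by
  intro k hk
  have hs : {k : ℂ | k.im < 0} ∈ 𝓝 k := (isOpen_lt continuous_im continuous_const).mem_nhds hk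
  have h := hasDerivAt_integral_of_dominated_loc_of_deriv_le (μ := volume.restrict (Ioi 0))
    (F := fun k (x : ℝ) => exp (-I * k * x) * f x)
    (F' := fun k (x : ℝ) => exp (-I * k * x) * (-I * x) * f x) (x₀ := k)
    (bound := fun x => ‖x‖ ^ 1 * ‖f x‖) hs (Eventually.of_forall fun k => by fun_prop)
    (integrableOn_halfLine f (le_of_lt hk)) (by fun_prop) ?_
    (f.integrable_pow_mul volume 1).integrableOn ?_
  · exact h.2.differentiableAt.differentiableWithinAt
  · filter_upwards [ae_restrict_mem measurableSet_Ioi] with x hx w hw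
    rw [norm_mul, norm_mul, pow_one]
    gcongr
    calc _ ≤ 1 * ‖-I * (x : ℂ)‖ := by
          gcongr; exact norm_exp_neg_I_mul_le (le_of_lt hw) (le_of_lt hx)
      _ = _ := by simp
  · refine ae_of_all _ fun x w _ => ?_
    have h1 : HasDerivAt (fun w : ℂ => -I * w * x) (-I * x) w := by
      simpa using ((hasDerivAt_id w).const_mul (-I)).mul_const (x : ℂ)
    exact h1.cexp.mul_const _

/-- The operator `f ↦ f + f'`. -/
def oneAddDeriv (f : 𝓢(ℝ, ℂ)) : 𝓢(ℝ, ℂ) := f + SchwartzMap.derivCLM ℂ ℂ f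

theorem oneAddDeriv_apply (x : ℝ) : oneAddDeriv f x = f x + deriv f x := by
  simp [oneAddDeriv]

/-- Integration by parts. Dividing by `1 + ik` instead of `ik` puts the pole at `i`, inside the
contour, and leaves the real line free of singularities. -/
theorem one_add_mul_halfLineFourier {k : ℂ} (hk : k.im ≤ 0) :
    (1 + I * k) * halfLineFourier f k = f 0 + halfLineFourier (oneAddDeriv f) k := by
  have hd : ∀ x ∈ Ici (0 : ℝ), HasDerivAt (fun x : ℝ => exp (-I * k * x) * f x)
      (exp (-I * k * x) * oneAddDeriv f x - (1 + I * k) * (exp (-I * k * x) * f x)) x := by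
    intro x _
    have h1 : HasDerivAt (fun y : ℝ => -I * k * (y : ℂ)) (-I * k) x := by
      simpa using ((hasDerivAt_id (x : ℂ)).const_mul (-I * k)).comp_ofReal
    convert! h1.cexp.mul (f.differentiableAt (x := x)).hasDerivAt using 1
    rw [oneAddDeriv_apply]; ring
  have hi := integrableOn_halfLine f hk
  have hi' := integrableOn_halfLine (oneAddDeriv f) hk
  have ht : Tendsto (fun x : ℝ => exp (-I * k * x) * f x) atTop (𝓝 0) := by
    refine squeeze_zero_norm' (a := fun x => ‖f x‖) ?_ ?_
    · filter_upwards [eventually_ge_atTop 0] with x hx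
      rw [norm_mul]
      exact mul_le_of_le_one_left (norm_nonneg _) (norm_exp_neg_I_mul_le hk hx)
    · have := (f.tendsto_cocompact.mono_left atTop_le_cocompact).norm
      simpa using this
  have h := integral_Ioi_of_hasDerivAt_of_tendsto' hd (hi'.sub (hi.const_mul _)) ht
  rw [integral_sub hi' (hi.const_mul _), integral_const_mul] at h
  simp only [ofReal_zero, mul_zero, exp_zero, one_mul, zero_sub] at h
  rw [halfLineFourier, halfLineFourier]
  linear_combination -h

/-- The part of the half-line Fourier transform that carries the boundary jets of `f` up to
order `n - 1`. It is the transform of a polynomial times `e^{-x}`. -/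
def jetFourier (n : ℕ) (k : ℂ) : ℂ :=
  ∑ j ∈ Finset.range n, (oneAddDeriv^[j] f) 0 / (1 + I * k) ^ (j + 1)

/-- The remaining part of the half-line Fourier transform; it decays like `k⁻ⁿ`. -/
def tailFourier (n : ℕ) (k : ℂ) : ℂ := halfLineFourier (oneAddDeriv^[n] f) k / (1 + I * k) ^ n

theorem halfLineFourier_eq_jet_add_tail (n : ℕ) {k : ℂ} (hk : k.im ≤ 0) :
    halfLineFourier f k = jetFourier f n k + tailFourier f n k := by
  have h0 := one_add_I_mul_ne_zero (ne_I_of_im_nonpos hk)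
  induction n with
  | zero => simp [jetFourier, tailFourier]
  | succ n ih =>
    rw [ih, jetFourier, jetFourier, Finset.sum_range_succ, add_assoc]
    congr 1
    have h := one_add_mul_halfLineFourier (oneAddDeriv^[n] f) hk
    rw [tailFourier, tailFourier, Function.iterate_succ_apply', ← add_div, ← h, pow_succ]
    field_simp

theorem norm_tailFourier_le (n : ℕ) : ∃ M : ℝ, 0 ≤ M ∧ ∀ k : ℂ, k.im ≤ 0 →
    ‖tailFourier f n k‖ ≤ M / ‖1 + I * k‖ ^ n := by
  refine ⟨∫ x in Ioi (0 : ℝ), ‖(oneAddDeriv^[n] f) x‖, integral_nonneg fun _ => norm_nonneg _,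
    fun k hk => ?_⟩
  rw [tailFourier, norm_div, norm_pow]
  gcongr
  exact norm_halfLineFourier_le _ hk

theorem continuousOn_tailFourier (n : ℕ) :
    ContinuousOn (tailFourier f n) {k : ℂ | k.im ≤ 0} :=
  (continuousOn_halfLineFourier _).div (by fun_prop)
    fun _ hk => pow_ne_zero _ (one_add_I_mul_ne_zero (ne_I_of_im_nonpos hk))

theorem differentiableOn_tailFourier (n : ℕ) :
    DifferentiableOn ℂ (tailFourier f n) {k : ℂ | k.im < 0} :=
  (differentiableOn_halfLineFourier _).div (by fun_prop)
    fun _ hk => pow_ne_zero _ (one_add_I_mul_ne_zero (ne_I_of_im_nonpos (le_of_lt hk)))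

end HalfLine

/-! ### Fourier inversion with a Gaussian cut-off -/

open scoped FourierTransform in
theorem hasGaussIntegral_halfLineFourier (f : 𝓢(ℝ, ℂ)) {x : ℝ} (hx : 0 < x) :
    HasGaussIntegral (fun k : ℝ => exp (I * k * x) * halfLineFourier f k) (2 * Real.pi * f x) := by
  set F : ℝ → ℂ := (Ioi (0 : ℝ)).indicator f with hF
  have hFi : Integrable F := f.integrable.indicator measurableSet_Ioi
  have hFx : F x = f x := indicator_of_mem hx f
  have hFc : ContinuousAt F x := by
    refine f.continuous.continuousAt.congr ?_
    filter_upwards [Ioi_mem_nhds hx] with y hy using (indicator_of_mem hy f).symm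
  -- With the kernel `e^{-2πiwy}`, the transform of the truncated function at `w` is the half-line
  -- transform at `k = 2πw`.
  have hhat : ∀ w : ℝ, 𝓕 F w = halfLineFourier f ((2 * Real.pi * w : ℝ) : ℂ) := by
    intro w
    rw [Real.fourier_eq', halfLineFourier, ← integral_indicator measurableSet_Ioi]
    congr 1; ext y
    by_cases hy : y ∈ Ioi (0 : ℝ)
    · rw [indicator_of_mem hy, hF, indicator_of_mem hy, smul_eq_mul]
      congr 2
      simp
      ring
    · rw [indicator_of_notMem hy, hF, indicator_of_notMem hy, smul_zero]
  have key := Real.tendsto_integral_gaussian_smul' hFi hFc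
  -- With `c = 1/(4π²ε)` the weight `e^{-w²/c}` becomes `e^{-εk²}` under `k = 2πw`. Letting `ε → 0⁺`
  -- sends `c → ∞`, where Gaussian approximate identities recover the value at the continuity point
  -- `x > 0`.
  have hc : Tendsto (fun ε : ℝ => (4 * Real.pi ^ 2 * ε)⁻¹) (𝓝[>] 0) atTop := by
    refine tendsto_inv_nhdsGT_zero.comp ?_
    refine tendsto_nhdsWithin_of_tendsto_nhds_of_eventually_within _ ?_ ?_
    · have : Continuous fun ε : ℝ => 4 * Real.pi ^ 2 * ε := by fun_prop
      simpa using this.continuousAt.tendsto.mono_left (x := 𝓝 (0 : ℝ)) nhdsWithin_le_nhds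
    · filter_upwards [self_mem_nhdsWithin] with ε hε
      have : 0 < ε := hε
      simp; positivity
  have key2 := ((key.comp hc).const_mul (2 * Real.pi : ℂ))
  rw [hFx] at key2
  refine key2.congr' ?_
  filter_upwards [self_mem_nhdsWithin] with ε hε
  have hε : 0 < ε := hε
  set c : ℝ := (4 * Real.pi ^ 2 * ε)⁻¹ with hcdef
  have hc0 : 0 < c := by positivity
  have J : Integrable (fun w : ℝ ↦ cexp (- c⁻¹ * ‖w‖ ^ 2 + 2 * Real.pi * I * inner ℝ x w)) :=
    GaussianFourier.integrable_cexp_neg_mul_sq_norm_add (by simpa) _ _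
  -- Self-adjointness of the Fourier transform moves it from the modulated Gaussian to `F`; the
  -- transform of that Gaussian is the heat kernel centred at `x`.
  have hflip : ∫ w : ℝ, 𝓕 (fun w : ℝ ↦ cexp (- c⁻¹ * ‖w‖ ^ 2 + 2 * Real.pi * I * inner ℝ x w)) w • F w
      = ∫ w : ℝ, cexp (- c⁻¹ * ‖w‖ ^ 2 + 2 * Real.pi * I * inner ℝ x w) • 𝓕 F w := by
    simpa using! (VectorFourier.integral_fourierIntegral_smul_eq_flip (L := innerₗ ℝ)
      Real.continuous_fourierChar continuous_inner J hFi)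
  have hgauss : ∫ w : ℝ, ((Real.pi * c : ℂ) ^ (Module.finrank ℝ ℝ / 2 : ℂ) *
      cexp (-Real.pi ^ 2 * c * ‖x - w‖ ^ 2)) • F w
      = ∫ w : ℝ, 𝓕 (fun w : ℝ ↦ cexp (- c⁻¹ * ‖w‖ ^ 2 + 2 * Real.pi * I * inner ℝ x w)) w • F w := by
    congr with w
    rw [fourier_gaussian_innerProductSpace' (by simpa)]
    congr 2
    · simp
    · congr 1; simp; ring
  simp only [Function.comp_apply]
  rw [hgauss, hflip]
  set G : ℝ → ℂ := fun k => (Real.exp (-ε * k ^ 2) : ℂ) * (exp (I * k * x) * halfLineFourier f k) with hG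
  have hsub : ∫ w : ℝ, G ((2 * Real.pi) * w) = |(2 * Real.pi)⁻¹| • ∫ k, G k :=
    Measure.integral_comp_mul_left G (2 * Real.pi)
  have hGw : (fun w : ℝ => cexp (- c⁻¹ * ‖w‖ ^ 2 + 2 * Real.pi * I * inner ℝ x w) • 𝓕 F w)
      = fun w => G ((2 * Real.pi) * w) := by
    ext w
    simp only [hG]
    rw [hhat, smul_eq_mul, ← mul_assoc, ofReal_exp, ← exp_add]
    congr 2
    have : ((c⁻¹ : ℝ) : ℂ) = 4 * Real.pi ^ 2 * ε := by rw [hcdef, inv_inv]; push_cast; ring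
    simp only [this, ← ofReal_pow, Real.norm_eq_abs, sq_abs]
    simp
    ring
  have hpi : (2 * Real.pi : ℝ) ≠ 0 := by positivity
  rw [hGw, hsub, abs_of_pos (by positivity), real_smul]
  push_cast
  have : (Real.pi : ℂ) ≠ 0 := by exact_mod_cast Real.pi_ne_zero
  field_simp

/-! ### Contour integrals and rectangles in the upper half-plane -/

/-- The open upper half-plane. -/
def upper : Set ℂ := {k | 0 < k.im}

/-- The closed upper half-plane. -/
def closedUpper : Set ℂ := {k | 0 ≤ k.im}

theorem isOpen_upper : IsOpen upper := isOpen_lt continuous_const continuous_im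

theorem upper_subset_closedUpper : upper ⊆ closedUpper := fun k h => (show 0 < k.im from h).le

theorem I_mem_upper : I ∈ upper := by simp [upper]

theorem upper_mem_nhds_I : upper ∈ 𝓝 I := isOpen_upper.mem_nhds I_mem_upper

theorem closedUpper_mem_nhds_I : closedUpper ∈ 𝓝 I :=
  mem_of_superset upper_mem_nhds_I upper_subset_closedUpper

/-- The domain on which the integrands live: the closed upper half-plane without `i`. -/
def puncturedUpper : Set ℂ := closedUpper \ {I}

theorem sub_I_ne_zero {k : ℂ} (hk : k ∈ puncturedUpper) : k - I ≠ 0 := sub_ne_zero.2 hk.2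

theorem add_I_ne_zero {k : ℂ} (hk : k ∈ closedUpper) : k + I ≠ 0 := by
  intro h
  have h1 : k.im + 1 = 0 := by simpa using congrArg im h
  have h2 : 0 ≤ k.im := hk
  linarith

theorem one_add_sq_eq (k : ℂ) : 1 + k ^ 2 = (k + I) * (k - I) := by
  linear_combination I_sq

theorem one_add_sq_ne_zero {k : ℂ} (hk : k ∈ puncturedUpper) : 1 + k ^ 2 ≠ 0 := by
  rw [one_add_sq_eq]
  exact mul_ne_zero (add_I_ne_zero hk.1) (sub_I_ne_zero hk)

theorem continuousOn_omegaSq : ContinuousOn omegaSq puncturedUpper :=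
  ContinuousOn.div (by fun_prop) (by fun_prop) fun _ hk => one_add_sq_ne_zero hk

section Contour

variable {γ : ℝ → ℂ}

theorem IsContourAroundI.mem_upper (hγ : IsContourAroundI γ) {u : ℝ} (hu : u ∈ Icc (0 : ℝ) 1) :
    γ u ∈ upper := hγ.im_pos u hu

theorem IsContourAroundI.mem_puncturedUpper (hγ : IsContourAroundI γ) {u : ℝ}
    (hu : u ∈ Icc (0 : ℝ) 1) : γ u ∈ puncturedUpper :=
  ⟨upper_subset_closedUpper (hγ.mem_upper hu), hγ.ne_I u hu⟩

theorem IsContourAroundI.continuousOn_derivWithin (hγ : IsContourAroundI γ) :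
    ContinuousOn (derivWithin γ (Icc 0 1)) (Icc 0 1) :=
  hγ.contDiffOn.continuousOn_derivWithin (uniqueDiffOn_Icc one_pos) le_rfl

theorem IsContourAroundI.hasDerivAt (hγ : IsContourAroundI γ) {u : ℝ} (hu : u ∈ Ioo (0 : ℝ) 1) :
    HasDerivAt γ (derivWithin γ (Icc 0 1) u) u :=
  ((hγ.contDiffOn.differentiableOn one_ne_zero) u (Ioo_subset_Icc_self hu)).hasDerivWithinAt.hasDerivAt
    (Icc_mem_nhds hu.1 hu.2)

theorem IsContourAroundI.intervalIntegrable (hγ : IsContourAroundI γ) {F : ℂ → ℂ}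
    (hF : ContinuousOn (fun u => F (γ u)) (Icc 0 1)) :
    IntervalIntegrable (fun u => F (γ u) * derivWithin γ (Icc 0 1) u) volume 0 1 := by
  refine (hF.mul hγ.continuousOn_derivWithin).intervalIntegrable_of_Icc zero_le_one

theorem contourIntegral_congr {F G : ℂ → ℂ} (h : ∀ u ∈ Icc (0 : ℝ) 1, F (γ u) = G (γ u)) :
    contourIntegral γ F = contourIntegral γ G := by
  refine intervalIntegral.integral_congr fun u hu => ?_
  rw [uIcc_of_le zero_le_one] at hu
  simp only [h u hu]

theorem IsContourAroundI.comp_continuousOn (hγ : IsContourAroundI γ) {F : ℂ → ℂ}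
    (hF : ContinuousOn F puncturedUpper) : ContinuousOn (fun u => F (γ u)) (Icc 0 1) :=
  hF.comp hγ.contDiffOn.continuousOn fun _ hu => hγ.mem_puncturedUpper hu

theorem IsContourAroundI.contourIntegral_add (hγ : IsContourAroundI γ) {F G : ℂ → ℂ}
    (hF : ContinuousOn F puncturedUpper) (hG : ContinuousOn G puncturedUpper) :
    contourIntegral γ (fun k => F k + G k) = contourIntegral γ F + contourIntegral γ G := by
  rw [contourIntegral, contourIntegral, contourIntegral, ← intervalIntegral.integral_add
    (hγ.intervalIntegrable (hγ.comp_continuousOn hF))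
    (hγ.intervalIntegrable (hγ.comp_continuousOn hG))]
  simp only [add_mul]

theorem contourIntegral_const_mul (c : ℂ) (F : ℂ → ℂ) :
    contourIntegral γ (fun k => c * F k) = c * contourIntegral γ F := by
  rw [contourIntegral, contourIntegral, ← intervalIntegral.integral_const_mul]
  simp only [mul_assoc]

theorem IsContourAroundI.contourIntegral_sub (hγ : IsContourAroundI γ) {F G : ℂ → ℂ}
    (hF : ContinuousOn F puncturedUpper) (hG : ContinuousOn G puncturedUpper) :
    contourIntegral γ (fun k => F k - G k) = contourIntegral γ F - contourIntegral γ G := by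
  rw [contourIntegral, contourIntegral, contourIntegral, ← intervalIntegral.integral_sub
    (hγ.intervalIntegrable (hγ.comp_continuousOn hF))
    (hγ.intervalIntegrable (hγ.comp_continuousOn hG))]
  simp only [sub_mul]

/-- The integral of a derivative over a closed contour vanishes. -/
theorem IsContourAroundI.contourIntegral_eq_zero_of_hasDerivAt (hγ : IsContourAroundI γ)
    {f f' : ℂ → ℂ} (hf : ∀ u ∈ Icc (0 : ℝ) 1, HasDerivAt f (f' (γ u)) (γ u))
    (hf' : ContinuousOn (fun u => f' (γ u)) (Icc 0 1)) : contourIntegral γ f' = 0 := by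
  rw [contourIntegral, intervalIntegral.integral_eq_sub_of_hasDerivAt_of_le (f := fun u => f (γ u))
    zero_le_one ?_ ?_ (hγ.intervalIntegrable hf'), hγ.closed, sub_self]
  · intro u hu
    exact (hf u hu).continuousAt.comp_continuousWithinAt (hγ.contDiffOn.continuousOn u hu)
  · intro u hu
    exact (hf u (Ioo_subset_Icc_self hu)).comp_of_eq u (hγ.hasDerivAt hu) rfl

/-- A compact subset of the upper half-plane lies in a disc contained in the upper half-plane. -/
theorem exists_ball_subset_upper {K : Set ℂ} (hK : IsCompact K) (hKu : K ⊆ upper) :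
    ∃ R : ℝ, 0 < R ∧ K ⊆ Metric.ball (R * I) R ∧ Metric.ball (R * I) R ⊆ upper := by
  -- For `Im k > 0`, the point `k` lies in the disc of radius `R` about `Ri` exactly when `|k|²/(2
  -- Im k) < R`; this quotient is bounded on compact sets.
  have hc : ContinuousOn (fun k : ℂ => ‖k‖ ^ 2 / (2 * k.im)) K := by
    refine ContinuousOn.div (by fun_prop) (by fun_prop) fun k hk => ?_
    have : 0 < k.im := hKu hk
    positivity
  obtain ⟨M, hM⟩ := hK.exists_bound_of_continuousOn hc
  have hsq : ∀ (R : ℝ) (k : ℂ), ‖k - R * I‖ ^ 2 = ‖k‖ ^ 2 - 2 * R * k.im + R ^ 2 := by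
    intro R k
    rw [← normSq_eq_norm_sq, ← normSq_eq_norm_sq, normSq_apply, normSq_apply]
    simp; ring
  refine ⟨|M| + 1, by positivity, fun k hk => ?_, fun k hk => ?_⟩
  · have hi : 0 < k.im := hKu hk
    have h1 := hM k hk
    rw [Real.norm_eq_abs, abs_of_nonneg (by positivity), div_le_iff₀ (by positivity)] at h1
    rw [mem_ball_iff_norm]
    refine lt_of_pow_lt_pow_left₀ 2 (by positivity) ?_
    rw [hsq]
    nlinarith [le_abs_self M]
  · rw [mem_ball_iff_norm] at hk
    have h1 := pow_lt_pow_left₀ hk (norm_nonneg _) two_ne_zero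
    rw [hsq] at h1
    have h2 : 0 < |M| + 1 := by positivity
    have h3 := sq_nonneg ‖k‖
    show 0 < k.im
    by_contra hneg
    push Not at hneg
    nlinarith

/-- Cauchy's theorem for a closed contour in the upper half-plane. -/
theorem IsContourAroundI.contourIntegral_eq_zero (hγ : IsContourAroundI γ) {f : ℂ → ℂ}
    (hf : DifferentiableOn ℂ f upper) : contourIntegral γ f = 0 := by
  have hK : IsCompact (γ '' Icc 0 1) := isCompact_Icc.image_of_continuousOn hγ.contDiffOn.continuousOn
  -- On a disc every holomorphic function has a primitive, so no homotopy argument is needed for the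
  -- curve.
  obtain ⟨R, -, hR, hRu⟩ := exists_ball_subset_upper hK
    (by rintro _ ⟨u, hu, rfl⟩; exact hγ.mem_upper hu)
  obtain ⟨F, hF⟩ := (hf.mono hRu).isExactOn_ball
  refine hγ.contourIntegral_eq_zero_of_hasDerivAt (f := F)
    (fun u hu => hF _ (hR (mem_image_of_mem γ hu))) ?_
  exact hf.continuousOn.comp hγ.contDiffOn.continuousOn fun u hu => hγ.mem_upper hu

/-- The integral along the boundary of the rectangle `[a, b] × [0, H]`. -/
def rectIntegral (F : ℂ → ℂ) (a b H : ℝ) : ℂ :=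
  (∫ x in a..b, F (x + (0 : ℝ) * I)) - (∫ x in a..b, F (x + H * I))
    + I * (∫ y in (0 : ℝ)..H, F (b + y * I)) - I * ∫ y in (0 : ℝ)..H, F (a + y * I)

/-- The integral of `F` along `γ` agrees with the integral along the boundary of each rectangle
in the upper half-plane that is based on the real axis and contains `i`. -/
structure RectContour (γ : ℝ → ℂ) (F : ℂ → ℂ) : Prop where
  continuousOn : ContinuousOn F puncturedUpper
  eq : ∀ a b H : ℝ, a < 0 → 0 < b → 1 < H → rectIntegral F a b H = contourIntegral γ F

theorem real_mem_puncturedUpper (x : ℝ) : (x : ℂ) + (0 : ℝ) * I ∈ puncturedUpper := by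
  refine ⟨by simp [closedUpper], fun h => ?_⟩
  have := congrArg im (mem_singleton_iff.1 h)
  simp at this

theorem horizontal_mem_puncturedUpper (x : ℝ) {H : ℝ} (hH : 1 < H) :
    (x : ℂ) + H * I ∈ puncturedUpper := by
  refine ⟨by simp [closedUpper]; linarith, fun h => ?_⟩
  have := congrArg im (mem_singleton_iff.1 h)
  simp at this; linarith

theorem vertical_mem_puncturedUpper {x : ℝ} (hx : x ≠ 0) {y : ℝ} (hy : 0 ≤ y) :
    (x : ℂ) + y * I ∈ puncturedUpper := by
  refine ⟨by simpa [closedUpper] using hy, fun h => ?_⟩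
  have := congrArg re (mem_singleton_iff.1 h)
  simp at this; exact hx this

section Sides

variable {F : ℂ → ℂ} {a b H : ℝ}

theorem continuousOn_real (hF : ContinuousOn F puncturedUpper) :
    Continuous (fun x : ℝ => F (x + (0 : ℝ) * I)) :=
  hF.comp_continuous (by fun_prop) real_mem_puncturedUpper

theorem continuousOn_horizontal (hF : ContinuousOn F puncturedUpper) (hH : 1 < H) :
    Continuous (fun x : ℝ => F (x + H * I)) :=
  hF.comp_continuous (by fun_prop) fun x => horizontal_mem_puncturedUpper x hH

theorem continuousOn_vertical (hF : ContinuousOn F puncturedUpper) (hb : b ≠ 0) (hH : 0 ≤ H) :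
    ContinuousOn (fun y : ℝ => F (b + y * I)) (uIcc 0 H) := by
  refine hF.comp (by fun_prop) fun y hy => ?_
  rw [uIcc_of_le hH] at hy
  exact vertical_mem_puncturedUpper hb hy.1

end Sides

theorem RectContour.congr {F G : ℂ → ℂ} (hF : RectContour γ F) (hγ : IsContourAroundI γ)
    (h : EqOn G F puncturedUpper) : RectContour γ G := by
  refine ⟨hF.continuousOn.congr h, fun a b H ha hb hH => ?_⟩
  rw [contourIntegral_congr fun u hu => h (hγ.mem_puncturedUpper hu), ← hF.eq a b H ha hb hH]
  have hv : ∀ c : ℝ, c ≠ 0 → ∫ y in (0 : ℝ)..H, G (c + y * I) = ∫ y in (0 : ℝ)..H, F (c + y * I) := by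
    intro c hc
    refine intervalIntegral.integral_congr fun y hy => ?_
    rw [uIcc_of_le (by linarith)] at hy
    exact h (vertical_mem_puncturedUpper hc hy.1)
  rw [rectIntegral, rectIntegral, hv a ha.ne, hv b hb.ne']
  simp only [h (real_mem_puncturedUpper _), h (horizontal_mem_puncturedUpper _ hH)]

theorem RectContour.add {F G : ℂ → ℂ} (hγ : IsContourAroundI γ) (hF : RectContour γ F)
    (hG : RectContour γ G) : RectContour γ (fun k => F k + G k) := by
  refine ⟨hF.continuousOn.add hG.continuousOn, fun a b H ha hb hH => ?_⟩
  rw [hγ.contourIntegral_add hF.continuousOn hG.continuousOn, ← hF.eq a b H ha hb hH,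
    ← hG.eq a b H ha hb hH]
  have hH0 : 0 ≤ H := by linarith
  have hv : ∀ c : ℝ, c ≠ 0 → ∫ y in (0 : ℝ)..H, (F (c + y * I) + G (c + y * I))
      = (∫ y in (0 : ℝ)..H, F (c + y * I)) + ∫ y in (0 : ℝ)..H, G (c + y * I) := fun c hc =>
    intervalIntegral.integral_add (continuousOn_vertical hF.continuousOn hc hH0).intervalIntegrable
      (continuousOn_vertical hG.continuousOn hc hH0).intervalIntegrable
  rw [rectIntegral, rectIntegral, rectIntegral, hv a ha.ne, hv b hb.ne',
    intervalIntegral.integral_add ((continuousOn_real hF.continuousOn).intervalIntegrable _ _)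
      ((continuousOn_real hG.continuousOn).intervalIntegrable _ _),
    intervalIntegral.integral_add ((continuousOn_horizontal hF.continuousOn hH).intervalIntegrable _ _)
      ((continuousOn_horizontal hG.continuousOn hH).intervalIntegrable _ _)]
  ring

theorem RectContour.const_mul {F : ℂ → ℂ} (hF : RectContour γ F) (c : ℂ) :
    RectContour γ (fun k => c * F k) := by
  refine ⟨hF.continuousOn.const_mul c, fun a b H ha hb hH => ?_⟩
  rw [contourIntegral_const_mul, ← hF.eq a b H ha hb hH, rectIntegral, rectIntegral]
  simp only [intervalIntegral.integral_const_mul]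
  ring

theorem RectContour.sub {F G : ℂ → ℂ} (hγ : IsContourAroundI γ) (hF : RectContour γ F)
    (hG : RectContour γ G) : RectContour γ (fun k => F k - G k) :=
  (hF.add hγ (hG.const_mul (-1))).congr hγ fun k _ => by ring

/-- Both integrals vanish by Cauchy's theorem. The version for rectangles needs holomorphy only in
the open rectangle, so continuity suffices on the real side. -/
theorem rectContour_of_differentiableOn (hγ : IsContourAroundI γ) {f : ℂ → ℂ}
    (hc : ContinuousOn f closedUpper) (hd : DifferentiableOn ℂ f upper) : RectContour γ f := by
  refine ⟨hc.mono sdiff_subset, fun a b H ha hb hH => ?_⟩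
  rw [hγ.contourIntegral_eq_zero hd]
  have h := integral_boundary_rect_eq_zero_of_continuousOn_of_differentiableOn f (a : ℂ) (b + H * I)
    (hc.mono ?_) (hd.mono ?_)
  · simpa [rectIntegral] using h
  · intro k hk
    have := hk.2
    simp [uIcc_of_le (by linarith : (0 : ℝ) ≤ H)] at this
    exact this.1
  · intro k hk
    have := hk.2
    simp [min_eq_left (by linarith : (0 : ℝ) ≤ H)] at this
    exact this.1

theorem integral_horizontal_eq_sub {Φ F : ℂ → ℂ} {a b y : ℝ}
    (hΦ : ∀ x ∈ uIcc a b, HasDerivAt Φ (F (x + y * I)) (x + y * I))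
    (hF : ContinuousOn (fun x : ℝ => F (x + y * I)) (uIcc a b)) :
    ∫ x in a..b, F (x + y * I) = Φ (b + y * I) - Φ (a + y * I) := by
  rw [intervalIntegral.integral_eq_sub_of_hasDerivAt (f := fun x : ℝ => Φ (x + y * I))
    (fun x hx => ?_) hF.intervalIntegrable]
  have h1 : HasDerivAt (fun x : ℂ => x + y * I) 1 (x : ℂ) := (hasDerivAt_id _).add_const _
  simpa using ((hΦ x hx).comp (x : ℂ) h1).comp_ofReal

theorem integral_vertical_eq_sub {Φ F : ℂ → ℂ} {a b x : ℝ}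
    (hΦ : ∀ y ∈ uIcc a b, HasDerivAt Φ (F (x + y * I)) (x + y * I))
    (hF : ContinuousOn (fun y : ℝ => F (x + y * I)) (uIcc a b)) :
    I * ∫ y in a..b, F (x + y * I) = Φ (x + b * I) - Φ (x + a * I) := by
  rw [← intervalIntegral.integral_const_mul,
    intervalIntegral.integral_eq_sub_of_hasDerivAt (f := fun y : ℝ => Φ (x + y * I))
    (fun y hy => ?_) (hF.const_mul I).intervalIntegrable]
  have h1 : HasDerivAt (fun y : ℂ => x + y * I) I (y : ℂ) := by
    simpa using ((hasDerivAt_id (y : ℂ)).mul_const I).const_add (x : ℂ)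
  simpa [mul_comm] using ((hΦ y hy).comp (y : ℂ) h1).comp_ofReal

/-- A single-valued primitive telescopes around either closed path, so both integrals are zero. -/
theorem rectContour_of_hasDerivAt (hγ : IsContourAroundI γ) {Φ F : ℂ → ℂ}
    (hΦ : ∀ k ∈ puncturedUpper, HasDerivAt Φ (F k) k) (hF : ContinuousOn F puncturedUpper) :
    RectContour γ F := by
  refine ⟨hF, fun a b H ha hb hH => ?_⟩
  have hH0 : 0 ≤ H := by linarith
  have hv : ∀ c : ℝ, c ≠ 0 → I * ∫ y in (0 : ℝ)..H, F (c + y * I)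
      = Φ (c + H * I) - Φ (c + (0 : ℝ) * I) := fun c hc =>
    integral_vertical_eq_sub (fun y hy => hΦ _ (vertical_mem_puncturedUpper hc
      (by rw [uIcc_of_le hH0] at hy; exact hy.1))) (continuousOn_vertical hF hc hH0)
  rw [hγ.contourIntegral_eq_zero_of_hasDerivAt (f := Φ) (fun u hu => hΦ _ (hγ.mem_puncturedUpper hu))
    (hγ.comp_continuousOn hF), rectIntegral, hv a ha.ne, hv b hb.ne',
    integral_horizontal_eq_sub (fun x _ => hΦ _ (real_mem_puncturedUpper x))
      (continuousOn_real hF).continuousOn,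
    integral_horizontal_eq_sub (fun x _ => hΦ _ (horizontal_mem_puncturedUpper x hH))
      (continuousOn_horizontal hF hH).continuousOn]
  ring

theorem rectIntegral_inv {a b H : ℝ} (ha : a < 0) (hb : 0 < b) (hH : 1 < H) :
    rectIntegral (fun k => 1 / (k - I)) a b H = 2 * Real.pi * I := by
  have hH0 : 0 ≤ H := by linarith
  have hF : ContinuousOn (fun k : ℂ => 1 / (k - I)) puncturedUpper :=
    ContinuousOn.div (by fun_prop) (by fun_prop) fun k hk => sub_I_ne_zero hk
  -- Two branches of the logarithm are used: this one is cut along the ray from `i` downwards and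
  -- serves the vertical and top sides; the next is cut upwards and serves the bottom side. At the
  -- two lower corners they differ by `πi` with opposite signs, and these jumps add up to `2πi`.
  have hup : ∀ k : ℂ, -I * (k - I) ∈ slitPlane →
      HasDerivAt (fun k => log (-I * (k - I))) (1 / (k - I)) k := by
    intro k hk
    have h0 : k - I ≠ 0 := by rintro h; simp [h] at hk
    have h1 : HasDerivAt (fun k : ℂ => -I * (k - I)) (-I) k := by
      simpa using ((hasDerivAt_id k).sub_const I).const_mul (-I)
    convert! h1.clog hk using 1
    have := I_ne_zero
    field_simp
  have hdown : ∀ k : ℂ, I * (k - I) ∈ slitPlane →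
      HasDerivAt (fun k => log (I * (k - I))) (1 / (k - I)) k := by
    intro k hk
    have h0 : k - I ≠ 0 := by rintro h; simp [h] at hk
    have h1 : HasDerivAt (fun k : ℂ => I * (k - I)) I k := by
      simpa using ((hasDerivAt_id k).sub_const I).const_mul I
    convert! h1.clog hk using 1
    have := I_ne_zero
    field_simp
  have hv : ∀ c : ℝ, c ≠ 0 → I * ∫ y in (0 : ℝ)..H, 1 / ((c : ℂ) + y * I - I)
      = log (-I * (c + H * I - I)) - log (-I * (c + (0 : ℝ) * I - I)) := by
    intro c hc
    refine integral_vertical_eq_sub (F := fun k => 1 / (k - I)) (Φ := fun k => log (-I * (k - I)))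
      (fun y hy => hup _ ?_) (continuousOn_vertical hF hc hH0)
    rw [mem_slitPlane_iff]; right; simpa using hc
  have h0 := integral_horizontal_eq_sub (F := fun k => 1 / (k - I))
    (Φ := fun k => log (I * (k - I))) (a := a) (b := b) (y := 0)
    (fun x hx => hdown _ (by rw [mem_slitPlane_iff]; left; simp))
    (continuousOn_real hF).continuousOn
  have h1 := integral_horizontal_eq_sub (F := fun k => 1 / (k - I))
    (Φ := fun k => log (-I * (k - I))) (a := a) (b := b) (y := H)
    (fun x hx => hup _ (by rw [mem_slitPlane_iff]; left; simpa using hH))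
    (continuousOn_horizontal hF hH).continuousOn
  rw [rectIntegral, hv a ha.ne, hv b hb.ne', h0, h1]
  have e1 : ∀ c : ℝ, I * ((c : ℂ) + (0 : ℝ) * I - I) = 1 + c * I := by
    intro c; push_cast; linear_combination -I_sq
  have e2 : ∀ c : ℝ, -I * ((c : ℂ) + (0 : ℝ) * I - I) = -(1 + c * I) := by
    intro c; push_cast; linear_combination I_sq
  rw [e1, e1, e2, e2]
  have hlb : log (-(1 + (b : ℂ) * I)) = log (1 + b * I) - Real.pi * I := by
    rw [log, log, norm_neg, arg_neg_eq_arg_sub_pi_of_im_pos (by simpa using hb)]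
    push_cast; ring
  have hla : log (-(1 + (a : ℂ) * I)) = log (1 + a * I) + Real.pi * I := by
    rw [log, log, norm_neg, arg_neg_eq_arg_add_pi_of_im_neg (by simpa using ha)]
    push_cast; ring
  rw [hlb, hla]
  ring

theorem rectContour_inv (hγ : IsContourAroundI γ) : RectContour γ (fun k => 1 / (k - I)) :=
  ⟨ContinuousOn.div (by fun_prop) (by fun_prop) fun _ hk => sub_I_ne_zero hk,
    fun a b H ha hb hH => by rw [rectIntegral_inv ha hb hH, hγ.winding]⟩

theorem rectContour_inv_pow (hγ : IsContourAroundI γ) (n : ℕ) :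
    RectContour γ (fun k => 1 / (k - I) ^ (n + 1)) := by
  -- Only the simple pole sees the winding number; each higher power has a primitive on the
  -- punctured half-plane.
  rcases n with _ | n
  · simpa using rectContour_inv hγ
  refine rectContour_of_hasDerivAt hγ (Φ := fun k => (-1 / (n + 1)) * ((k - I) ^ (n + 1))⁻¹)
    (fun k hk => ?_) (ContinuousOn.div (by fun_prop) (by fun_prop)
      fun k hk => pow_ne_zero _ (sub_I_ne_zero hk))
  have h0 := sub_I_ne_zero hk
  have h1 : HasDerivAt (fun k : ℂ => (k - I) ^ (n + 1)) ((n + 1) * (k - I) ^ n) k := by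
    simpa using ((hasDerivAt_id k).sub_const I).fun_pow (n + 1)
  convert! (h1.inv (pow_ne_zero _ h0)).const_mul (-1 / ((n : ℂ) + 1)) using 1
  have : (n : ℂ) + 1 ≠ 0 := by exact_mod_cast n.succ_ne_zero
  field_simp
  ring

/-- The contour may be replaced by a rectangle for functions with a pole at `i`. -/
theorem rectContour_div_pow (hγ : IsContourAroundI γ) (n : ℕ) : ∀ {f : ℂ → ℂ},
    ContinuousOn f closedUpper → DifferentiableOn ℂ f upper →
    RectContour γ (fun k => f k / (k - I) ^ n) := by
  induction n with
  | zero => intro f hc hd; simpa using rectContour_of_differentiableOn hγ hc hd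
  | succ n ih =>
    intro f hc hd
    have hdI : DifferentiableAt ℂ f I := hd.differentiableAt upper_mem_nhds_I
    -- Writing `f(k) = f(i) + (k-i) g(k)` with `g` the divided slope, again holomorphic, lowers the
    -- order of the pole by one.
    have h1 := ih ((continuousOn_dslope closedUpper_mem_nhds_I).2 ⟨hc, hdI⟩)
      ((differentiableOn_dslope upper_mem_nhds_I).2 hd)
    refine (((rectContour_inv_pow hγ n).const_mul (f I)).add hγ h1).congr hγ fun k hk => ?_
    have h0 := sub_I_ne_zero hk
    have h2 := sub_smul_dslope f I k
    rw [smul_eq_mul] at h2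
    simp only
    rw [pow_succ]
    field_simp
    linear_combination -h2

/-- Along a compact path avoiding `i` the values of `ω²` stay bounded, so the Taylor series of `E`
at `0` may be integrated term by term. The weight `w` is `γ'` on the contour and `1` on a side of a
rectangle. -/
theorem hasSum_integral_entire_comp {E : ℂ → ℂ} (hE : Differentiable ℂ E) {g : ℂ → ℂ}
    (hg : ContinuousOn g puncturedUpper) {p w : ℝ → ℂ} {a b : ℝ}
    (hp : ContinuousOn p (uIcc a b)) (hw : ContinuousOn w (uIcc a b))
    (hmem : ∀ u ∈ uIcc a b, p u ∈ puncturedUpper) :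
    HasSum (fun n : ℕ => ∫ u in a..b, g (p u) *
        (((n.factorial : ℂ)⁻¹ * iteratedDeriv n E 0) * omegaSq (p u) ^ n) * w u)
      (∫ u in a..b, g (p u) * E (omegaSq (p u)) * w u) := by
  have hz : ContinuousOn (fun u => omegaSq (p u)) (uIcc a b) := continuousOn_omegaSq.comp hp hmem
  have hgw : ContinuousOn (fun u => g (p u) * w u) (uIcc a b) := (hg.comp hp hmem).mul hw
  obtain ⟨M, hM⟩ := isCompact_uIcc.exists_bound_of_continuousOn hz
  obtain ⟨A, hA⟩ := isCompact_uIcc.exists_bound_of_continuousOn hgw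
  have hsum : Summable fun n : ℕ => A * ‖((n.factorial : ℂ)⁻¹ * iteratedDeriv n E 0) * (M : ℂ) ^ n‖ := by
    refine Summable.mul_left A (Summable.norm ?_)
    convert! (hasSum_taylorSeries_of_entire hE 0 (M : ℂ)).summable using 2 with n
    simp only [smul_eq_mul, sub_zero]; ring
  refine intervalIntegral.hasSum_integral_of_dominated_convergence
    (fun n _ => A * ‖((n.factorial : ℂ)⁻¹ * iteratedDeriv n E 0) * (M : ℂ) ^ n‖)
    (fun n => ?_) (fun n => ae_of_all _ fun u hu => ?_) (ae_of_all _ fun u _ => hsum)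
    intervalIntegrable_const (ae_of_all _ fun u hu => ?_)
  · refine ContinuousOn.aestronglyMeasurable (ContinuousOn.mono ?_ uIoc_subset_uIcc)
      measurableSet_uIoc
    exact ((hg.comp hp hmem).mul ((hz.pow n).const_mul _)).mul hw
  · have hu' := uIoc_subset_uIcc hu
    have hM0 : ‖omegaSq (p u)‖ ≤ ‖(M : ℂ)‖ := (hM u hu').trans (by simpa using le_abs_self M)
    calc _ = ‖g (p u) * w u‖ * (‖(n.factorial : ℂ)⁻¹ * iteratedDeriv n E 0‖ * ‖omegaSq (p u)‖ ^ n) := by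
          simp only [norm_mul, norm_pow]; ring
      _ ≤ A * (‖(n.factorial : ℂ)⁻¹ * iteratedDeriv n E 0‖ * ‖(M : ℂ)‖ ^ n) := by
          have := hA u hu'
          have h0 : 0 ≤ A := (norm_nonneg _).trans this
          gcongr
      _ = _ := by simp only [norm_mul, norm_pow]
  · refine HasSum.mul_right _ (HasSum.mul_left _ ?_)
    convert! hasSum_taylorSeries_of_entire hE 0 (omegaSq (p u)) using 2 with n
    simp only [smul_eq_mul, sub_zero]; ring

/-- The contour may be replaced by a rectangle for functions of the form `f(k) (k - i)⁻ᵐ E(ω²)`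
with `E` entire, although `ω²` has a pole at `i`. -/
theorem rectContour_entire (hγ : IsContourAroundI γ) {E : ℂ → ℂ} (hE : Differentiable ℂ E)
    {f : ℂ → ℂ} (hc : ContinuousOn f closedUpper) (hd : DifferentiableOn ℂ f upper) (m : ℕ) :
    RectContour γ (fun k => f k / (k - I) ^ m * E (omegaSq k)) := by
  have hg : ContinuousOn (fun k => f k / (k - I) ^ m) puncturedUpper :=
    (hc.mono sdiff_subset).div (by fun_prop) fun k hk => pow_ne_zero _ (sub_I_ne_zero hk)
  refine ⟨hg.mul (hE.continuous.comp_continuousOn continuousOn_omegaSq), fun a b H ha hb hH => ?_⟩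
  have hH0 : 0 ≤ H := by linarith
  -- The `n`-th Taylor term has a pole of order at most `m + n` at `i`, because `ω² =
  -- (k²/(k+i))/(k-i)`; the pole case applies to it, and the two sums of integrals then agree term
  -- by term.
  set T : ℕ → ℂ → ℂ := fun n k => f k / (k - I) ^ m *
    (((n.factorial : ℂ)⁻¹ * iteratedDeriv n E 0) * omegaSq k ^ n) with hT
  have hTr : ∀ n, RectContour γ (T n) := by
    intro n
    have h := (rectContour_div_pow hγ (m + n) (f := fun k => f k * (k ^ 2 / (k + I)) ^ n)
      (hc.mul (ContinuousOn.pow (ContinuousOn.div (by fun_prop) (by fun_prop)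
        fun k hk => add_I_ne_zero hk) n))
      (hd.mul (DifferentiableOn.pow (DifferentiableOn.div (by fun_prop) (by fun_prop)
        fun k hk => add_I_ne_zero (upper_subset_closedUpper hk)) n))).const_mul
        ((n.factorial : ℂ)⁻¹ * iteratedDeriv n E 0)
    refine h.congr hγ fun k hk => ?_
    have h1 := sub_I_ne_zero hk
    have h2 := add_I_ne_zero hk.1
    simp only [hT, omegaSq, one_add_sq_eq, div_pow, mul_pow, pow_add]
    field_simp
  have hcont : HasSum (fun n => contourIntegral γ (T n))
      (contourIntegral γ (fun k => f k / (k - I) ^ m * E (omegaSq k))) := by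
    have hI : uIcc (0 : ℝ) 1 = Icc 0 1 := uIcc_of_le zero_le_one
    exact hasSum_integral_entire_comp hE hg (p := γ) (w := derivWithin γ (Icc 0 1))
      (by rw [hI]; exact hγ.contDiffOn.continuousOn) (by rw [hI]; exact hγ.continuousOn_derivWithin)
      (by rw [hI]; exact fun u hu => hγ.mem_puncturedUpper hu)
  have hside : ∀ {p : ℝ → ℂ} {a b : ℝ}, ContinuousOn p (uIcc a b) →
      (∀ u ∈ uIcc a b, p u ∈ puncturedUpper) → HasSum (fun n => ∫ u in a..b, T n (p u))
        (∫ u in a..b, f (p u) / (p u - I) ^ m * E (omegaSq (p u))) := by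
    intro p a b hp hmem
    simpa using hasSum_integral_entire_comp hE hg (w := fun _ => 1) hp continuousOn_const hmem
  have hrect : HasSum (fun n => rectIntegral (T n) a b H)
      (rectIntegral (fun k => f k / (k - I) ^ m * E (omegaSq k)) a b H) := by
    refine (((hside ?_ ?_).sub (hside ?_ ?_)).add ((hside ?_ ?_).mul_left I)).sub
      ((hside ?_ ?_).mul_left I)
    · fun_prop
    · exact fun x _ => real_mem_puncturedUpper x
    · fun_prop
    · exact fun x _ => horizontal_mem_puncturedUpper x hH
    · fun_prop
    · intro y hy; rw [uIcc_of_le hH0] at hy; exact vertical_mem_puncturedUpper hb.ne' hy.1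
    · fun_prop
    · intro y hy; rw [uIcc_of_le hH0] at hy; exact vertical_mem_puncturedUpper ha.ne hy.1
  have heq : (fun n => rectIntegral (T n) a b H) = fun n => contourIntegral γ (T n) :=
    funext fun n => (hTr n).eq a b H ha hb hH
  rw [heq] at hrect
  exact hrect.unique hcont

/-! ### Closing the real line in the upper half-plane -/

/-- The filter of neighbourhoods of infinity in the closed upper half-plane. -/
def upperInfty : Filter ℂ := Bornology.cobounded ℂ ⊓ 𝓟 closedUpper

theorem eventually_upperInfty {P : ℂ → Prop} (h : ∀ᶠ k in upperInfty, P k) :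
    ∃ R : ℝ, 1 < R ∧ ∀ k ∈ closedUpper, R ≤ ‖k‖ → P k := by
  rw [upperInfty, eventually_inf_principal, ← comap_norm_atTop, eventually_comap] at h
  obtain ⟨R, hR⟩ := eventually_atTop.1 h
  -- The lower bound `2` guarantees `R > 1`, so that rectangles of height at least `R` contain `i`.
  exact ⟨max R 2, by simp, fun k hk hk' => hR ‖k‖ (le_of_max_le_left hk') k rfl hk⟩

theorem tendsto_ofReal_upperInfty :
    Tendsto (fun k : ℝ => (k : ℂ)) (Bornology.cobounded ℝ) upperInfty := by
  refine tendsto_inf.2 ⟨?_, tendsto_principal.2 (Eventually.of_forall fun k => by simp [closedUpper])⟩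
  rw [← tendsto_norm_atTop_iff_cobounded]
  simp only [norm_real]
  exact tendsto_norm_cobounded_atTop (E := ℝ)

theorem norm_exp_I_mul (k : ℂ) (x : ℝ) : ‖exp (I * k * x)‖ = Real.exp (-x * k.im) := by
  rw [norm_exp]; congr 1; simp; ring

theorem integral_exp_neg_mul_le {x : ℝ} (hx : 0 < x) (H : ℝ) :
    ∫ y in (0 : ℝ)..H, Real.exp (-x * y) ≤ 1 / x := by
  have h : ∀ y : ℝ, HasDerivAt (fun y => -(1 / x) * Real.exp (-x * y)) (Real.exp (-x * y)) y := by
    intro y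
    have h1 : HasDerivAt (fun y : ℝ => -x * y) (-x) y := by
      simpa using (hasDerivAt_id y).const_mul (-x)
    convert! h1.exp.const_mul (-(1 / x)) using 1
    field_simp
  rw [intervalIntegral.integral_eq_sub_of_hasDerivAt (fun y _ => h y)
    (Continuous.intervalIntegrable (by fun_prop) _ _)]
  have : 0 < 1 / x * Real.exp (-x * H) := by positivity
  simp only [mul_zero, Real.exp_zero]
  linarith

/-- Jordan's lemma: for `x > 0` the integral of `e^{ikx} h(k)` over the real line can be closed
in the upper half-plane if `h` vanishes at infinity. -/
theorem hasImproperIntegral_of_tendsto_zero {h : ℂ → ℂ} {x : ℝ} (hx : 0 < x)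
    (hP : RectContour γ (fun k => exp (I * k * x) * h k)) (hh : Tendsto h upperInfty (𝓝 0)) :
    HasImproperIntegral (fun k : ℝ => exp (I * k * x) * h k)
      (contourIntegral γ (fun k => exp (I * k * x) * h k)) := by
  set F : ℂ → ℂ := fun k => exp (I * k * x) * h k with hF
  refine Metric.tendsto_nhds.2 fun ε hε => ?_
  -- Each vertical side contributes at most `δ/x` and the top side vanishes as `H → ∞`; the total
  -- `2δ/x = ε/2` is below `ε`.
  set δ := ε * x / 4 with hδ
  have hδ0 : 0 < δ := by positivity
  obtain ⟨R, hR1, hR⟩ := eventually_upperInfty (hh.eventually (Metric.ball_mem_nhds 0 hδ0))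
  have hbound : ∀ k ∈ closedUpper, R ≤ ‖k‖ → ‖F k‖ ≤ δ * Real.exp (-x * k.im) := by
    intro k hk hk'
    have := hR k hk hk'
    rw [dist_zero_right] at this
    rw [hF, norm_mul, norm_exp_I_mul, mul_comm]
    gcongr
  filter_upwards [prod_mem_prod (Iic_mem_atBot (-R)) (Ici_mem_atTop R)] with ⟨a, b⟩ ⟨ha, hb⟩
  simp only [mem_Iic, mem_Ici] at ha hb
  have hv : ∀ c : ℝ, R ≤ |c| → ∀ H : ℝ, 0 ≤ H → ‖∫ y in (0 : ℝ)..H, F (c + y * I)‖ ≤ δ / x := by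
    intro c hc H hH
    calc _ ≤ ∫ y in (0 : ℝ)..H, δ * Real.exp (-x * y) := by
          refine intervalIntegral.norm_integral_le_of_norm_le hH (ae_of_all _ fun y hy => ?_)
            (Continuous.intervalIntegrable (by fun_prop) _ _)
          have := hbound (c + y * I) (by simpa [closedUpper] using hy.1.le) (hc.trans ?_)
          · simpa using this
          · simpa using abs_re_le_norm ((c : ℂ) + y * I)
      _ ≤ δ * (1 / x) := by
          rw [intervalIntegral.integral_const_mul]
          gcongr
          exact integral_exp_neg_mul_le hx H
      _ = δ / x := by ring
  have hH : ∀ᶠ H : ℝ in atTop, ‖(∫ k in a..b, F k) - contourIntegral γ F‖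
      ≤ δ * Real.exp (-x * H) * |b - a| + (δ / x + δ / x) := by
    filter_upwards [eventually_gt_atTop R] with H hHR
    have h1 := hP.eq a b H (by linarith) (by linarith) (by linarith)
    have h2 : (∫ k in a..b, F k) - contourIntegral γ F = (∫ k in a..b, F (k + H * I))
        - (I * (∫ y in (0 : ℝ)..H, F (b + y * I)) - I * ∫ y in (0 : ℝ)..H, F (a + y * I)) := by
      rw [← h1, rectIntegral]; simp; ring
    rw [h2]
    refine (norm_sub_le _ _).trans (add_le_add ?_ ((norm_sub_le _ _).trans (add_le_add ?_ ?_)))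
    · refine intervalIntegral.norm_integral_le_of_norm_le_const fun k _ => ?_
      have := hbound (k + H * I) (by simp [closedUpper]; linarith) (hHR.le.trans ?_)
      · simpa using this
      · simpa using (le_abs_self _).trans (abs_im_le_norm ((k : ℂ) + H * I))
    · rw [norm_mul, norm_I, one_mul]
      exact hv b (hb.trans (le_abs_self _)) H (by linarith)
    · rw [norm_mul, norm_I, one_mul]
      exact hv a ((by linarith : R ≤ -a).trans (neg_le_abs _)) H (by linarith)
  have hlim : Tendsto (fun H : ℝ => δ * Real.exp (-x * H) * |b - a| + (δ / x + δ / x)) atTop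
      (𝓝 (δ * 0 * |b - a| + (δ / x + δ / x))) := by
    have : Tendsto (fun H : ℝ => Real.exp (-x * H)) atTop (𝓝 0) :=
      Real.tendsto_exp_atBot.comp (tendsto_id.const_mul_atTop_of_neg (by linarith))
    exact ((this.const_mul δ).mul_const _).add_const _
  have := ge_of_tendsto hlim hH
  rw [dist_eq_norm]
  refine this.trans_lt ?_
  rw [hδ]; field_simp; linarith

/-- Closing the real line in the upper half-plane for a function that decays faster than `1/k`. -/
theorem tendsto_integral_of_mul_tendsto_zero {F : ℂ → ℂ} (hP : RectContour γ F)
    (hF : Tendsto (fun k => k * F k) upperInfty (𝓝 0)) :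
    Tendsto (fun R : ℝ => ∫ k in (-R)..R, F k) atTop (𝓝 (contourIntegral γ F)) := by
  refine Metric.tendsto_nhds.2 fun ε hε => ?_
  -- On `|k| ≥ R` the bound is `ε/(5R)`; the top has length `2R` and the two verticals length `R`,
  -- which gives `4ε/5` in all.
  obtain ⟨R₀, hR1, hR⟩ := eventually_upperInfty
    (hF.eventually (Metric.ball_mem_nhds 0 (by positivity : 0 < ε / 5)))
  filter_upwards [eventually_ge_atTop R₀] with R hRR
  have hR0 : 0 < R := by linarith
  have hbound : ∀ k ∈ closedUpper, R ≤ ‖k‖ → ‖F k‖ ≤ ε / 5 / R := by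
    intro k hk hk'
    have := hR k hk (hRR.trans hk')
    rw [dist_zero_right, norm_mul] at this
    rw [le_div_iff₀ hR0, mul_comm]
    exact (mul_le_mul_of_nonneg_right hk' (norm_nonneg _)).trans this.le
  have hv : ∀ c : ℝ, R ≤ |c| → ‖∫ y in (0 : ℝ)..R, F (c + y * I)‖ ≤ ε / 5 := by
    intro c hc
    have := intervalIntegral.norm_integral_le_of_norm_le_const (a := 0) (b := R) (C := ε / 5 / R)
      (f := fun y : ℝ => F (c + y * I)) (fun y hy => hbound _ ?_ (hc.trans ?_))
    · rwa [sub_zero, abs_of_pos hR0, div_mul_cancel₀ _ hR0.ne'] at this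
    · rw [uIoc_of_le hR0.le] at hy
      simpa [closedUpper] using hy.1.le
    · simpa using abs_re_le_norm ((c : ℂ) + y * I)
  have ht : ‖∫ k in (-R)..R, F (k + R * I)‖ ≤ 2 * (ε / 5) := by
    have := intervalIntegral.norm_integral_le_of_norm_le_const (a := -R) (b := R) (C := ε / 5 / R)
      (f := fun k : ℝ => F (k + R * I)) (fun k hk => hbound _ ?_ ?_)
    · rw [sub_neg_eq_add, ← two_mul, abs_of_pos (by linarith)] at this
      refine this.trans_eq ?_
      field_simp
    · simpa [closedUpper] using hR0.le
    · simpa using (le_abs_self _).trans (abs_im_le_norm ((k : ℂ) + R * I))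
  have h1 := hP.eq (-R) R R (by linarith) hR0 (by linarith)
  have h2 : (∫ k in (-R)..R, F k) - contourIntegral γ F = (∫ k in (-R)..R, F (k + R * I))
      - (I * (∫ y in (0 : ℝ)..R, F (R + y * I)) - I * ∫ y in (0 : ℝ)..R, F ((-R : ℝ) + y * I)) := by
    rw [← h1, rectIntegral]; simp; ring
  rw [dist_eq_norm, h2]
  calc _ ≤ 2 * (ε / 5) + (ε / 5 + ε / 5) := by
        refine (norm_sub_le _ _).trans (add_le_add ht ((norm_sub_le _ _).trans (add_le_add ?_ ?_)))
        · rw [norm_mul, norm_I, one_mul]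
          exact hv R (le_abs_self _)
        · rw [norm_mul, norm_I, one_mul]
          exact hv (-R) (by rw [abs_neg]; exact le_abs_self _)
    _ < ε := by linarith

theorem tendsto_mul_div : Tendsto (fun k : ℂ => k * (k / (1 + k ^ 2))) (Bornology.cobounded ℂ) (𝓝 1) := by
  have h1 : Tendsto (fun k : ℂ => 1 / ((k⁻¹) ^ 2 + 1)) (Bornology.cobounded ℂ) (𝓝 (1 / (0 ^ 2 + 1))) :=
    tendsto_const_nhds.div ((tendsto_inv₀_cobounded.pow 2).add_const 1) (by simp)
  simp only [ne_eq, OfNat.ofNat_ne_zero, not_false_eq_true, zero_pow, zero_add, div_one] at h1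
  refine h1.congr' ?_
  filter_upwards [Bornology.eventually_ne_cobounded 0] with k hk
  field_simp

/-- The contour integral of an odd function is half of its residue at infinity. -/
theorem contourIntegral_of_odd (hγ : IsContourAroundI γ) {F : ℂ → ℂ} (hP : RectContour γ F)
    (hodd : ∀ k : ℝ, F (-k) = -F k) {L : ℂ}
    (hF : Tendsto (fun k => k * F k) upperInfty (𝓝 L)) :
    contourIntegral γ F = Real.pi * I * L := by
  -- The model function `k/(1+k²)` is odd, behaves like `1/k` at infinity, and has residue `1/2` at
  -- `i`. Subtracting `L` times it makes the integrand `o(1/k)`, so that the real line can be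
  -- closed.
  have hk : RectContour γ (fun k => k / (1 + k ^ 2)) := by
    refine (rectContour_div_pow hγ 1 (f := fun k => k / (k + I))
      (ContinuousOn.div (by fun_prop) (by fun_prop) fun k hk => add_I_ne_zero hk)
      (DifferentiableOn.div (by fun_prop) (by fun_prop)
        fun k hk => add_I_ne_zero (upper_subset_closedUpper hk))).congr hγ fun k hk => ?_
    have h1 := sub_I_ne_zero hk
    have h2 := add_I_ne_zero hk.1
    simp only [one_add_sq_eq]
    field_simp
  have hval : contourIntegral γ (fun k => k / (1 + k ^ 2)) = Real.pi * I := by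
    have h1 : RectContour γ (fun k => 1 / (k + I)) := rectContour_of_differentiableOn hγ
      (ContinuousOn.div (by fun_prop) (by fun_prop) fun k hk => add_I_ne_zero hk)
      (DifferentiableOn.div (by fun_prop) (by fun_prop)
        fun k hk => add_I_ne_zero (upper_subset_closedUpper hk))
    have h2 := rectContour_inv hγ
    have h3 : contourIntegral γ (fun k => 1 / (k + I)) = 0 := hγ.contourIntegral_eq_zero
      (DifferentiableOn.div (by fun_prop) (by fun_prop)
        fun k hk => add_I_ne_zero (upper_subset_closedUpper hk))
    rw [contourIntegral_congr (G := fun k => 1 / 2 * (1 / (k - I) + 1 / (k + I))),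
      contourIntegral_const_mul, hγ.contourIntegral_add h2.continuousOn h1.continuousOn, h3, hγ.winding]
    · ring
    · intro u hu
      have h1 := sub_I_ne_zero (hγ.mem_puncturedUpper hu)
      have h2 := add_I_ne_zero (hγ.mem_puncturedUpper hu).1
      simp only [one_add_sq_eq]
      field_simp
      ring
  have hlim : Tendsto (fun k : ℂ => k * (k / (1 + k ^ 2))) upperInfty (𝓝 1) :=
    tendsto_mul_div.mono_left inf_le_left
  have hG : RectContour γ (fun k => F k - L * (k / (1 + k ^ 2))) := hP.sub hγ (hk.const_mul L)
  have ht := tendsto_integral_of_mul_tendsto_zero hG (by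
    have := hF.sub (hlim.const_mul L)
    rw [mul_one, sub_self] at this
    exact this.congr fun k => by ring)
  -- Oddness kills every symmetric integral over the real line, so only the model function
  -- contributes.
  have h0 : ∀ R : ℝ, ∫ k in (-R)..R, (F k - L * ((k : ℂ) / (1 + (k : ℂ) ^ 2))) = 0 := by
    intro R
    have h1 := intervalIntegral.integral_comp_neg (a := -R) (b := R)
      (fun k : ℝ => F k - L * ((k : ℂ) / (1 + (k : ℂ) ^ 2)))
    rw [neg_neg] at h1
    have h2 : ∀ k : ℝ, F ((-k : ℝ)) - L * (((-k : ℝ) : ℂ) / (1 + ((-k : ℝ) : ℂ) ^ 2))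
        = -(F k - L * ((k : ℂ) / (1 + (k : ℂ) ^ 2))) := by
      intro k; push_cast; rw [hodd]; ring
    simp only [h2, intervalIntegral.integral_neg] at h1
    exact self_eq_neg.1 h1.symm
  simp only [h0] at ht
  have h3 := tendsto_nhds_unique ht tendsto_const_nhds
  rw [hγ.contourIntegral_sub hP.continuousOn (hk.const_mul L).continuousOn,
    contourIntegral_const_mul, hval] at h3
  linear_combination h3

end Contour

/-! ### Gaussian summation of oscillatory integrals -/

theorem integrable_gauss_mul {F : ℝ → ℂ} (hF : Continuous F) {M : ℝ} (hM : ∀ k, ‖F k‖ ≤ M)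
    {ε : ℝ} (hε : 0 < ε) : Integrable (fun k : ℝ => (Real.exp (-ε * k ^ 2) : ℂ) * F k) := by
  refine (integrable_exp_neg_mul_sq hε).ofReal.mul_bdd hF.aestronglyMeasurable (c := M) ?_
  exact ae_of_all _ hM

theorem HasGaussIntegral.add {F G : ℝ → ℂ} {J K : ℂ} (hF : HasGaussIntegral F J)
    (hG : HasGaussIntegral G K) (hFc : Continuous F) (hGc : Continuous G)
    (hFb : ∃ M, ∀ k, ‖F k‖ ≤ M) (hGb : ∃ M, ∀ k, ‖G k‖ ≤ M) :
    HasGaussIntegral (fun k => F k + G k) (J + K) := by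
  obtain ⟨M, hM⟩ := hFb
  obtain ⟨N, hN⟩ := hGb
  refine (Tendsto.add hF hG).congr' ?_
  filter_upwards [self_mem_nhdsWithin] with ε hε
  rw [← integral_add (integrable_gauss_mul hFc hM hε) (integrable_gauss_mul hGc hN hε)]
  simp only [mul_add]

theorem hasImproperIntegral_of_integrable {F : ℝ → ℂ} (hF : Integrable F) :
    HasImproperIntegral F (∫ k, F k) :=
  intervalIntegral_tendsto_integral hF tendsto_fst tendsto_snd

theorem integral_Ioi_two_mul_exp_neg_sq :
    IntegrableOn (fun s : ℝ => 2 * s * Real.exp (-s ^ 2)) (Ioi 0) ∧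
      ∫ s in Ioi (0 : ℝ), 2 * s * Real.exp (-s ^ 2) = 1 := by
  have hd : ∀ s ∈ Ici (0 : ℝ), HasDerivAt (fun s : ℝ => -Real.exp (-s ^ 2))
      (2 * s * Real.exp (-s ^ 2)) s := by
    intro s _
    have h1 : HasDerivAt (fun s : ℝ => -s ^ 2) (-(2 * s)) s := by
      simpa using (hasDerivAt_pow 2 s).fun_neg
    convert! h1.exp.fun_neg using 1
    ring
  have ht : Tendsto (fun s : ℝ => -Real.exp (-s ^ 2)) atTop (𝓝 0) := by
    have : Tendsto (fun s : ℝ => Real.exp (-s ^ 2)) atTop (𝓝 0) :=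
      Real.tendsto_exp_neg_atTop_nhds_zero.comp (tendsto_pow_atTop two_ne_zero)
    simpa using this.neg
  have hp : ∀ s ∈ Ioi (0 : ℝ), 0 ≤ 2 * s * Real.exp (-s ^ 2) := by
    intro s hs
    have : 0 < s := hs
    positivity
  refine ⟨integrableOn_Ioi_deriv_of_nonneg' hd hp ht, ?_⟩
  rw [integral_Ioi_of_hasDerivAt_of_nonneg' hd hp ht]
  simp

/-- A convergent (bounded, continuous) improper integral is summed to the same value by the
Gaussian cut-off. -/
theorem HasImproperIntegral.hasGaussIntegral {F : ℝ → ℂ} {J : ℂ} (h : HasImproperIntegral F J)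
    (hF : Continuous F) (hb : ∃ M, ∀ k, ‖F k‖ ≤ M) : HasGaussIntegral F J := by
  obtain ⟨M, hM⟩ := hb
  set Ψ : ℝ → ℂ := fun s => ∫ k in (-s)..s, F k with hΨ
  have hΨt : Tendsto Ψ atTop (𝓝 J) := by
    have : Tendsto (fun s : ℝ => (-s, s)) atTop (atBot ×ˢ atTop) :=
      tendsto_neg_atTop_atBot.prodMk tendsto_id
    exact Tendsto.comp h this
  have hΨd : ∀ s, HasDerivAt Ψ (F s + F (-s)) s := by
    intro s
    have e : Ψ = fun s => (∫ k in (0 : ℝ)..s, F k) - ∫ k in (0 : ℝ)..(-s), F k := by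
      ext s
      rw [hΨ]
      simp only
      rw [intervalIntegral.integral_interval_sub_left] <;> exact hF.intervalIntegrable _ _
    have h1 := (hF.integral_hasStrictDerivAt 0 s).hasDerivAt
    have h2 := ((hF.integral_hasStrictDerivAt 0 (-s)).hasDerivAt).scomp s (hasDerivAt_neg s)
    rw [e]
    convert! h1.sub h2 using 1
    simp
  have hΨc : Continuous Ψ := continuous_iff_continuousAt.2 fun s => (hΨd s).continuousAt
  obtain ⟨B, hB⟩ : ∃ B, ∀ s ∈ Ici (0 : ℝ), ‖Ψ s‖ ≤ B := by
    obtain ⟨R, hR⟩ := eventually_atTop.1 (hΨt.norm.eventually (gt_mem_nhds (lt_add_one ‖J‖)))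
    obtain ⟨B, hB⟩ := (isCompact_Icc (a := 0) (b := R)).exists_bound_of_continuousOn hΨc.continuousOn
    refine ⟨max B (‖J‖ + 1), fun s hs => ?_⟩
    rcases le_total s R with h1 | h1
    · exact (hB s ⟨hs, h1⟩).trans (le_max_left _ _)
    · exact (hR s h1).le.trans (le_max_right _ _)
  obtain ⟨hgi, hg1⟩ := integral_Ioi_two_mul_exp_neg_sq
  -- Integration by parts against `Ψ(s) = ∫_{-s}^{s} F`, followed by the scaling `k = s/√ε`,
  -- produces an average of `Ψ` with the probability density `2s e^{-s²}` on the half-line. As `ε →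
  -- 0⁺` the argument `s/√ε` runs to infinity, where `Ψ → J`.
  have hgauss : ∀ ε : ℝ, 0 < ε → ∫ k : ℝ, (Real.exp (-ε * k ^ 2) : ℂ) * F k
      = ∫ s in Ioi (0 : ℝ), ((2 * s * Real.exp (-s ^ 2) : ℝ) : ℂ) * Ψ (s / √ε) := by
    intro ε hε
    have hε' : 0 < √ε := Real.sqrt_pos.2 hε
    have hi := integrable_gauss_mul hF hM hε
    have hi' : Integrable (fun k : ℝ => (Real.exp (-ε * k ^ 2) : ℂ) * F (-k)) :=
      integrable_gauss_mul (hF.comp continuous_neg) (fun k => hM (-k)) hε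
    have e1 : ∫ k : ℝ, (Real.exp (-ε * k ^ 2) : ℂ) * F k
        = ∫ k in Ioi (0 : ℝ), (Real.exp (-ε * k ^ 2) : ℂ) * (F k + F (-k)) := by
      have e2 := integral_comp_neg_Ioi (0 : ℝ) (fun k : ℝ => (Real.exp (-ε * k ^ 2) : ℂ) * F k)
      simp only [neg_zero, even_two, Even.neg_pow] at e2
      rw [← intervalIntegral.integral_Iic_add_Ioi hi.integrableOn hi.integrableOn (b := 0), ← e2,
        ← integral_add hi'.integrableOn hi.integrableOn]
      congr 1; ext k; ring
    have hscale : ∫ k in Ioi (0 : ℝ), ((2 * ε * k * Real.exp (-ε * k ^ 2) : ℝ) : ℂ) * Ψ k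
        = ∫ s in Ioi (0 : ℝ), ((2 * s * Real.exp (-s ^ 2) : ℝ) : ℂ) * Ψ (s / √ε) := by
      have e3 := integral_comp_mul_left_Ioi
        (fun s : ℝ => ((2 * s * Real.exp (-s ^ 2) : ℝ) : ℂ) * Ψ (s / √ε)) 0 hε'
      rw [mul_zero] at e3
      have e4 : ∫ s in Ioi (0 : ℝ), ((2 * s * Real.exp (-s ^ 2) : ℝ) : ℂ) * Ψ (s / √ε)
          = √ε • ∫ k in Ioi (0 : ℝ), ((2 * (√ε * k) * Real.exp (-(√ε * k) ^ 2) : ℝ) : ℂ)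
            * Ψ (√ε * k / √ε) := by
        rw [e3, smul_smul, mul_inv_cancel₀ hε'.ne', one_smul]
      rw [e4, ← integral_smul]
      congr 1; ext k
      rw [mul_div_cancel_left₀ _ hε'.ne', mul_pow, Real.sq_sqrt hε.le, real_smul, ← mul_assoc,
        ← ofReal_mul]
      congr 2
      rw [neg_mul]
      have := Real.mul_self_sqrt hε.le
      linear_combination (-2 * k * Real.exp (-(ε * k ^ 2))) * this
    have hintegral : IntegrableOn (fun k : ℝ => ((2 * ε * k * Real.exp (-ε * k ^ 2) : ℝ) : ℂ) * Ψ k)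
        (Ioi 0) := by
      have h0 : Integrable (fun k : ℝ => 2 * ε * k * Real.exp (-ε * k ^ 2)) := by
        simpa only [mul_assoc] using (integrable_mul_exp_neg_mul_sq hε).const_mul (2 * ε)
      have h1 : Integrable (fun k : ℝ => ((2 * ε * k * Real.exp (-ε * k ^ 2) : ℝ) : ℂ)) := h0.ofReal
      refine h1.integrableOn.mul_bdd (c := B) hΨc.aestronglyMeasurable ?_
      filter_upwards [ae_restrict_mem measurableSet_Ioi] with k hk using hB k (mem_Ici_of_Ioi hk)
    have hd : ∀ k ∈ Ici (0 : ℝ), HasDerivAt (fun k : ℝ => (Real.exp (-ε * k ^ 2) : ℂ) * Ψ k)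
        ((Real.exp (-ε * k ^ 2) : ℂ) * (F k + F (-k))
          - ((2 * ε * k * Real.exp (-ε * k ^ 2) : ℝ) : ℂ) * Ψ k) k := by
      intro k _
      have h1 : HasDerivAt (fun k : ℝ => -ε * k ^ 2) (-ε * (2 * k)) k := by
        simpa using (hasDerivAt_pow 2 k).const_mul (-ε)
      convert! h1.exp.ofReal_comp.mul (hΨd k) using 1
      push_cast; ring
    have ht : Tendsto (fun k : ℝ => (Real.exp (-ε * k ^ 2) : ℂ) * Ψ k) atTop (𝓝 0) := by
      have h1 : Tendsto (fun k : ℝ => Real.exp (-ε * k ^ 2)) atTop (𝓝 0) :=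
        Real.tendsto_exp_atBot.comp
          ((tendsto_pow_atTop two_ne_zero).const_mul_atTop_of_neg (by linarith))
      simpa using h1.ofReal.mul hΨt
    have hi2 : IntegrableOn (fun k : ℝ => (Real.exp (-ε * k ^ 2) : ℂ) * (F k + F (-k))) (Ioi 0) := by
      refine (hi.add hi').integrableOn.congr_fun (fun k _ => ?_) measurableSet_Ioi
      simp only [Pi.add_apply]; ring
    have e5 := integral_Ioi_of_hasDerivAt_of_tendsto' hd (hi2.sub hintegral) ht
    rw [integral_sub hi2 hintegral] at e5
    have h0 : Ψ 0 = 0 := by simp [hΨ]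
    rw [h0, mul_zero, sub_zero, sub_eq_zero] at e5
    rw [e1, e5, hscale]
  have hlim : Tendsto (fun ε : ℝ => ∫ s in Ioi (0 : ℝ),
      ((2 * s * Real.exp (-s ^ 2) : ℝ) : ℂ) * Ψ (s / √ε)) (𝓝[>] 0)
      (𝓝 (∫ s in Ioi (0 : ℝ), ((2 * s * Real.exp (-s ^ 2) : ℝ) : ℂ) * J)) := by
    refine tendsto_integral_filter_of_dominated_convergence
      (fun s => ‖2 * s * Real.exp (-s ^ 2)‖ * B) ?_ ?_ (hgi.norm.mul_const B) ?_
    · exact Eventually.of_forall fun ε => Continuous.aestronglyMeasurable (by fun_prop)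
    · refine Eventually.of_forall fun ε => ?_
      filter_upwards [ae_restrict_mem measurableSet_Ioi] with s hs
      rw [norm_mul, norm_real]
      gcongr
      exact hB _ (div_nonneg (le_of_lt hs) (Real.sqrt_nonneg _))
    · filter_upwards [ae_restrict_mem measurableSet_Ioi] with s hs
      refine Tendsto.const_mul _ (hΨt.comp ?_)
      have h1 : Tendsto (fun ε : ℝ => √ε) (𝓝[>] 0) (𝓝[>] 0) := by
        refine tendsto_nhdsWithin_of_tendsto_nhds_of_eventually_within _ ?_ ?_
        · simpa using (Real.continuous_sqrt.tendsto 0).mono_left nhdsWithin_le_nhds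
        · filter_upwards [self_mem_nhdsWithin] with ε hε using Real.sqrt_pos.2 hε
      simpa [div_eq_mul_inv] using (tendsto_inv_nhdsGT_zero.comp h1).const_mul_atTop (show 0 < s from hs)
  rw [integral_mul_const, integral_complex_ofReal, hg1, ofReal_one, one_mul] at hlim
  refine hlim.congr' ?_
  filter_upwards [self_mem_nhdsWithin] with ε hε
  exact (hgauss ε hε).symm

/-- The Gaussian integral equals `√(π/ε) e^{-x²/(4ε)} c`; for `x ≠ 0` the exponential beats the
power of `1/ε`. -/
theorem hasGaussIntegral_exp (c : ℂ) {x : ℝ} (hx : x ≠ 0) :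
    HasGaussIntegral (fun k : ℝ => exp (I * k * x) * c) 0 := by
  have h1 : Tendsto (fun y : ℝ => y ^ (1 / 2 : ℝ) * Real.exp (-(x ^ 2 / 4) * y)) atTop (𝓝 0) :=
    tendsto_rpow_mul_exp_neg_mul_atTop_nhds_zero (1 / 2) (x ^ 2 / 4) (by positivity)
  have h2 := (h1.comp tendsto_inv_nhdsGT_zero).const_mul (Real.pi ^ (1 / 2 : ℝ) * ‖c‖)
  rw [mul_zero] at h2
  refine squeeze_zero_norm' ?_ h2
  filter_upwards [self_mem_nhdsWithin] with ε hε
  have hε : 0 < ε := hε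
  have h3 := fourierIntegral_gaussian (b := (ε : ℂ)) (by simpa using hε) (x : ℂ)
  have h4 : ∫ k : ℝ, (Real.exp (-ε * k ^ 2) : ℂ) * (exp (I * k * x) * c)
      = ((Real.pi / ε : ℂ) ^ (1 / 2 : ℂ) * cexp (-(x : ℂ) ^ 2 / (4 * ε))) * c := by
    rw [← h3, ← integral_mul_const]
    congr 1; ext k
    push_cast
    rw [show I * (k : ℂ) * x = I * x * k by ring]
    ring
  rw [h4, norm_mul, norm_mul, norm_exp]
  have h5 : ‖(Real.pi / ε : ℂ) ^ (1 / 2 : ℂ)‖ = Real.pi ^ (1 / 2 : ℝ) * ε⁻¹ ^ (1 / 2 : ℝ) := by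
    rw [← Real.mul_rpow Real.pi_pos.le (by positivity), ← div_eq_mul_inv, ← ofReal_div,
      norm_cpow_eq_rpow_re_of_pos (by positivity)]
    norm_num
  have h6 : (-(x : ℂ) ^ 2 / (4 * ε)).re = -(x ^ 2 / 4) * ε⁻¹ := by
    have : (-(x : ℂ) ^ 2 / (4 * ε)) = ((-(x ^ 2 / 4) * ε⁻¹ : ℝ) : ℂ) := by
      push_cast; field_simp
    rw [this, ofReal_re]
  rw [h5, h6]
  simp only [Function.comp_apply]
  apply le_of_eq
  ring

theorem exists_bound_of_tendsto_cobounded {F : ℝ → ℂ} (hF : Continuous F) {c : ℂ}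
    (h : Tendsto F (Bornology.cobounded ℝ) (𝓝 c)) : ∃ M, ∀ k, ‖F k‖ ≤ M := by
  have h1 := h.norm.eventually (gt_mem_nhds (lt_add_one ‖c‖))
  rw [← comap_norm_atTop, eventually_comap] at h1
  obtain ⟨R, hR⟩ := eventually_atTop.1 h1
  obtain ⟨B, hB⟩ := (isCompact_closedBall (0 : ℝ) R).exists_bound_of_continuousOn hF.continuousOn
  refine ⟨max B (‖c‖ + 1), fun k => ?_⟩
  rcases le_total ‖k‖ R with hk | hk
  · exact (hB k (by simpa using hk)).trans (le_max_left _ _)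
  · exact (hR ‖k‖ hk k rfl).le.trans (le_max_right _ _)

theorem norm_exp_I_mul_ofReal (k x : ℝ) : ‖exp (I * k * x)‖ = 1 := by
  rw [norm_exp_I_mul]; simp

theorem rectContour_exp_mul_const {γ : ℝ → ℂ} (hγ : IsContourAroundI γ) (c : ℂ) (x : ℝ) :
    RectContour γ (fun k => exp (I * k * x) * c) ∧
      contourIntegral γ (fun k => exp (I * k * x) * c) = 0 :=
  ⟨rectContour_of_differentiableOn hγ (by fun_prop) (by fun_prop),
    hγ.contourIntegral_eq_zero (by fun_prop)⟩

/-- Closing the real line in the upper half-plane for an integrand `e^{ikx} h(k)` where `h` has a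
limit at infinity. -/
theorem hasGaussIntegral_of_tendsto {γ : ℝ → ℂ} (hγ : IsContourAroundI γ) {h : ℂ → ℂ} {x : ℝ}
    (hx : 0 < x) (hc : ContinuousOn h puncturedUpper)
    (hP : RectContour γ (fun k => exp (I * k * x) * h k)) {c : ℂ}
    (hh : Tendsto h upperInfty (𝓝 c)) :
    HasGaussIntegral (fun k : ℝ => exp (I * k * x) * h k)
      (contourIntegral γ (fun k => exp (I * k * x) * h k)) := by
  -- The limit `c` is subtracted from `h`. The term `c e^{ikx}` contributes `0` on both sides: on
  -- the contour by Cauchy, on the line by the Gaussian computation.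
  obtain ⟨hE, hE0⟩ := rectContour_exp_mul_const hγ c x
  have hP' : RectContour γ (fun k => exp (I * k * x) * (h k - c)) :=
    (hP.sub hγ hE).congr hγ fun k _ => by ring
  have hh' : Tendsto (fun k => h k - c) upperInfty (𝓝 0) := by simpa using hh.sub_const c
  have himp := hasImproperIntegral_of_tendsto_zero hx hP' hh'
  have hcr : Continuous (fun k : ℝ => h k - c) := by
    have := continuousOn_real hc
    simp only [ofReal_zero, zero_mul, add_zero] at this
    exact this.sub continuous_const
  obtain ⟨M, hM⟩ := exists_bound_of_tendsto_cobounded hcr (hh'.comp tendsto_ofReal_upperInfty)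
  have hFc : Continuous (fun k : ℝ => exp (I * k * x) * (h k - c)) := by fun_prop
  have hFb : ∃ M, ∀ k : ℝ, ‖exp (I * k * x) * (h k - c)‖ ≤ M :=
    ⟨M, fun k => by rw [norm_mul, norm_exp_I_mul_ofReal, one_mul]; exact hM k⟩
  have hG := (himp.hasGaussIntegral hFc hFb).add (hasGaussIntegral_exp c hx.ne') hFc (by fun_prop) hFb
    ⟨‖c‖, fun k => by rw [norm_mul, norm_exp_I_mul_ofReal, one_mul]⟩
  have hval : contourIntegral γ (fun k => exp (I * k * x) * (h k - c)) + 0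
      = contourIntegral γ (fun k => exp (I * k * x) * h k) := by
    rw [← hE0, ← hγ.contourIntegral_add hP'.continuousOn hE.continuousOn]
    congr 1; ext k; ring
  rw [hval] at hG
  convert! hG using 2 with k
  ring

/-! ### Superpositions of plane waves -/

/-- The superposition `∫ e^{iκx} Φ(κ, t) dν` of plane waves with wave numbers `κ` and
time-dependent amplitude `Φ`. -/
def superpose (ν : Measure ℝ) (κ : ℝ → ℂ) (Φ : ℝ → ℝ → ℂ) (p : ℝ × ℝ) : ℂ :=
  ∫ u, exp (I * κ u * p.1) * Φ u p.2 ∂ν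

/-- Amplitudes that are continuous in time and dominated, locally uniformly in time, by an
integrable function. -/
structure Dominated (ν : Measure ℝ) (Φ : ℝ → ℝ → ℂ) : Prop where
  meas : ∀ t, AEStronglyMeasurable (fun u => Φ u t) ν
  cont : ∀ u, Continuous (Φ u)
  bound : ∀ T : ℝ, ∃ b : ℝ → ℝ, Integrable b ν ∧ ∀ u t, |t| ≤ T → ‖Φ u t‖ ≤ b u

/-- Amplitudes whose superposition may be differentiated `n` times under the integral sign. -/
def SmoothAmplitude (ν : Measure ℝ) (κ : ℝ → ℂ) : ℕ → (ℝ → ℝ → ℂ) → Prop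
  | 0, Φ => Dominated ν Φ
  | n + 1, Φ => Dominated ν Φ ∧ SmoothAmplitude ν κ n (fun u t => I * κ u * Φ u t) ∧
      ∃ Φ' : ℝ → ℝ → ℂ, (∀ u t, HasDerivAt (Φ u) (Φ' u t) t) ∧ SmoothAmplitude ν κ n Φ'

/-- Admissible families of wave numbers: the imaginary part, `κ²/(1+κ²)` and `κ/(1+κ²)` are
bounded. -/
structure WaveNumbers (κ : ℝ → ℂ) : Prop where
  continuous : Continuous κ
  ne : ∀ u, 1 + κ u ^ 2 ≠ 0
  bound_im : ∃ B, ∀ u, |(κ u).im| ≤ B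
  bound_omegaSq : ∃ B, ∀ u, ‖omegaSq (κ u)‖ ≤ B
  bound_div : ∃ B, ∀ u, ‖κ u / (1 + κ u ^ 2)‖ ≤ B

section Superpose

variable {ν : Measure ℝ} {κ : ℝ → ℂ}

theorem Dominated.add {Φ Ψ : ℝ → ℝ → ℂ} (hΦ : Dominated ν Φ) (hΨ : Dominated ν Ψ) :
    Dominated ν (fun u t => Φ u t + Ψ u t) := by
  refine ⟨fun t => (hΦ.meas t).add (hΨ.meas t), fun u => (hΦ.cont u).add (hΨ.cont u), fun T => ?_⟩
  obtain ⟨b, hb, hb'⟩ := hΦ.bound T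
  obtain ⟨c, hc, hc'⟩ := hΨ.bound T
  exact ⟨fun u => b u + c u, hb.add hc,
    fun u t ht => (norm_add_le _ _).trans (add_le_add (hb' u t ht) (hc' u t ht))⟩

theorem SmoothAmplitude.dominated {n : ℕ} {Φ : ℝ → ℝ → ℂ} (h : SmoothAmplitude ν κ n Φ) :
    Dominated ν Φ := by
  cases n with
  | zero => exact h
  | succ n => exact h.1

theorem SmoothAmplitude.add {n : ℕ} : ∀ {Φ Ψ : ℝ → ℝ → ℂ}, SmoothAmplitude ν κ n Φ →
    SmoothAmplitude ν κ n Ψ → SmoothAmplitude ν κ n (fun u t => Φ u t + Ψ u t) := by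
  induction n with
  | zero => intro Φ Ψ hΦ hΨ; exact Dominated.add hΦ hΨ
  | succ n ih =>
    rintro Φ Ψ ⟨h1, h2, Φ', h3, h4⟩ ⟨k1, k2, Ψ', k3, k4⟩
    refine ⟨h1.add k1, ?_, fun u t => Φ' u t + Ψ' u t, fun u t => (h3 u t).add (k3 u t), ih h4 k4⟩
    simpa only [mul_add] using ih h2 k2

/-- Derivatives are unique, so the time derivative hidden in the existential can be replaced by a
known one. -/
theorem SmoothAmplitude.deriv {n : ℕ} {Φ Φ' : ℝ → ℝ → ℂ} (h : SmoothAmplitude ν κ (n + 1) Φ)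
    (hd : ∀ u t, HasDerivAt (Φ u) (Φ' u t) t) : SmoothAmplitude ν κ n Φ' := by
  obtain ⟨-, -, Ψ, h3, h4⟩ := h
  have : Φ' = Ψ := by ext u t; exact (hd u t).unique (h3 u t)
  rwa [this]

theorem exists_norm_exp_le (hκ : WaveNumbers κ) (x₀ : ℝ) :
    ∃ A : ℝ, 0 ≤ A ∧ ∀ u x, |x| ≤ |x₀| + 1 → ‖exp (I * κ u * (x : ℝ))‖ ≤ A := by
  obtain ⟨B, hB⟩ := hκ.bound_im
  refine ⟨Real.exp ((|x₀| + 1) * B), (Real.exp_pos _).le, fun u x hx => ?_⟩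
  rw [norm_exp_I_mul, Real.exp_le_exp]
  calc -x * (κ u).im ≤ |-x * (κ u).im| := le_abs_self _
    _ = |x| * |(κ u).im| := by rw [abs_mul, abs_neg]
    _ ≤ _ := by gcongr; exact hB u

theorem Dominated.integrable {Φ : ℝ → ℝ → ℂ} (h : Dominated ν Φ) (hκ : WaveNumbers κ) (p : ℝ × ℝ) :
    Integrable (fun u => exp (I * κ u * p.1) * Φ u p.2) ν := by
  obtain ⟨A, hA0, hA⟩ := exists_norm_exp_le hκ p.1
  obtain ⟨b, hb, hb'⟩ := h.bound |p.2|
  have := hκ.continuous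
  refine (hb.const_mul A).mono' ((Continuous.aestronglyMeasurable (by fun_prop)).mul (h.meas _))
    (ae_of_all _ fun u => ?_)
  rw [norm_mul]
  exact mul_le_mul (hA u p.1 (by linarith)) (hb' u p.2 le_rfl) (norm_nonneg _) hA0

theorem Dominated.continuous {Φ : ℝ → ℝ → ℂ} (h : Dominated ν Φ) (hκ : WaveNumbers κ) :
    Continuous (superpose ν κ Φ) := by
  refine continuous_iff_continuousAt.2 fun p => ?_
  obtain ⟨A, hA0, hA⟩ := exists_norm_exp_le hκ p.1
  obtain ⟨b, hb, hb'⟩ := h.bound (|p.2| + 1)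
  have hκc := hκ.continuous
  refine continuousAt_of_dominated (bound := fun u => A * b u)
    (Eventually.of_forall fun q => (h.integrable hκ q).1) ?_ (hb.const_mul A)
    (ae_of_all _ fun u => ?_)
  · filter_upwards [Metric.closedBall_mem_nhds p one_pos] with q hq
    rw [mem_closedBall_iff_norm, Prod.norm_def, max_le_iff] at hq
    refine ae_of_all _ fun u => ?_
    rw [norm_mul]
    refine mul_le_mul (hA u q.1 ?_) (hb' u q.2 ?_) (norm_nonneg _) hA0
    · linarith [abs_sub_abs_le_abs_sub q.1 p.1, show |q.1 - p.1| ≤ 1 from hq.1]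
    · linarith [abs_sub_abs_le_abs_sub q.2 p.2, show |q.2 - p.2| ≤ 1 from hq.2]
  · have := h.cont u
    fun_prop

/-- Under the integral, `∂ₓ` multiplies the amplitude by `iκ` and `∂ₜ` differentiates it. Both are
dominated near `p`, where `|e^{iκx}|` is bounded because `Im κ` is. -/
theorem hasFDerivAt_superpose {Φ Φ' : ℝ → ℝ → ℂ} (hκ : WaveNumbers κ) (h : Dominated ν Φ)
    (hx : Dominated ν (fun u t => I * κ u * Φ u t)) (hd : ∀ u t, HasDerivAt (Φ u) (Φ' u t) t)
    (ht : Dominated ν Φ') (p : ℝ × ℝ) :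
    HasFDerivAt (superpose ν κ Φ)
      ((ContinuousLinearMap.fst ℝ ℝ ℝ).smulRight (superpose ν κ (fun u t => I * κ u * Φ u t) p)
        + (ContinuousLinearMap.snd ℝ ℝ ℝ).smulRight (superpose ν κ Φ' p)) p := by
  obtain ⟨A, hA0, hA⟩ := exists_norm_exp_le hκ p.1
  obtain ⟨b, hb, hb'⟩ := hx.bound (|p.2| + 1)
  obtain ⟨c, hc, hc'⟩ := ht.bound (|p.2| + 1)
  set G : ℝ × ℝ → ℝ → ℂ := fun q u => exp (I * κ u * q.1) * (I * κ u * Φ u q.2)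
  set K : ℝ × ℝ → ℝ → ℂ := fun q u => exp (I * κ u * q.1) * Φ' u q.2
  have hG := hx.integrable hκ p
  have hK := ht.integrable hκ p
  have hintegral : ∫ u, ((ContinuousLinearMap.fst ℝ ℝ ℝ).smulRight (G p u)
        + (ContinuousLinearMap.snd ℝ ℝ ℝ).smulRight (K p u)) ∂ν
      = (ContinuousLinearMap.fst ℝ ℝ ℝ).smulRight (∫ u, G p u ∂ν)
        + (ContinuousLinearMap.snd ℝ ℝ ℝ).smulRight (∫ u, K p u ∂ν) := by
    have e1 := (ContinuousLinearMap.smulRightL ℝ (ℝ × ℝ) ℂ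
      (ContinuousLinearMap.fst ℝ ℝ ℝ)).integral_comp_comm hG
    have e2 := (ContinuousLinearMap.smulRightL ℝ (ℝ × ℝ) ℂ
      (ContinuousLinearMap.snd ℝ ℝ ℝ)).integral_comp_comm hK
    rw [integral_add]
    · exact congrArg₂ (· + ·) e1 e2
    · exact (ContinuousLinearMap.smulRightL ℝ (ℝ × ℝ) ℂ
        (ContinuousLinearMap.fst ℝ ℝ ℝ)).integrable_comp hG
    · exact (ContinuousLinearMap.smulRightL ℝ (ℝ × ℝ) ℂ
        (ContinuousLinearMap.snd ℝ ℝ ℝ)).integrable_comp hK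
  have key := hasFDerivAt_integral_of_dominated_of_fderiv_le (𝕜 := ℝ) (μ := ν)
    (F := fun (q : ℝ × ℝ) u => exp (I * κ u * q.1) * Φ u q.2)
    (F' := fun q u => (ContinuousLinearMap.fst ℝ ℝ ℝ).smulRight (G q u)
        + (ContinuousLinearMap.snd ℝ ℝ ℝ).smulRight (K q u)) (x₀ := p)
    (bound := fun u => A * b u + A * c u)
    (Metric.closedBall_mem_nhds p one_pos)
    (Eventually.of_forall fun q => (h.integrable hκ q).1) (h.integrable hκ p) ?_ ?_
    ((hb.const_mul A).add (hc.const_mul A)) ?_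
  · rw [hintegral] at key
    exact key
  · refine AEStronglyMeasurable.add ?_ ?_
    · exact ((ContinuousLinearMap.smulRightL ℝ (ℝ × ℝ) ℂ
        (ContinuousLinearMap.fst ℝ ℝ ℝ)).integrable_comp hG).1
    · exact ((ContinuousLinearMap.smulRightL ℝ (ℝ × ℝ) ℂ
        (ContinuousLinearMap.snd ℝ ℝ ℝ)).integrable_comp hK).1
  · refine ae_of_all _ fun u q hq => ?_
    rw [mem_closedBall_iff_norm, Prod.norm_def, max_le_iff] at hq
    have hq1 : |q.1| ≤ |p.1| + 1 := by
      linarith [abs_sub_abs_le_abs_sub q.1 p.1, show |q.1 - p.1| ≤ 1 from hq.1]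
    have hq2 : |q.2| ≤ |p.2| + 1 := by
      linarith [abs_sub_abs_le_abs_sub q.2 p.2, show |q.2 - p.2| ≤ 1 from hq.2]
    refine (norm_add_le _ _).trans (add_le_add ?_ ?_)
    · rw [ContinuousLinearMap.norm_smulRight_apply]
      refine (mul_le_of_le_one_left (norm_nonneg _) (ContinuousLinearMap.norm_fst_le ℝ ℝ ℝ)).trans ?_
      rw [norm_mul]
      exact mul_le_mul (hA u q.1 hq1) (hb' u q.2 hq2) (norm_nonneg _) hA0
    · rw [ContinuousLinearMap.norm_smulRight_apply]
      refine (mul_le_of_le_one_left (norm_nonneg _) (ContinuousLinearMap.norm_snd_le ℝ ℝ ℝ)).trans ?_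
      rw [norm_mul]
      exact mul_le_mul (hA u q.1 hq1) (hc' u q.2 hq2) (norm_nonneg _) hA0
  · refine ae_of_all _ fun u q _ => ?_
    have h1 : HasDerivAt (fun x : ℝ => exp (I * κ u * x)) (exp (I * κ u * q.1) * (I * κ u)) q.1 := by
      have : HasDerivAt (fun x : ℝ => I * κ u * (x : ℂ)) (I * κ u) q.1 := by
        simpa using ((hasDerivAt_id (q.1 : ℂ)).const_mul (I * κ u)).comp_ofReal
      exact this.cexp
    have h2 := h1.hasFDerivAt.comp q (hasFDerivAt_fst (p := q))
    have h3 := (hd u q.2).hasFDerivAt.comp q (hasFDerivAt_snd (p := q))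
    convert! h2.mul h3 using 1
    ext
    · simp [G, K]; ring
    · simp [G, K]

/-- Both partial derivatives are again superpositions, with amplitudes that are smooth to one order
less; hence induction. -/
theorem SmoothAmplitude.contDiff (hκ : WaveNumbers κ) {n : ℕ} : ∀ {Φ : ℝ → ℝ → ℂ},
    SmoothAmplitude ν κ n Φ → ContDiff ℝ n (superpose ν κ Φ) := by
  induction n with
  | zero => intro Φ h; exact contDiff_zero.2 (Dominated.continuous h hκ)
  | succ n ih =>
    rintro Φ ⟨h1, h2, Φ', h3, h4⟩
    push_cast
    refine contDiff_succ_iff_hasFDerivAt.2 ⟨_, ?_,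
      hasFDerivAt_superpose hκ h1 h2.dominated h3 h4.dominated⟩
    have e1 := ih h2
    have e2 := ih h4
    exact (((ContinuousLinearMap.smulRightL ℝ (ℝ × ℝ) ℂ
      (ContinuousLinearMap.fst ℝ ℝ ℝ)).contDiff.comp e1).add
      ((ContinuousLinearMap.smulRightL ℝ (ℝ × ℝ) ℂ (ContinuousLinearMap.snd ℝ ℝ ℝ)).contDiff.comp e2))

theorem SmoothAmplitude.hasDerivAt_fst (hκ : WaveNumbers κ) {n : ℕ} {Φ : ℝ → ℝ → ℂ}
    (h : SmoothAmplitude ν κ (n + 1) Φ) (x t : ℝ) :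
    HasDerivAt (fun y => superpose ν κ Φ (y, t))
      (superpose ν κ (fun u t => I * κ u * Φ u t) (x, t)) x := by
  obtain ⟨h1, h2, Φ', h3, h4⟩ := h
  have h5 := (hasFDerivAt_superpose hκ h1 h2.dominated h3 h4.dominated (x, t)).comp_hasDerivAt x
    ((hasDerivAt_id x).prodMk (hasDerivAt_const x t))
  simpa [Function.comp_def] using h5

theorem SmoothAmplitude.hasDerivAt_snd (hκ : WaveNumbers κ) {n : ℕ} {Φ Φ' : ℝ → ℝ → ℂ}
    (h : SmoothAmplitude ν κ (n + 1) Φ) (hd : ∀ u t, HasDerivAt (Φ u) (Φ' u t) t) (x t : ℝ) :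
    HasDerivAt (fun s => superpose ν κ Φ (x, s)) (superpose ν κ Φ' (x, t)) t := by
  have h4 := h.deriv hd
  obtain ⟨h1, h2, -⟩ := h
  have h5 := (hasFDerivAt_superpose hκ h1 h2.dominated hd h4.dominated (x, t)).comp_hasDerivAt t
    ((hasDerivAt_const t x).prodMk (hasDerivAt_id t))
  simpa [Function.comp_def] using h5

end Superpose

/-- Functions of `z` and `t` that are `n` times differentiable in `t` with jointly continuous
derivatives. -/
def TimeSmooth : ℕ → (ℂ → ℝ → ℂ) → Prop
  | 0, φ => Continuous (fun p : ℂ × ℝ => φ p.1 p.2)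
  | n + 1, φ => Continuous (fun p : ℂ × ℝ => φ p.1 p.2) ∧
      ∃ φ' : ℂ → ℝ → ℂ, (∀ z t, HasDerivAt (φ z) (φ' z t) t) ∧ TimeSmooth n φ'

theorem TimeSmooth.of_succ {n : ℕ} : ∀ {φ : ℂ → ℝ → ℂ}, TimeSmooth (n + 1) φ → TimeSmooth n φ := by
  induction n with
  | zero => intro φ h; exact h.1
  | succ n ih => rintro φ ⟨h1, φ', h2, h3⟩; exact ⟨h1, φ', h2, ih h3⟩

theorem TimeSmooth.add {n : ℕ} : ∀ {φ ψ : ℂ → ℝ → ℂ}, TimeSmooth n φ → TimeSmooth n ψ →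
    TimeSmooth n (fun z t => φ z t + ψ z t) := by
  induction n with
  | zero => intro φ ψ h k; exact Continuous.add h k
  | succ n ih =>
    rintro φ ψ ⟨h1, φ', h2, h3⟩ ⟨k1, ψ', k2, k3⟩
    exact ⟨h1.add k1, fun z t => φ' z t + ψ' z t, fun z t => (h2 z t).add (k2 z t), ih h3 k3⟩

theorem TimeSmooth.mul_left {n : ℕ} {a : ℂ → ℂ} (ha : Continuous a) : ∀ {φ : ℂ → ℝ → ℂ},
    TimeSmooth n φ → TimeSmooth n (fun z t => a z * φ z t) := by
  induction n with
  | zero => intro φ h; exact (ha.comp continuous_fst).mul h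
  | succ n ih =>
    rintro φ ⟨h1, φ', h2, h3⟩
    exact ⟨(ha.comp continuous_fst).mul h1, fun z t => a z * φ' z t,
      fun z t => (h2 z t).const_mul (a z), ih h3⟩

/-- Each function is, up to a continuous factor in `z`, the derivative of the other, so the two are
treated in one induction. -/
theorem timeSmooth_cosTime_sinTime (n : ℕ) : TimeSmooth n cosTime ∧ TimeSmooth n sinTime := by
  induction n with
  | zero => exact ⟨continuous_cosTime, continuous_sinTime⟩
  | succ n ih =>
    exact ⟨⟨continuous_cosTime, fun z t => -z * sinTime z t, hasDerivAt_cosTime,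
      ih.2.mul_left continuous_neg⟩, ⟨continuous_sinTime, cosTime, hasDerivAt_sinTime, ih.1⟩⟩

theorem timeSmooth_schwartz (n : ℕ) : ∀ g : 𝓢(ℝ, ℂ), TimeSmooth n (fun _ t => g t) := by
  induction n with
  | zero => intro g; exact g.continuous.comp continuous_snd
  | succ n ih =>
    intro g
    exact ⟨g.continuous.comp continuous_snd, fun _ t => SchwartzMap.derivCLM ℂ ℂ g t,
      fun _ t => g.differentiableAt.hasDerivAt, ih _⟩

theorem timeSmooth_cosConv_sinConv (n : ℕ) (g : 𝓢(ℝ, ℂ)) :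
    TimeSmooth n (cosConv g) ∧ TimeSmooth n (sinConv g) := by
  induction n with
  | zero => exact ⟨continuous_cosConv g.continuous, continuous_sinConv g.continuous⟩
  | succ n ih =>
    refine ⟨⟨continuous_cosConv g.continuous, fun z t => g t + -z * sinConv g z t, fun z t => ?_,
      (timeSmooth_schwartz n g).add (ih.2.mul_left continuous_neg)⟩,
      ⟨continuous_sinConv g.continuous, cosConv g, hasDerivAt_sinConv g.continuous, ih.1⟩⟩
    simp only [neg_mul, ← sub_eq_add_neg]
    exact hasDerivAt_cosConv g.continuous z t

/-- Weights with `n` integrable moments. -/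
def HasMoments (ν : Measure ℝ) (κ : ℝ → ℂ) (n : ℕ) (w : ℝ → ℂ) : Prop :=
  AEStronglyMeasurable w ν ∧ Integrable (fun u => (1 + ‖κ u‖) ^ n * ‖w u‖) ν

/-! ### Integrable moments of the weights. -/

section Moments

variable {ν : Measure ℝ} {κ : ℝ → ℂ}

theorem HasMoments.of_le {n m : ℕ} {v w : ℝ → ℂ} (hκ : WaveNumbers κ) (hw : HasMoments ν κ n w)
    (hv : AEStronglyMeasurable v ν) {B : ℝ}
    (h : ∀ u, (1 + ‖κ u‖) ^ m * ‖v u‖ ≤ B * ((1 + ‖κ u‖) ^ n * ‖w u‖)) : HasMoments ν κ m v := by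
  have := hκ.continuous
  refine ⟨hv, (hw.2.const_mul B).mono'
    ((Continuous.aestronglyMeasurable (by fun_prop)).mul hv.norm) (ae_of_all _ fun u => ?_)⟩
  rw [Real.norm_of_nonneg (by positivity)]
  exact h u

theorem HasMoments.of_succ {n : ℕ} {w : ℝ → ℂ} (hκ : WaveNumbers κ) (hw : HasMoments ν κ (n + 1) w) :
    HasMoments ν κ n w := by
  refine hw.of_le hκ hw.1 (B := 1) fun u => ?_
  rw [one_mul]
  gcongr
  · linarith [norm_nonneg (κ u)]
  · omega

theorem HasMoments.mul_bdd {n : ℕ} {w a : ℝ → ℂ} (hκ : WaveNumbers κ) (hw : HasMoments ν κ n w)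
    (ha : Continuous a) (hb : ∃ B, ∀ u, ‖a u‖ ≤ B) : HasMoments ν κ n (fun u => a u * w u) := by
  obtain ⟨B, hB⟩ := hb
  refine hw.of_le hκ (ha.aestronglyMeasurable.mul hw.1) (B := B) fun u => ?_
  rw [norm_mul]
  calc _ = ‖a u‖ * ((1 + ‖κ u‖) ^ n * ‖w u‖) := by ring
    _ ≤ _ := by gcongr; exact hB u

theorem HasMoments.mul_waveNumber {n : ℕ} {w : ℝ → ℂ} (hκ : WaveNumbers κ)
    (hw : HasMoments ν κ (n + 1) w) : HasMoments ν κ n (fun u => I * κ u * w u) := by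
  have := hκ.continuous
  refine hw.of_le hκ ((Continuous.aestronglyMeasurable (by fun_prop)).mul hw.1) (B := 1) fun u => ?_
  rw [norm_mul, norm_mul, norm_I, one_mul, one_mul, pow_succ]
  calc _ = (1 + ‖κ u‖) ^ n * ‖κ u‖ * ‖w u‖ := by ring
    _ ≤ _ := by gcongr; linarith [norm_nonneg (κ u)]

theorem HasMoments.const_mul {n : ℕ} {w : ℝ → ℂ} (hκ : WaveNumbers κ)
    (hw : HasMoments ν κ n w) (c : ℂ) : HasMoments ν κ n (fun u => c * w u) :=
  hw.mul_bdd hκ continuous_const ⟨‖c‖, fun _ => le_rfl⟩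

theorem WaveNumbers.continuous_omegaSq (hκ : WaveNumbers κ) : Continuous (fun u => omegaSq (κ u)) := by
  have := hκ.continuous
  exact Continuous.div (by fun_prop) (by fun_prop) hκ.ne

theorem WaveNumbers.continuous_div (hκ : WaveNumbers κ) :
    Continuous (fun u => κ u / (1 + κ u ^ 2)) := by
  have := hκ.continuous
  exact Continuous.div (by fun_prop) (by fun_prop) hκ.ne

/-- As `ω²` is bounded along the wave numbers, `φ` is evaluated on a compact set for `|t| ≤ T`, and
the weight alone dominates. -/
theorem HasMoments.dominated {w : ℝ → ℂ} {φ : ℂ → ℝ → ℂ} (hκ : WaveNumbers κ) {n : ℕ}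
    (hw : HasMoments ν κ n w) (hφ : Continuous (fun p : ℂ × ℝ => φ p.1 p.2)) :
    Dominated ν (fun u t => w u * φ (omegaSq (κ u)) t) := by
  have hz := hκ.continuous_omegaSq
  refine ⟨fun t => hw.1.mul (Continuous.aestronglyMeasurable ?_), fun u => ?_, fun T => ?_⟩
  · exact hφ.comp (hz.prodMk continuous_const)
  · exact continuous_const.mul (hφ.comp (continuous_const.prodMk continuous_id))
  · obtain ⟨Z, hZ⟩ := hκ.bound_omegaSq
    obtain ⟨M, hM⟩ := ((isCompact_closedBall (0 : ℂ) Z).prod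
      (isCompact_Icc (a := -T) (b := T))).exists_bound_of_continuousOn hφ.continuousOn
    refine ⟨fun u => |M| * ((1 + ‖κ u‖) ^ n * ‖w u‖), hw.2.const_mul _, fun u t ht => ?_⟩
    have h1 : ‖φ (omegaSq (κ u)) t‖ ≤ |M| :=
      (hM (omegaSq (κ u), t) ⟨by simpa using hZ u, abs_le.1 ht⟩).trans (le_abs_self _)
    have h2 : 1 ≤ (1 + ‖κ u‖) ^ n := one_le_pow₀ (by linarith [norm_nonneg (κ u)])
    rw [norm_mul, mul_comm ‖w u‖]
    exact mul_le_mul h1 (le_mul_of_one_le_left (norm_nonneg _) h2) (norm_nonneg _) (abs_nonneg _)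

/-- An `x`-derivative costs one moment of the weight. A `t`-derivative costs one order of time
smoothness and no moment, since `ω²` is bounded. -/
theorem HasMoments.smoothAmplitude (hκ : WaveNumbers κ) {n : ℕ} :
    ∀ {w : ℝ → ℂ} {φ : ℂ → ℝ → ℂ}, HasMoments ν κ n w → TimeSmooth n φ →
    SmoothAmplitude ν κ n (fun u t => w u * φ (omegaSq (κ u)) t) := by
  induction n with
  | zero => intro w φ hw hφ; exact hw.dominated hκ hφ
  | succ n ih =>
    rintro w φ hw hφ
    have hφ' := hφ
    obtain ⟨h1, φ', h2, h3⟩ := hφ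
    refine ⟨hw.dominated hκ h1, ?_, fun u t => w u * φ' (omegaSq (κ u)) t,
      fun u t => (h2 _ t).const_mul _, ih (hw.of_succ hκ) h3⟩
    simpa only [mul_assoc] using ih (hw.mul_waveNumber hκ) hφ'.of_succ

end Moments

/-! ### Superpositions that solve the linear system -/

/-- The response of `r` to the boundary data `g`. -/
def forcingR (g : ℝ → ℂ) (z : ℂ) (t : ℝ) : ℂ :=
  2 * cosConv g z t + -2 * z * sinConv (deriv g) z t

/-- The response of `q` to the boundary data `g`, up to the factor `-2ik/(1+k²)`. -/
def forcingQ (g : ℝ → ℂ) (z : ℂ) (t : ℝ) : ℂ := sinConv g z t + cosConv (deriv g) z t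

theorem continuous_deriv_schwartz (g : 𝓢(ℝ, ℂ)) : Continuous (deriv g) :=
  (SchwartzMap.derivCLM ℂ ℂ g).continuous

theorem timeSmooth_forcingR (n : ℕ) (g : 𝓢(ℝ, ℂ)) : TimeSmooth n (forcingR g) :=
  ((timeSmooth_cosConv_sinConv n g).1.mul_left continuous_const).add
    ((timeSmooth_cosConv_sinConv n (SchwartzMap.derivCLM ℂ ℂ g)).2.mul_left
      (a := fun z => -2 * z) (by fun_prop))

theorem timeSmooth_forcingQ (n : ℕ) (g : 𝓢(ℝ, ℂ)) : TimeSmooth n (forcingQ g) :=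
  (timeSmooth_cosConv_sinConv n g).2.add
    (timeSmooth_cosConv_sinConv n (SchwartzMap.derivCLM ℂ ℂ g)).1

theorem hasDerivAt_forcingR (g : 𝓢(ℝ, ℂ)) (z : ℂ) (t : ℝ) :
    HasDerivAt (forcingR g z) (2 * g t - 2 * z * forcingQ g z t) t := by
  convert! ((hasDerivAt_cosConv g.continuous z t).const_mul 2).add
    ((hasDerivAt_sinConv (continuous_deriv_schwartz g) z t).const_mul (-2 * z)) using 1
  rw [forcingQ]; ring

theorem hasDerivAt_forcingQ (g : 𝓢(ℝ, ℂ)) (z : ℂ) (t : ℝ) :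
    HasDerivAt (forcingQ g z) (deriv g t + 1 / 2 * forcingR g z t) t := by
  convert! (hasDerivAt_sinConv g.continuous z t).add
    (hasDerivAt_cosConv (continuous_deriv_schwartz g) z t) using 1
  rw [forcingR]; ring

section Pair

variable (κ a b d : ℝ → ℂ) (g : 𝓢(ℝ, ℂ))

/-- Amplitude of `r` for initial amplitudes `(a, b)` of `(r, q)` and boundary forcing of
strength `d`. -/
def amplitudeR (u t : ℝ) : ℂ :=
  a u * cosTime (omegaSq (κ u)) t + -(I * κ u * b u) * sinTime (omegaSq (κ u)) t
    + d u * forcingR g (omegaSq (κ u)) t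

/-- Amplitude of `q` for initial amplitudes `(a, b)` of `(r, q)` and boundary forcing of
strength `d`. -/
def amplitudeQ (u t : ℝ) : ℂ :=
  b u * cosTime (omegaSq (κ u)) t
    + -I * (κ u / (1 + κ u ^ 2) * a u) * sinTime (omegaSq (κ u)) t
    + -2 * I * (κ u / (1 + κ u ^ 2) * d u) * forcingQ g (omegaSq (κ u)) t

/-- Time derivative of `amplitudeR`. -/
def amplitudeR' (u t : ℝ) : ℂ := -(I * κ u) * amplitudeQ κ a b d g u t + 2 * g t * d u

/-- Time derivative of `amplitudeQ`. -/
def amplitudeQ' (u t : ℝ) : ℂ :=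
  -I * (κ u / (1 + κ u ^ 2)) * amplitudeR κ a b d g u t
    + -2 * I * (κ u / (1 + κ u ^ 2)) * deriv g t * d u

theorem hasDerivAt_amplitudeR (u t : ℝ) :
    HasDerivAt (amplitudeR κ a b d g u) (amplitudeR' κ a b d g u t) t := by
  convert! (((hasDerivAt_cosTime (omegaSq (κ u)) t).const_mul (a u)).add
    ((hasDerivAt_sinTime (omegaSq (κ u)) t).const_mul (-(I * κ u * b u)))).add
    ((hasDerivAt_forcingR g (omegaSq (κ u)) t).const_mul (d u)) using 1
  rw [amplitudeR', amplitudeQ]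
  -- With `c = κ/(1+κ²)` made an atom, the only relation needed is `ω² = κ c`.
  have : omegaSq (κ u) = κ u * (κ u / (1 + κ u ^ 2)) := by rw [omegaSq]; ring
  generalize hz : κ u / (1 + κ u ^ 2) = c at *
  linear_combination (-a u * sinTime (omegaSq (κ u)) t - 2 * d u * forcingQ g (omegaSq (κ u)) t)
    * this * I ^ 2
    + (omegaSq (κ u) * a u * sinTime (omegaSq (κ u)) t
      + 2 * omegaSq (κ u) * d u * forcingQ g (omegaSq (κ u)) t) * I_sq

theorem hasDerivAt_amplitudeQ (u t : ℝ) :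
    HasDerivAt (amplitudeQ κ a b d g u) (amplitudeQ' κ a b d g u t) t := by
  convert! (((hasDerivAt_cosTime (omegaSq (κ u)) t).const_mul (b u)).add
    ((hasDerivAt_sinTime (omegaSq (κ u)) t).const_mul (-I * (κ u / (1 + κ u ^ 2) * a u)))).add
    ((hasDerivAt_forcingQ g (omegaSq (κ u)) t).const_mul (-2 * I * (κ u / (1 + κ u ^ 2) * d u))) using 1
  rw [amplitudeQ', amplitudeR]
  have : omegaSq (κ u) = κ u * (κ u / (1 + κ u ^ 2)) := by rw [omegaSq]; ring
  generalize hz : κ u / (1 + κ u ^ 2) = c at *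
  linear_combination (-b u * sinTime (omegaSq (κ u)) t) * this * I ^ 2
    + (omegaSq (κ u) * b u * sinTime (omegaSq (κ u)) t) * I_sq

end Pair

/-- Admissible wave numbers, initial amplitudes and forcing strength. -/
structure AdmissiblePair (ν : Measure ℝ) (κ a b d : ℝ → ℂ) : Prop where
  waveNumbers : WaveNumbers κ
  moments_a : HasMoments ν κ 3 a
  moments_b : HasMoments ν κ 4 b
  moments_d : HasMoments ν κ 3 d

/-! ### The differential equations for superpositions. -/

section Pair

variable {ν : Measure ℝ} {κ a b d : ℝ → ℂ}

theorem AdmissiblePair.smoothR (h : AdmissiblePair ν κ a b d) (g : 𝓢(ℝ, ℂ)) :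
    SmoothAmplitude ν κ 3 (amplitudeR κ a b d g) := by
  have hκ := h.waveNumbers
  obtain ⟨hc, hs⟩ := timeSmooth_cosTime_sinTime 3
  have h2 := ((h.moments_b.mul_waveNumber hκ).const_mul hκ (-1)).smoothAmplitude hκ hs
  have h3 := ((h.moments_a.smoothAmplitude hκ hc).add h2).add
    (h.moments_d.smoothAmplitude hκ (timeSmooth_forcingR 3 g))
  simpa only [neg_one_mul] using! h3

theorem AdmissiblePair.smoothQ (h : AdmissiblePair ν κ a b d) (g : 𝓢(ℝ, ℂ)) :
    SmoothAmplitude ν κ 3 (amplitudeQ κ a b d g) := by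
  have hκ := h.waveNumbers
  obtain ⟨hc, hs⟩ := timeSmooth_cosTime_sinTime 3
  have h2 := ((h.moments_a.mul_bdd hκ hκ.continuous_div hκ.bound_div).const_mul hκ (-I)).smoothAmplitude hκ hs
  have h3 := ((h.moments_d.mul_bdd hκ hκ.continuous_div hκ.bound_div).const_mul hκ (-2 * I)).smoothAmplitude
    hκ (timeSmooth_forcingQ 3 g)
  exact (((h.moments_b.of_succ hκ).smoothAmplitude hκ hc).add h2).add h3

/-- Mode by mode `R' + iκQ = 2 g d`. The source vanishes after integration: on the line `d = 0`, and
on the contour the integral is that of `e^{ikx}` over a closed curve. -/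
theorem AdmissiblePair.first_equation (h : AdmissiblePair ν κ a b d) (g : 𝓢(ℝ, ℂ)) (p : ℝ × ℝ) :
    superpose ν κ (amplitudeR' κ a b d g) p
      + superpose ν κ (fun u t => I * κ u * amplitudeQ κ a b d g u t) p
      = 2 * g p.2 * ∫ u, exp (I * κ u * p.1) * d u ∂ν := by
  have hκ := h.waveNumbers
  have h1 := ((h.smoothR g).deriv (hasDerivAt_amplitudeR κ a b d g)).dominated.integrable hκ p
  have h2 := (h.smoothQ g).2.1.dominated.integrable hκ p
  rw [superpose, superpose, ← integral_add h1 h2, ← integral_const_mul]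
  congr 1; ext u
  rw [amplitudeR']; ring

/-- In Fourier variables `q_t - q_{xxt}` is `(1+κ²) Q'`, and the factor `1+κ²` cancels the
denominator in `Q'`, leaving `-iκR` and the source. -/
theorem AdmissiblePair.second_equation (h : AdmissiblePair ν κ a b d) (g : 𝓢(ℝ, ℂ)) (p : ℝ × ℝ) :
    superpose ν κ (amplitudeQ' κ a b d g) p
      + superpose ν κ (fun u t => I * κ u * amplitudeR κ a b d g u t) p
      - superpose ν κ (fun u t => I * κ u * (I * κ u * amplitudeQ' κ a b d g u t)) p
      = -2 * deriv g p.2 * ∫ u, exp (I * κ u * p.1) * (I * κ u * d u) ∂ν := by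
  have hκ := h.waveNumbers
  have hQ' := (h.smoothQ g).deriv (hasDerivAt_amplitudeQ κ a b d g)
  have h1 := hQ'.dominated.integrable hκ p
  have h2 := (h.smoothR g).2.1.dominated.integrable hκ p
  have h3 := hQ'.2.1.2.1.dominated.integrable hκ p
  have h12 : Integrable (fun u => exp (I * κ u * p.1) * amplitudeQ' κ a b d g u p.2
      + exp (I * κ u * p.1) * (I * κ u * amplitudeR κ a b d g u p.2)) ν := h1.add h2
  simp only at h3
  rw [superpose, superpose, superpose, ← integral_add h1 h2, ← integral_sub h12 h3,
    ← integral_const_mul]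
  congr 1; ext u
  have hk : (1 + κ u ^ 2) * (κ u / (1 + κ u ^ 2)) = κ u := mul_div_cancel₀ _ (hκ.ne u)
  simp only [amplitudeQ']
  generalize κ u / (1 + κ u ^ 2) = c at *
  linear_combination (exp (I * κ u * p.1) * (-I * amplitudeR κ a b d g u p.2
      - 2 * I * deriv g p.2 * d u)) * hk
    - exp (I * κ u * p.1) * κ u ^ 2 * c * (-I * amplitudeR κ a b d g u p.2
      - 2 * I * deriv g p.2 * d u) * I_sq

end Pair

/-! ### Behaviour of the jet part at `i` and at infinity -/

theorem one_add_I_mul_eq (k : ℂ) : 1 + I * k = I * (k - I) := by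
  linear_combination I_sq

theorem RectContour.zero {γ : ℝ → ℂ} (hγ : IsContourAroundI γ) : RectContour γ (fun _ => 0) :=
  rectContour_of_differentiableOn hγ continuousOn_const (differentiableOn_const 0)

/-- Since `1 + ik = i(k-i)`, each jet term only raises the order of the pole at `i`. -/
theorem rectContour_jetFourier {γ : ℝ → ℂ} (hγ : IsContourAroundI γ) (f : 𝓢(ℝ, ℂ)) (n m : ℕ)
    {w E : ℂ → ℂ} (hc : ContinuousOn w closedUpper) (hd : DifferentiableOn ℂ w upper)
    (hE : Differentiable ℂ E) :
    RectContour γ (fun k => w k / (k - I) ^ m * jetFourier f n k * E (omegaSq k)) := by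
  induction n with
  | zero => simpa [jetFourier] using RectContour.zero hγ
  | succ n ih =>
    have h := (rectContour_entire hγ hE hc hd (m + (n + 1))).const_mul
      ((oneAddDeriv^[n] f) 0 / I ^ (n + 1))
    refine (ih.add hγ h).congr hγ fun k hk => ?_
    have h0 := sub_I_ne_zero hk
    have h1 := I_ne_zero
    simp only [jetFourier, Finset.sum_range_succ, one_add_I_mul_eq, mul_pow, pow_add, pow_one]
    field_simp

theorem one_sub_I_mul_ne_zero {k : ℂ} (hk : k ∈ closedUpper) : 1 + I * -k ≠ 0 := by
  refine one_add_I_mul_ne_zero (ne_I_of_im_nonpos ?_)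
  have : 0 ≤ k.im := hk
  simpa using this

theorem continuousOn_jetFourier_neg (f : 𝓢(ℝ, ℂ)) (n : ℕ) :
    ContinuousOn (fun k => jetFourier f n (-k)) closedUpper := by
  unfold jetFourier
  exact continuousOn_finsetSum _ fun j _ => ContinuousOn.div (by fun_prop) (by fun_prop)
    fun k hk => pow_ne_zero _ (one_sub_I_mul_ne_zero hk)

theorem differentiableOn_jetFourier_neg (f : 𝓢(ℝ, ℂ)) (n : ℕ) :
    DifferentiableOn ℂ (fun k => jetFourier f n (-k)) upper := by
  unfold jetFourier
  exact DifferentiableOn.fun_sum fun j _ => DifferentiableOn.div (by fun_prop) (by fun_prop)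
    fun k hk => pow_ne_zero _ (one_sub_I_mul_ne_zero (upper_subset_closedUpper hk))

theorem neg_mem_im_nonpos {k : ℂ} (hk : k ∈ closedUpper) : (-k).im ≤ 0 := by
  have : 0 ≤ k.im := hk
  simpa using this

theorem neg_mem_im_neg {k : ℂ} (hk : k ∈ upper) : (-k).im < 0 := by
  have : 0 < k.im := hk
  simpa using this

theorem continuousOn_halfLineFourier_neg (f : 𝓢(ℝ, ℂ)) :
    ContinuousOn (fun k => halfLineFourier f (-k)) closedUpper :=
  (continuousOn_halfLineFourier f).comp continuousOn_neg fun _ hk => neg_mem_im_nonpos hk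

theorem differentiableOn_halfLineFourier_neg (f : 𝓢(ℝ, ℂ)) :
    DifferentiableOn ℂ (fun k => halfLineFourier f (-k)) upper :=
  (differentiableOn_halfLineFourier f).comp differentiable_neg.differentiableOn
    fun _ hk => neg_mem_im_neg hk

theorem continuousOn_tailFourier_neg (f : 𝓢(ℝ, ℂ)) (n : ℕ) :
    ContinuousOn (fun k => tailFourier f n (-k)) closedUpper :=
  (continuousOn_tailFourier f n).comp continuousOn_neg fun _ hk => neg_mem_im_nonpos hk

theorem differentiableOn_tailFourier_neg (f : 𝓢(ℝ, ℂ)) (n : ℕ) :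
    DifferentiableOn ℂ (fun k => tailFourier f n (-k)) upper :=
  (differentiableOn_tailFourier f n).comp differentiable_neg.differentiableOn
    fun _ hk => neg_mem_im_neg hk

/-! ### Behaviour of jets, tails and `ω²` at infinity. -/

section Limits

open Bornology

theorem tendsto_one_add_I_mul_inv : Tendsto (fun k : ℂ => (1 + I * k)⁻¹) (cobounded ℂ) (𝓝 0) := by
  refine tendsto_inv₀_cobounded.comp ?_
  rw [← tendsto_norm_atTop_iff_cobounded]
  refine tendsto_atTop_mono (f := fun k : ℂ => ‖k‖ - 1) (fun k => ?_)
    (tendsto_atTop_add_const_right _ _ tendsto_norm_cobounded_atTop)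
  have := norm_sub_le (1 + I * k) 1
  rw [add_sub_cancel_left, norm_mul, norm_I, one_mul, norm_one] at this
  linarith

theorem tendsto_mul_one_add_I_mul_inv :
    Tendsto (fun k : ℂ => k * (1 + I * k)⁻¹) (cobounded ℂ) (𝓝 (-I)) := by
  have h : Tendsto (fun k : ℂ => -I + I * (1 + I * k)⁻¹) (cobounded ℂ) (𝓝 (-I + I * 0)) :=
    (tendsto_one_add_I_mul_inv.const_mul I).const_add _
  rw [mul_zero, add_zero] at h
  refine h.congr' ?_
  filter_upwards [eventually_ne_cobounded I] with k hk
  have h0 := one_add_I_mul_ne_zero hk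
  field_simp
  linear_combination (-k) * I_sq

/-- As `k/(1+ik) → -i`, only the term `j = 0`, which carries `f(0)`, survives in the limit. -/
theorem tendsto_mul_jetFourier (f : 𝓢(ℝ, ℂ)) (n : ℕ) :
    Tendsto (fun k => k * jetFourier f (n + 1) k) (cobounded ℂ) (𝓝 (-I * f 0)) := by
  have h : ∀ j ∈ Finset.range (n + 1), Tendsto (fun k : ℂ => (oneAddDeriv^[j] f) 0 *
      ((k * (1 + I * k)⁻¹) * (1 + I * k)⁻¹ ^ j)) (cobounded ℂ)
      (𝓝 ((oneAddDeriv^[j] f) 0 * (-I * 0 ^ j))) := fun j _ =>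
    ((tendsto_mul_one_add_I_mul_inv.mul (tendsto_one_add_I_mul_inv.pow j)).const_mul _)
  have h2 := tendsto_finsetSum _ h
  rw [Finset.sum_range_succ', Finset.sum_eq_zero (fun j _ => by simp), zero_add] at h2
  simp only [Function.iterate_zero, id_eq, pow_zero, mul_one] at h2
  rw [mul_comm (f 0)] at h2
  refine h2.congr fun k => ?_
  rw [jetFourier, Finset.mul_sum]
  refine Finset.sum_congr rfl fun j _ => ?_
  rw [inv_pow, div_eq_mul_inv, pow_succ, mul_inv]
  ring

theorem tendsto_jetFourier (f : 𝓢(ℝ, ℂ)) (n : ℕ) :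
    Tendsto (fun k => jetFourier f (n + 1) k) (cobounded ℂ) (𝓝 0) := by
  have h := (tendsto_inv₀_cobounded (α := ℂ)).mul (tendsto_mul_jetFourier f n)
  rw [zero_mul] at h
  refine h.congr' ?_
  filter_upwards [eventually_ne_cobounded 0] with k hk
  field_simp

theorem tendsto_omegaSq : Tendsto omegaSq (cobounded ℂ) (𝓝 1) :=
  tendsto_mul_div.congr fun k => by rw [omegaSq]; ring

theorem tendsto_div : Tendsto (fun k : ℂ => k / (1 + k ^ 2)) (cobounded ℂ) (𝓝 0) := by
  have h := (tendsto_inv₀_cobounded (α := ℂ)).mul tendsto_mul_div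
  rw [zero_mul] at h
  refine h.congr' ?_
  filter_upwards [eventually_ne_cobounded 0] with k hk
  field_simp

theorem tendsto_cosTime_omegaSq (t : ℝ) :
    Tendsto (fun k => cosTime (omegaSq k) t) (cobounded ℂ) (𝓝 (Real.cos t)) := by
  rw [← cosTime_one]
  exact ((differentiable_cosTime t).continuous.tendsto 1).comp tendsto_omegaSq

theorem tendsto_sinTime_omegaSq (t : ℝ) :
    Tendsto (fun k => sinTime (omegaSq k) t) (cobounded ℂ) (𝓝 (Real.sin t)) := by
  rw [← sinTime_one]
  exact ((differentiable_sinTime t).continuous.tendsto 1).comp tendsto_omegaSq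

theorem upperInfty_le : upperInfty ≤ cobounded ℂ := inf_le_left

theorem tendsto_neg_upperInfty : Tendsto (fun k : ℂ => -k) upperInfty (cobounded ℂ) :=
  (tendsto_neg_cobounded (E := ℂ)).mono_left upperInfty_le

/-- The tail of the transform decays faster than `1/k`. -/
theorem tendsto_mul_tailFourier_neg (f : 𝓢(ℝ, ℂ)) (n : ℕ) :
    Tendsto (fun k => k * tailFourier f (n + 2) (-k)) upperInfty (𝓝 0) := by
  obtain ⟨M, hM0, hM⟩ := norm_tailFourier_le f (n + 2)
  have h1 : Tendsto (fun k : ℂ => M * (‖-k * (1 + I * -k)⁻¹‖ * ‖(1 + I * -k)⁻¹‖ ^ (n + 1)))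
      upperInfty (𝓝 (M * (‖-I‖ * ‖(0 : ℂ)‖ ^ (n + 1)))) :=
    (((tendsto_mul_one_add_I_mul_inv.comp tendsto_neg_upperInfty).norm).mul
      ((tendsto_one_add_I_mul_inv.comp tendsto_neg_upperInfty).norm.pow (n + 1))).const_mul M
  rw [norm_zero, zero_pow (by omega), mul_zero, mul_zero] at h1
  refine squeeze_zero_norm' ?_ h1
  filter_upwards [mem_inf_of_right (mem_principal_self closedUpper)] with k hk
  have h2 := hM (-k) (neg_mem_im_nonpos hk)
  rw [norm_mul, norm_mul, norm_neg]
  calc _ ≤ ‖k‖ * (M / ‖1 + I * -k‖ ^ (n + 2)) := by gcongr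
    _ = _ := by rw [norm_inv, pow_succ _ (n + 1), inv_pow]; field_simp

end Limits

/-! ### The decaying part of the solution -/

theorem waveNumbers_ofReal : WaveNumbers (fun k : ℝ => (k : ℂ)) := by
  have hn : ∀ k : ℝ, ‖(1 : ℂ) + (k : ℂ) ^ 2‖ = 1 + k ^ 2 := by
    intro k
    rw [show (1 : ℂ) + (k : ℂ) ^ 2 = ((1 + k ^ 2 : ℝ) : ℂ) by push_cast; ring, norm_real,
      Real.norm_of_nonneg (by positivity)]
  refine ⟨continuous_ofReal, fun k => ?_, ⟨0, by simp⟩, ⟨1, fun k => ?_⟩, ⟨1, fun k => ?_⟩⟩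
  · rw [← norm_pos_iff, hn]; positivity
  · rw [omegaSq, norm_div, hn, norm_pow, norm_real, Real.norm_eq_abs, sq_abs,
      div_le_one (by positivity)]
    linarith
  · rw [norm_div, hn, norm_real, Real.norm_eq_abs, div_le_one (by positivity)]
    nlinarith [sq_abs k, sq_nonneg (|k| - 1), abs_nonneg k]

theorem hasMoments_tailFourier (f : 𝓢(ℝ, ℂ)) (n : ℕ) :
    HasMoments volume (fun k : ℝ => (k : ℂ)) n (fun k : ℝ => tailFourier f (n + 2) k) := by
  obtain ⟨M, hM0, hM⟩ := norm_tailFourier_le f (n + 2)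
  have hc : Continuous (fun k : ℝ => tailFourier f (n + 2) k) :=
    (continuousOn_tailFourier f (n + 2)).comp_continuous continuous_ofReal fun k => by simp
  refine ⟨hc.aestronglyMeasurable, (integrable_inv_one_add_sq.const_mul (2 ^ n * M)).mono'
    (Continuous.aestronglyMeasurable (by fun_prop)) (ae_of_all _ fun k => ?_)⟩
  set s := ‖1 + I * (k : ℂ)‖ with hs
  have hs2 : s ^ 2 = 1 + k ^ 2 := by
    rw [hs, ← normSq_eq_norm_sq, normSq_apply]; simp; ring
  have hs1 : 1 ≤ s := by
    have : 0 ≤ s := norm_nonneg _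
    nlinarith [sq_nonneg k]
  have hks : 1 + |k| ≤ 2 * s := by
    have : |k| ≤ s := abs_le_of_sq_le_sq (by rw [hs2]; linarith) (by linarith)
    linarith
  have h1 := hM k (by simp)
  rw [Real.norm_of_nonneg (by positivity)]
  simp only [norm_real, Real.norm_eq_abs]
  calc (1 + |k|) ^ n * ‖tailFourier f (n + 2) k‖ ≤ (2 * s) ^ n * (M / s ^ (n + 2)) := by gcongr
    _ = 2 ^ n * M * (s ^ 2)⁻¹ := by
        rw [mul_pow, pow_add]; field_simp
    _ = _ := by rw [hs2]

theorem HasMoments.zero (ν : Measure ℝ) (κ : ℝ → ℂ) (n : ℕ) : HasMoments ν κ n (fun _ => 0) :=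
  ⟨aestronglyMeasurable_const, by simp⟩

/-- The order `6` of the tail is `4 + 2`: four moments of `b` are needed, because `iκb` enters the
amplitude of `r` and three derivatives are wanted, and a further `k⁻²` makes the integral converge.
-/
theorem admissiblePair_line (r₀ q₀ : 𝓢(ℝ, ℂ)) :
    AdmissiblePair volume (fun k : ℝ => (k : ℂ)) (fun k => tailFourier r₀ 6 k)
      (fun k => tailFourier q₀ 6 k) (fun _ => 0) :=
  ⟨waveNumbers_ofReal, (hasMoments_tailFourier r₀ 4).of_succ waveNumbers_ofReal,
    hasMoments_tailFourier q₀ 4, HasMoments.zero _ _ _⟩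

/-! ### The contour part of the solution -/

section ContourPart

/-- The contour, extended to all parameters by constants. -/
def extend (γ : ℝ → ℂ) (u : ℝ) : ℂ := γ (projIcc (0 : ℝ) 1 zero_le_one u)

variable {γ : ℝ → ℂ}

theorem continuous_extend {w : ℝ → ℂ} (hw : ContinuousOn w (Icc 0 1)) : Continuous (extend w) :=
  hw.comp_continuous (by fun_prop) fun u => (projIcc (0 : ℝ) 1 zero_le_one u).2

theorem extend_of_mem (w : ℝ → ℂ) {u : ℝ} (hu : u ∈ Icc (0 : ℝ) 1) : extend w u = w u := by
  rw [extend, projIcc_of_mem zero_le_one hu]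

theorem exists_bound_extend {w : ℝ → ℂ} (hw : ContinuousOn w (Icc 0 1)) :
    ∃ B, ∀ u, ‖extend w u‖ ≤ B := by
  obtain ⟨B, hB⟩ := isCompact_Icc.exists_bound_of_continuousOn hw
  exact ⟨B, fun u => hB _ (projIcc (0 : ℝ) 1 zero_le_one u).2⟩

theorem IsContourAroundI.extend_mem (hγ : IsContourAroundI γ) (u : ℝ) :
    extend γ u ∈ puncturedUpper :=
  hγ.mem_puncturedUpper (projIcc (0 : ℝ) 1 zero_le_one u).2

/-- All bounds follow from compactness of the curve and its avoiding `i`. The constant extension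
makes them hold for every real parameter. -/
theorem IsContourAroundI.waveNumbers (hγ : IsContourAroundI γ) : WaveNumbers (extend γ) := by
  refine ⟨continuous_extend hγ.contDiffOn.continuousOn, fun u => one_add_sq_ne_zero (hγ.extend_mem u),
    ?_, ?_, ?_⟩
  · obtain ⟨B, hB⟩ := exists_bound_extend hγ.contDiffOn.continuousOn
    exact ⟨B, fun u => (abs_im_le_norm _).trans (hB u)⟩
  · exact exists_bound_extend (hγ.comp_continuousOn continuousOn_omegaSq)
  · refine exists_bound_extend (hγ.comp_continuousOn (F := fun k => k / (1 + k ^ 2)) ?_)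
    exact ContinuousOn.div (by fun_prop) (by fun_prop) fun k hk => one_add_sq_ne_zero hk

theorem IsContourAroundI.hasMoments (hγ : IsContourAroundI γ) {w : ℝ → ℂ} (hw : Continuous w) (n : ℕ) :
    HasMoments (volume.restrict (Ioc 0 1)) (extend γ) n w := by
  have := hγ.waveNumbers.continuous
  exact ⟨hw.aestronglyMeasurable, Continuous.integrableOn_Ioc (by fun_prop)⟩

theorem superpose_contour (γ : ℝ → ℂ) {Φ : ℝ → ℝ → ℂ} {F : ℂ → ℂ} (x t : ℝ)
    (h : ∀ u ∈ Icc (0 : ℝ) 1, Φ u t = F (γ u) * derivWithin γ (Icc 0 1) u) :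
    superpose (volume.restrict (Ioc 0 1)) (extend γ) Φ (x, t)
      = contourIntegral γ (fun k => exp (I * k * x) * F k) := by
  rw [superpose, contourIntegral, intervalIntegral.integral_of_le zero_le_one]
  refine setIntegral_congr_fun measurableSet_Ioc fun u hu => ?_
  have hu' := Ioc_subset_Icc_self hu
  simp only [extend_of_mem γ hu', h u hu']
  ring

end ContourPart

/-! ### The solution -/

section Solution

variable (r₀ q₀ g₀ : 𝓢(ℝ, ℂ)) (γ : ℝ → ℂ)

/-- Amplitude of `r` that comes from the boundary jets of the initial data. -/
def jetR (t : ℝ) (k : ℂ) : ℂ :=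
  cosTime (omegaSq k) t * jetFourier r₀ 6 k - I * k * sinTime (omegaSq k) t * jetFourier q₀ 6 k

/-- Amplitude of `q` that comes from the boundary jets of the initial data. -/
def jetQ (t : ℝ) (k : ℂ) : ℂ :=
  cosTime (omegaSq k) t * jetFourier q₀ 6 k
    - I * (k / (1 + k ^ 2)) * sinTime (omegaSq k) t * jetFourier r₀ 6 k

/-- Initial amplitude of `r` on the contour. -/
def contourA (k : ℂ) : ℂ := jetFourier r₀ 6 k + halfLineFourier r₀ (-k)

/-- Initial amplitude of `q` on the contour. -/
def contourB (k : ℂ) : ℂ := jetFourier q₀ 6 k - halfLineFourier q₀ (-k)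

/-- The contribution of the real line to `2π r`. -/
def lineR : ℝ × ℝ → ℂ := superpose volume (fun k : ℝ => (k : ℂ))
  (amplitudeR (fun k : ℝ => (k : ℂ)) (fun k => tailFourier r₀ 6 k) (fun k => tailFourier q₀ 6 k)
    (fun _ => 0) g₀)

/-- The contribution of the real line to `2π q`. -/
def lineQ : ℝ × ℝ → ℂ := superpose volume (fun k : ℝ => (k : ℂ))
  (amplitudeQ (fun k : ℝ => (k : ℂ)) (fun k => tailFourier r₀ 6 k) (fun k => tailFourier q₀ 6 k)
    (fun _ => 0) g₀)

/-- The contribution of the contour to `2π r`. -/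
def contourR : ℝ × ℝ → ℂ := superpose (volume.restrict (Ioc 0 1)) (extend γ)
  (amplitudeR (extend γ) (fun u => contourA r₀ (extend γ u) * extend (derivWithin γ (Icc 0 1)) u)
    (fun u => contourB q₀ (extend γ u) * extend (derivWithin γ (Icc 0 1)) u)
    (extend (derivWithin γ (Icc 0 1))) g₀)

/-- The contribution of the contour to `2π q`. -/
def contourQ : ℝ × ℝ → ℂ := superpose (volume.restrict (Ioc 0 1)) (extend γ)
  (amplitudeQ (extend γ) (fun u => contourA r₀ (extend γ u) * extend (derivWithin γ (Icc 0 1)) u)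
    (fun u => contourB q₀ (extend γ u) * extend (derivWithin γ (Icc 0 1)) u)
    (extend (derivWithin γ (Icc 0 1))) g₀)

/-- The function `r`. -/
def solR (x t : ℝ) : ℂ := 1 / (2 * Real.pi) * (lineR r₀ q₀ g₀ (x, t) + contourR r₀ q₀ g₀ γ (x, t))

/-- The function `q`. -/
def solQ (x t : ℝ) : ℂ := 1 / (2 * Real.pi) * (lineQ r₀ q₀ g₀ (x, t) + contourQ r₀ q₀ g₀ γ (x, t))

end Solution

section Properties

variable {r₀ q₀ g₀ : 𝓢(ℝ, ℂ)} {γ : ℝ → ℂ}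

theorem rectContour_exp_mul_jetR (hγ : IsContourAroundI γ) (x t : ℝ) :
    RectContour γ (fun k => exp (I * k * x) * jetR r₀ q₀ t k) := by
  have h1 := rectContour_jetFourier hγ r₀ 6 0 (w := fun k => exp (I * k * x)) (by fun_prop)
    (by fun_prop) (differentiable_cosTime t)
  have h2 := rectContour_jetFourier hγ q₀ 6 0 (w := fun k => exp (I * k * x) * (I * k)) (by fun_prop)
    (by fun_prop) (differentiable_sinTime t)
  refine (h1.sub hγ h2).congr hγ fun k _ => ?_
  simp only [jetR, pow_zero, div_one]; ring

theorem rectContour_exp_mul_jetQ (hγ : IsContourAroundI γ) (x t : ℝ) :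
    RectContour γ (fun k => exp (I * k * x) * jetQ r₀ q₀ t k) := by
  have h1 := rectContour_jetFourier hγ q₀ 6 0 (w := fun k => exp (I * k * x)) (by fun_prop)
    (by fun_prop) (differentiable_cosTime t)
  have h2 := rectContour_jetFourier hγ r₀ 6 1 (w := fun k => exp (I * k * x) * I * (k / (k + I)))
    (ContinuousOn.mul (by fun_prop)
      (ContinuousOn.div (by fun_prop) (by fun_prop) fun k hk => add_I_ne_zero hk))
    (DifferentiableOn.mul (by fun_prop) (DifferentiableOn.div (by fun_prop) (by fun_prop)
      fun k hk => add_I_ne_zero (upper_subset_closedUpper hk))) (differentiable_sinTime t)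
  refine (h1.sub hγ h2).congr hγ fun k hk => ?_
  have h3 := sub_I_ne_zero hk
  have h4 := add_I_ne_zero hk.1
  simp only [jetQ, pow_zero, div_one, one_add_sq_eq, pow_one]
  field_simp

theorem continuousOn_jetR (hγ : IsContourAroundI γ) (t : ℝ) :
    ContinuousOn (jetR r₀ q₀ t) puncturedUpper := by
  simpa using (rectContour_exp_mul_jetR (r₀ := r₀) (q₀ := q₀) hγ 0 t).continuousOn

theorem continuousOn_jetQ (hγ : IsContourAroundI γ) (t : ℝ) :
    ContinuousOn (jetQ r₀ q₀ t) puncturedUpper := by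
  simpa using (rectContour_exp_mul_jetQ (r₀ := r₀) (q₀ := q₀) hγ 0 t).continuousOn

theorem continuous_comp_ofReal {h : ℂ → ℂ} (hc : ContinuousOn h puncturedUpper) :
    Continuous (fun k : ℝ => h k) := by
  simpa using continuousOn_real hc

/-- The factor `k` in front of the sine meets `k · jet → -i q₀(0)`. This nonzero limit is what
obstructs convergence of the improper integral for `r`. -/
theorem tendsto_jetR (t : ℝ) :
    Tendsto (jetR r₀ q₀ t) upperInfty (𝓝 (-(q₀ 0 * Real.sin t))) := by
  have h := ((tendsto_cosTime_omegaSq t).mul (tendsto_jetFourier r₀ 5)).sub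
    (((tendsto_mul_jetFourier q₀ 5).const_mul I).mul (tendsto_sinTime_omegaSq t))
  have e : (Real.cos t : ℂ) * 0 - I * (-I * q₀ 0) * Real.sin t = -(q₀ 0 * Real.sin t) := by
    linear_combination (q₀ 0 * Real.sin t) * I_sq
  rw [e] at h
  refine (h.mono_left upperInfty_le).congr fun k => ?_
  rw [jetR]; ring

theorem tendsto_jetQ (t : ℝ) : Tendsto (jetQ r₀ q₀ t) upperInfty (𝓝 0) := by
  have h := ((tendsto_cosTime_omegaSq t).mul (tendsto_jetFourier q₀ 5)).sub
    (((tendsto_div.const_mul I).mul (tendsto_sinTime_omegaSq t)).mul (tendsto_jetFourier r₀ 5))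
  simp only [mul_zero, sub_zero] at h
  exact h.mono_left upperInfty_le

theorem continuousOn_jetFourier (f : 𝓢(ℝ, ℂ)) (n : ℕ) :
    ContinuousOn (jetFourier f n) puncturedUpper := by
  unfold jetFourier
  exact continuousOn_finsetSum _ fun j _ => ContinuousOn.div (by fun_prop) (by fun_prop)
    fun k hk => pow_ne_zero _ (one_add_I_mul_ne_zero hk.2)

theorem continuousOn_hat_neg (f : 𝓢(ℝ, ℂ)) :
    ContinuousOn (fun k => halfLineFourier f (-k)) puncturedUpper :=
  (continuousOn_halfLineFourier_neg f).mono sdiff_subset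

theorem continuousOn_contourA : ContinuousOn (contourA r₀) puncturedUpper :=
  (continuousOn_jetFourier r₀ 6).add (continuousOn_hat_neg r₀)

theorem continuousOn_contourB : ContinuousOn (contourB q₀) puncturedUpper :=
  (continuousOn_jetFourier q₀ 6).sub (continuousOn_hat_neg q₀)

theorem IsContourAroundI.admissiblePair (hγ : IsContourAroundI γ) :
    AdmissiblePair (volume.restrict (Ioc 0 1)) (extend γ)
      (fun u => contourA r₀ (extend γ u) * extend (derivWithin γ (Icc 0 1)) u)
      (fun u => contourB q₀ (extend γ u) * extend (derivWithin γ (Icc 0 1)) u)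
      (extend (derivWithin γ (Icc 0 1))) := by
  have hd := continuous_extend hγ.continuousOn_derivWithin
  have hκ := hγ.waveNumbers.continuous
  exact ⟨hγ.waveNumbers,
    hγ.hasMoments ((continuousOn_contourA.comp_continuous hκ hγ.extend_mem).mul hd) 3,
    hγ.hasMoments ((continuousOn_contourB.comp_continuous hκ hγ.extend_mem).mul hd) 4,
    hγ.hasMoments hd 3⟩

/-! #### The formulas -/

theorem lineR_apply (x t : ℝ) : lineR r₀ q₀ g₀ (x, t) = ∫ k : ℝ, exp (I * k * x) *
    (cosTime (omegaSq k) t * tailFourier r₀ 6 k - I * k * sinTime (omegaSq k) t * tailFourier q₀ 6 k) := by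
  rw [lineR, superpose]
  congr 1; ext k
  rw [amplitudeR]; ring

theorem lineQ_apply (x t : ℝ) : lineQ r₀ q₀ g₀ (x, t) = ∫ k : ℝ, exp (I * k * x) *
    (cosTime (omegaSq k) t * tailFourier q₀ 6 k
      - I * (k / (1 + k ^ 2)) * sinTime (omegaSq k) t * tailFourier r₀ 6 k) := by
  rw [lineQ, superpose]
  congr 1; ext k
  rw [amplitudeQ]; ring

theorem integrable_lineR (x t : ℝ) : Integrable (fun k : ℝ => exp (I * k * x) *
    (cosTime (omegaSq k) t * tailFourier r₀ 6 k
      - I * k * sinTime (omegaSq k) t * tailFourier q₀ 6 k)) := by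
  have h := ((admissiblePair_line r₀ q₀).smoothR 0).dominated.integrable waveNumbers_ofReal (x, t)
  refine h.congr (ae_of_all _ fun k => ?_)
  simp only [amplitudeR]; ring

theorem integrable_lineQ (x t : ℝ) : Integrable (fun k : ℝ => exp (I * k * x) *
    (cosTime (omegaSq k) t * tailFourier q₀ 6 k
      - I * (k / (1 + k ^ 2)) * sinTime (omegaSq k) t * tailFourier r₀ 6 k)) := by
  have h := ((admissiblePair_line r₀ q₀).smoothQ 0).dominated.integrable waveNumbers_ofReal (x, t)
  refine h.congr (ae_of_all _ fun k => ?_)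
  simp only [amplitudeQ]; ring

theorem lineIntegrandR_eq_tail_add_jet (x t k : ℝ) :
    lineIntegrandR r₀ q₀ x t k = exp (I * k * x) * (cosTime (omegaSq k) t * tailFourier r₀ 6 k
      - I * k * sinTime (omegaSq k) t * tailFourier q₀ 6 k) + exp (I * k * x) * jetR r₀ q₀ t k := by
  rw [lineIntegrandR_eq, halfLineFourier_eq_jet_add_tail r₀ 6 (by simp),
    halfLineFourier_eq_jet_add_tail q₀ 6 (by simp), jetR]
  ring

theorem lineIntegrandQ_eq_tail_add_jet (x t k : ℝ) :
    lineIntegrandQ r₀ q₀ x t k = exp (I * k * x) * (cosTime (omegaSq k) t * tailFourier q₀ 6 k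
      - I * (k / (1 + k ^ 2)) * sinTime (omegaSq k) t * tailFourier r₀ 6 k)
      + exp (I * k * x) * jetQ r₀ q₀ t k := by
  rw [lineIntegrandQ_eq, halfLineFourier_eq_jet_add_tail r₀ 6 (by simp),
    halfLineFourier_eq_jet_add_tail q₀ 6 (by simp), jetQ]
  ring

theorem HasImproperIntegral.add_integrable {F G : ℝ → ℂ} {K : ℂ} (hF : Integrable F)
    (hG : HasImproperIntegral G K) (hGc : Continuous G) :
    HasImproperIntegral (fun k => F k + G k) ((∫ k, F k) + K) := by
  refine (Tendsto.add (hasImproperIntegral_of_integrable hF) hG).congr fun p => ?_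
  rw [← intervalIntegral.integral_add hF.intervalIntegrable (hGc.intervalIntegrable _ _)]

theorem HasGaussIntegral.add_integrable {F G : ℝ → ℂ} {K : ℂ} (hF : Integrable F)
    (hG : HasGaussIntegral G K) (hGc : Continuous G) (hGb : ∃ M, ∀ k, ‖G k‖ ≤ M) :
    HasGaussIntegral (fun k => F k + G k) ((∫ k, F k) + K) := by
  obtain ⟨M, hM⟩ := hGb
  have hle : ∀ ε : ℝ, 0 < ε → ∀ k : ℝ, ‖(Real.exp (-ε * k ^ 2) : ℂ)‖ ≤ 1 := by
    intro ε hε k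
    rw [norm_real, Real.norm_of_nonneg (Real.exp_pos _).le, Real.exp_le_one_iff, neg_mul]
    have : 0 ≤ ε * k ^ 2 := by positivity
    linarith
  have hFi : ∀ ε : ℝ, 0 < ε → Integrable (fun k : ℝ => (Real.exp (-ε * k ^ 2) : ℂ) * F k) :=
    fun ε hε => hF.bdd_mul (Continuous.aestronglyMeasurable (by fun_prop)) (ae_of_all _ (hle ε hε))
  have h1 : HasGaussIntegral F (∫ k, F k) := by
    refine tendsto_integral_filter_of_dominated_convergence (fun k => ‖F k‖) ?_ ?_ hF.norm ?_
    · filter_upwards [self_mem_nhdsWithin] with ε hε using (hFi ε hε).1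
    · filter_upwards [self_mem_nhdsWithin] with ε hε
      refine ae_of_all _ fun k => ?_
      rw [norm_mul]
      exact mul_le_of_le_one_left (norm_nonneg _) (hle ε hε k)
    · refine ae_of_all _ fun k => ?_
      have : Continuous (fun ε : ℝ => (Real.exp (-ε * k ^ 2) : ℂ) * F k) := by fun_prop
      simpa using (this.tendsto 0).mono_left nhdsWithin_le_nhds
  refine (Tendsto.add h1 hG).congr' ?_
  filter_upwards [self_mem_nhdsWithin] with ε hε
  rw [← integral_add (hFi ε hε) (integrable_gauss_mul hGc hM hε)]
  simp only [mul_add]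

theorem hasGaussIntegral_lineIntegrandR (hγ : IsContourAroundI γ) {x : ℝ} (hx : 0 < x) (t : ℝ) :
    HasGaussIntegral (lineIntegrandR r₀ q₀ x t) (lineR r₀ q₀ g₀ (x, t)
      + contourIntegral γ (fun k => exp (I * k * x) * jetR r₀ q₀ t k)) := by
  have hc := continuous_comp_ofReal (continuousOn_jetR (r₀ := r₀) (q₀ := q₀) hγ t)
  obtain ⟨M, hM⟩ := exists_bound_of_tendsto_cobounded hc
    ((tendsto_jetR t).comp tendsto_ofReal_upperInfty)
  have h := HasGaussIntegral.add_integrable (integrable_lineR (r₀ := r₀) (q₀ := q₀) x t)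
    (hasGaussIntegral_of_tendsto hγ hx (continuousOn_jetR hγ t) (rectContour_exp_mul_jetR hγ x t)
      (tendsto_jetR t)) (by fun_prop)
    ⟨M, fun k => by rw [norm_mul, norm_exp_I_mul_ofReal, one_mul]; exact hM k⟩
  rw [← lineR_apply (g₀ := g₀)] at h
  convert! h using 1
  ext k
  exact lineIntegrandR_eq_tail_add_jet x t k

theorem hasImproperIntegral_lineIntegrandR (hγ : IsContourAroundI γ) {x : ℝ} (hx : 0 < x) {t : ℝ}
    (ht : q₀ 0 * (Real.sin t : ℂ) = 0) :
    HasImproperIntegral (lineIntegrandR r₀ q₀ x t) (lineR r₀ q₀ g₀ (x, t)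
      + contourIntegral γ (fun k => exp (I * k * x) * jetR r₀ q₀ t k)) := by
  have hc := continuous_comp_ofReal (continuousOn_jetR (r₀ := r₀) (q₀ := q₀) hγ t)
  have hl := tendsto_jetR (r₀ := r₀) (q₀ := q₀) t
  rw [ht, neg_zero] at hl
  have h := HasImproperIntegral.add_integrable (integrable_lineR (r₀ := r₀) (q₀ := q₀) x t)
    (hasImproperIntegral_of_tendsto_zero hx (rectContour_exp_mul_jetR hγ x t) hl) (by fun_prop)
  rw [← lineR_apply (g₀ := g₀)] at h
  convert! h using 1
  ext k
  exact lineIntegrandR_eq_tail_add_jet x t k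

theorem hasImproperIntegral_lineIntegrandQ (hγ : IsContourAroundI γ) {x : ℝ} (hx : 0 < x) (t : ℝ) :
    HasImproperIntegral (lineIntegrandQ r₀ q₀ x t) (lineQ r₀ q₀ g₀ (x, t)
      + contourIntegral γ (fun k => exp (I * k * x) * jetQ r₀ q₀ t k)) := by
  have hc := continuous_comp_ofReal (continuousOn_jetQ (r₀ := r₀) (q₀ := q₀) hγ t)
  have h := HasImproperIntegral.add_integrable (integrable_lineQ (r₀ := r₀) (q₀ := q₀) x t)
    (hasImproperIntegral_of_tendsto_zero hx (rectContour_exp_mul_jetQ hγ x t) (tendsto_jetQ t))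
    (by fun_prop)
  rw [← lineQ_apply (g₀ := g₀)] at h
  convert! h using 1
  ext k
  exact lineIntegrandQ_eq_tail_add_jet x t k

theorem continuousOn_comp_omegaSq {E : ℂ → ℂ} (hE : Differentiable ℂ E) :
    ContinuousOn (fun k => E (omegaSq k)) puncturedUpper :=
  hE.continuous.comp_continuousOn continuousOn_omegaSq

theorem continuousOn_div_one_add_sq : ContinuousOn (fun k : ℂ => k / (1 + k ^ 2)) puncturedUpper :=
  ContinuousOn.div (by fun_prop) (by fun_prop) fun _ hk => one_add_sq_ne_zero hk

theorem continuousOn_contourIntegrandR₁ (x t : ℝ) :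
    ContinuousOn (contourIntegrandR₁ r₀ q₀ x t) puncturedUpper := by
  have h1 := continuousOn_hat_neg r₀
  have h2 := continuousOn_hat_neg q₀
  have h3 := continuousOn_comp_omegaSq (differentiable_cosTime t)
  have h4 := continuousOn_comp_omegaSq (differentiable_sinTime t)
  refine ContinuousOn.congr ?_ fun k hk => contourIntegrandR₁_eq r₀ q₀ x t (one_add_sq_ne_zero hk)
  fun_prop

theorem continuousOn_contourIntegrandQ₁ (x t : ℝ) :
    ContinuousOn (contourIntegrandQ₁ r₀ q₀ x t) puncturedUpper := by
  have h1 := continuousOn_hat_neg r₀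
  have h2 := continuousOn_hat_neg q₀
  have h3 := continuousOn_comp_omegaSq (differentiable_cosTime t)
  have h4 := continuousOn_comp_omegaSq (differentiable_sinTime t)
  have h5 := continuousOn_div_one_add_sq
  refine ContinuousOn.congr ?_ fun k _ => contourIntegrandQ₁_eq r₀ q₀ x t k
  fun_prop

theorem differentiable_forcingR (g : 𝓢(ℝ, ℂ)) (t : ℝ) : Differentiable ℂ (fun z => forcingR g z t) := by
  have h1 := differentiable_cosConv g.continuous t
  have h2 := differentiable_sinConv (continuous_deriv_schwartz g) t
  unfold forcingR; fun_prop

theorem differentiable_forcingQ (g : 𝓢(ℝ, ℂ)) (t : ℝ) : Differentiable ℂ (fun z => forcingQ g z t) := by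
  have h1 := differentiable_sinConv g.continuous t
  have h2 := differentiable_cosConv (continuous_deriv_schwartz g) t
  unfold forcingQ; fun_prop

theorem contourIntegrandR₂_eq_forcing (x t : ℝ) (k : ℂ) :
    contourIntegrandR₂ g₀ x t k = exp (I * k * x) * forcingR g₀ (omegaSq k) t := by
  rw [contourIntegrandR₂_eq g₀.continuous (continuous_deriv_schwartz g₀), forcingR]; ring

theorem contourIntegrandQ₂_eq_forcing (x t : ℝ) (k : ℂ) :
    contourIntegrandQ₂ g₀ x t k
      = exp (I * k * x) * (2 * I * (k / (1 + k ^ 2)) * forcingQ g₀ (omegaSq k) t) := by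
  rw [contourIntegrandQ₂_eq g₀.continuous (continuous_deriv_schwartz g₀), forcingQ]

theorem continuousOn_contourIntegrandR₂ (x t : ℝ) :
    ContinuousOn (contourIntegrandR₂ g₀ x t) puncturedUpper := by
  have h1 := continuousOn_comp_omegaSq (differentiable_forcingR g₀ t)
  refine ContinuousOn.congr ?_ fun k _ => contourIntegrandR₂_eq_forcing x t k
  fun_prop

theorem continuousOn_contourIntegrandQ₂ (x t : ℝ) :
    ContinuousOn (contourIntegrandQ₂ g₀ x t) puncturedUpper := by
  have h1 := continuousOn_comp_omegaSq (differentiable_forcingQ g₀ t)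
  have h2 := continuousOn_div_one_add_sq
  refine ContinuousOn.congr ?_ fun k _ => contourIntegrandQ₂_eq_forcing x t k
  fun_prop

/-- The jet integral moved off the real line joins the two contour integrals of the formula; its
jets account for the extra terms in `contourA` and `contourB`. -/
theorem contourR_eq (hγ : IsContourAroundI γ) (x t : ℝ) :
    contourR r₀ q₀ g₀ γ (x, t) = contourIntegral γ (fun k => exp (I * k * x) * jetR r₀ q₀ t k)
      + contourIntegral γ (contourIntegrandR₁ r₀ q₀ x t)
      + contourIntegral γ (contourIntegrandR₂ g₀ x t) := by
  have hj := (rectContour_exp_mul_jetR (r₀ := r₀) (q₀ := q₀) hγ x t).continuousOn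
  have h1 := continuousOn_contourIntegrandR₁ (r₀ := r₀) (q₀ := q₀) x t
  have h2 := continuousOn_contourIntegrandR₂ (g₀ := g₀) x t
  rw [← hγ.contourIntegral_add hj h1, ← hγ.contourIntegral_add (hj.fun_add h1) h2, contourR,
    superpose_contour γ (F := fun k => contourA r₀ k * cosTime (omegaSq k) t
      - I * k * contourB q₀ k * sinTime (omegaSq k) t + forcingR g₀ (omegaSq k) t)]
  · refine contourIntegral_congr fun u hu => ?_
    rw [contourIntegrandR₁_eq _ _ _ _ (one_add_sq_ne_zero (hγ.mem_puncturedUpper hu)),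
      contourIntegrandR₂_eq_forcing, jetR, contourA, contourB]
    ring
  · intro u hu
    rw [amplitudeR, extend_of_mem γ hu, extend_of_mem _ hu]
    ring

theorem contourQ_eq_integral (x t : ℝ) :
    contourQ r₀ q₀ g₀ γ (x, t) = contourIntegral γ (fun k => exp (I * k * x) *
      (contourB q₀ k * cosTime (omegaSq k) t
      - I * (k / (1 + k ^ 2)) * contourA r₀ k * sinTime (omegaSq k) t
      - 2 * I * (k / (1 + k ^ 2)) * forcingQ g₀ (omegaSq k) t)) := by
  rw [contourQ, superpose_contour γ]
  intro u hu
  rw [amplitudeQ, extend_of_mem γ hu, extend_of_mem _ hu]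
  ring

theorem contourQ_eq (hγ : IsContourAroundI γ) (x t : ℝ) :
    contourQ r₀ q₀ g₀ γ (x, t) = contourIntegral γ (fun k => exp (I * k * x) * jetQ r₀ q₀ t k)
      - contourIntegral γ (contourIntegrandQ₁ r₀ q₀ x t)
      - contourIntegral γ (contourIntegrandQ₂ g₀ x t) := by
  have hj := (rectContour_exp_mul_jetQ (r₀ := r₀) (q₀ := q₀) hγ x t).continuousOn
  have h1 := continuousOn_contourIntegrandQ₁ (r₀ := r₀) (q₀ := q₀) x t
  have h2 := continuousOn_contourIntegrandQ₂ (g₀ := g₀) x t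
  rw [← hγ.contourIntegral_sub hj h1, ← hγ.contourIntegral_sub (hj.fun_sub h1) h2, contourQ_eq_integral]
  refine contourIntegral_congr fun u hu => ?_
  rw [contourIntegrandQ₁_eq, contourIntegrandQ₂_eq_forcing, jetQ, contourA, contourB]
  ring

theorem isFormulaValueR_solR (hγ : IsContourAroundI γ) {x : ℝ} (hx : 0 < x) (t : ℝ) :
    IsFormulaValueR r₀ q₀ g₀ γ x t (solR r₀ q₀ g₀ γ x t) := by
  refine ⟨_, hasGaussIntegral_lineIntegrandR (g₀ := g₀) hγ hx t,
    hasImproperIntegral_lineIntegrandR hγ hx, ?_⟩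
  rw [solR, contourR_eq hγ]; ring

theorem isFormulaValueQ_solQ (hγ : IsContourAroundI γ) {x : ℝ} (hx : 0 < x) (t : ℝ) :
    IsFormulaValueQ r₀ q₀ g₀ γ x t (solQ r₀ q₀ g₀ γ x t) := by
  refine ⟨_, hasImproperIntegral_lineIntegrandQ (g₀ := g₀) hγ hx t, ?_⟩
  rw [solQ, contourQ_eq hγ]; ring

/-! #### Smoothness and the differential equations -/

/-- Smoothness holds on the whole plane, so the continuous extension to `x = 0` and `t = 0` needs no
separate argument. -/
theorem contDiff_solR (hγ : IsContourAroundI γ) :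
    ContDiff ℝ 3 (fun p : ℝ × ℝ => solR r₀ q₀ g₀ γ p.1 p.2) :=
  contDiff_const.mul ((((admissiblePair_line r₀ q₀).smoothR g₀).contDiff waveNumbers_ofReal).add
    ((hγ.admissiblePair.smoothR g₀).contDiff hγ.waveNumbers))

theorem contDiff_solQ (hγ : IsContourAroundI γ) :
    ContDiff ℝ 3 (fun p : ℝ × ℝ => solQ r₀ q₀ g₀ γ p.1 p.2) :=
  contDiff_const.mul ((((admissiblePair_line r₀ q₀).smoothQ g₀).contDiff waveNumbers_ofReal).add
    ((hγ.admissiblePair.smoothQ g₀).contDiff hγ.waveNumbers))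

theorem integral_exp_mul_contour (hγ : IsContourAroundI γ) (x : ℝ) :
    ∫ u in Ioc (0 : ℝ) 1, exp (I * extend γ u * x) * extend (derivWithin γ (Icc 0 1)) u = 0 := by
  have h := superpose_contour γ (Φ := fun u _ => extend (derivWithin γ (Icc 0 1)) u) (F := fun _ => 1)
    x 0 (fun u hu => by simp only [extend_of_mem _ hu]; ring)
  rw [hγ.contourIntegral_eq_zero (by fun_prop)] at h
  exact h

theorem integral_exp_mul_waveNumber_contour (hγ : IsContourAroundI γ) (x : ℝ) :
    ∫ u in Ioc (0 : ℝ) 1, exp (I * extend γ u * x) *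
      (I * extend γ u * extend (derivWithin γ (Icc 0 1)) u) = 0 := by
  have h := superpose_contour γ
    (Φ := fun u _ => I * extend γ u * extend (derivWithin γ (Icc 0 1)) u) (F := fun k => I * k)
    x 0 (fun u hu => by simp only [extend_of_mem _ hu])
  rw [hγ.contourIntegral_eq_zero (by fun_prop)] at h
  exact h

theorem solution_first_equation (hγ : IsContourAroundI γ) (x t : ℝ) :
    deriv (fun s => solR r₀ q₀ g₀ γ x s) t + deriv (fun y => solQ r₀ q₀ g₀ γ y t) x = 0 := by
  have hl := admissiblePair_line r₀ q₀
  have hc := hγ.admissiblePair (r₀ := r₀) (q₀ := q₀)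
  have h1 := (((hl.smoothR g₀).hasDerivAt_snd waveNumbers_ofReal
    (hasDerivAt_amplitudeR _ _ _ _ g₀) x t).add ((hc.smoothR g₀).hasDerivAt_snd hγ.waveNumbers
    (hasDerivAt_amplitudeR _ _ _ _ g₀) x t)).const_mul (1 / (2 * Real.pi) : ℂ)
  have h2 := (((hl.smoothQ g₀).hasDerivAt_fst waveNumbers_ofReal x t).add
    ((hc.smoothQ g₀).hasDerivAt_fst hγ.waveNumbers x t)).const_mul (1 / (2 * Real.pi) : ℂ)
  have e1 := hl.first_equation g₀ (x, t)
  have e2 := hc.first_equation g₀ (x, t)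
  simp only [mul_zero, integral_zero] at e1
  simp only [integral_exp_mul_contour hγ, mul_zero] at e2
  have d1 : deriv (fun s => solR r₀ q₀ g₀ γ x s) t = _ := h1.deriv
  have d2 : deriv (fun y => solQ r₀ q₀ g₀ γ y t) x = _ := h2.deriv
  rw [d1, d2]
  linear_combination (1 / (2 * Real.pi) : ℂ) * (e1 + e2)

theorem solution_second_equation (hγ : IsContourAroundI γ) (x t : ℝ) :
    deriv (fun s => solQ r₀ q₀ g₀ γ x s) t + deriv (fun y => solR r₀ q₀ g₀ γ y t) x
      - deriv (fun s => iteratedDeriv 2 (fun y => solQ r₀ q₀ g₀ γ y s) x) t = 0 := by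
  have hl := admissiblePair_line r₀ q₀
  have hc := hγ.admissiblePair (r₀ := r₀) (q₀ := q₀)
  have h1 := (((hl.smoothQ g₀).hasDerivAt_snd waveNumbers_ofReal
    (hasDerivAt_amplitudeQ _ _ _ _ g₀) x t).add ((hc.smoothQ g₀).hasDerivAt_snd hγ.waveNumbers
    (hasDerivAt_amplitudeQ _ _ _ _ g₀) x t)).const_mul (1 / (2 * Real.pi) : ℂ)
  have h2 := (((hl.smoothR g₀).hasDerivAt_fst waveNumbers_ofReal x t).add
    ((hc.smoothR g₀).hasDerivAt_fst hγ.waveNumbers x t)).const_mul (1 / (2 * Real.pi) : ℂ)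
  have hx : ∀ y s, HasDerivAt (fun y => solQ r₀ q₀ g₀ γ y s) _ y := fun y s =>
    (((hl.smoothQ g₀).hasDerivAt_fst waveNumbers_ofReal y s).add
    ((hc.smoothQ g₀).hasDerivAt_fst hγ.waveNumbers y s)).const_mul (1 / (2 * Real.pi) : ℂ)
  have hxx := fun y s => (((hl.smoothQ g₀).2.1.hasDerivAt_fst waveNumbers_ofReal y s).add
    ((hc.smoothQ g₀).2.1.hasDerivAt_fst hγ.waveNumbers y s)).const_mul (1 / (2 * Real.pi) : ℂ)
  -- Two `x`-derivatives have used two of the three orders of smoothness; the last one is spent on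
  -- `t`.
  have h3 := (((hl.smoothQ g₀).2.1.2.1.hasDerivAt_snd waveNumbers_ofReal
    (fun u t => ((hasDerivAt_amplitudeQ _ _ _ _ g₀ u t).const_mul _).const_mul _) x t).add
    ((hc.smoothQ g₀).2.1.2.1.hasDerivAt_snd hγ.waveNumbers
    (fun u t => ((hasDerivAt_amplitudeQ _ _ _ _ g₀ u t).const_mul _).const_mul _) x t)).const_mul
    (1 / (2 * Real.pi) : ℂ)
  have e1 := hl.second_equation g₀ (x, t)
  have e2 := hc.second_equation g₀ (x, t)
  simp only [mul_zero, integral_zero] at e1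
  simp only [integral_exp_mul_waveNumber_contour hγ, mul_zero] at e2
  have d1 : deriv (fun s => solQ r₀ q₀ g₀ γ x s) t = _ := h1.deriv
  have d2 : deriv (fun y => solR r₀ q₀ g₀ γ y t) x = _ := h2.deriv
  have d3 := h3.congr_of_eventuallyEq
    (f₁ := fun s => iteratedDeriv 2 (fun y => solQ r₀ q₀ g₀ γ y s) x)
    (Eventually.of_forall fun s => by
      dsimp only
      rw [iteratedDeriv_succ, iteratedDeriv_one, funext fun y => (hx y s).deriv]
      exact (hxx x s).deriv)
  rw [d1, d2, d3.deriv]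
  linear_combination (1 / (2 * Real.pi) : ℂ) * (e1 + e2)

/-! #### Initial values -/

theorem two_pi_ne_zero' : (2 * Real.pi : ℂ) ≠ 0 := by
  exact_mod_cast Real.two_pi_pos.ne'

/-- For `k` in the upper half-plane `-k` lies in the lower one, where the transform is holomorphic;
Cauchy's theorem applies. -/
theorem contourIntegral_exp_mul_hat_neg (hγ : IsContourAroundI γ) (f : 𝓢(ℝ, ℂ)) (x : ℝ) :
    contourIntegral γ (fun k => exp (I * k * x) * halfLineFourier f (-k)) = 0 := by
  have := differentiableOn_halfLineFourier_neg f
  exact hγ.contourIntegral_eq_zero (by fun_prop)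

theorem forcingR_zero (z : ℂ) : forcingR g₀ z 0 = 0 := by simp [forcingR]

theorem forcingQ_zero (z : ℂ) : forcingQ g₀ z 0 = 0 := by simp [forcingQ]

theorem contourIntegral_zero (γ : ℝ → ℂ) : contourIntegral γ (fun _ => 0) = 0 := by
  simp [contourIntegral]

theorem IsFormulaValueR.eq_initial (hγ : IsContourAroundI γ) {x : ℝ} (hx : 0 < x) {v : ℂ}
    (h : IsFormulaValueR r₀ q₀ g₀ γ x 0 v) : v = r₀ x := by
  obtain ⟨J, hJ, -, rfl⟩ := h
  have e1 : lineIntegrandR r₀ q₀ x 0 = fun k : ℝ => exp (I * k * x) * halfLineFourier r₀ k := by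
    ext k; rw [lineIntegrandR_eq]; simp
  rw [e1] at hJ
  rw [tendsto_nhds_unique hJ (hasGaussIntegral_halfLineFourier r₀ hx),
    contourIntegral_congr (F := contourIntegrandR₁ r₀ q₀ x 0)
      (G := fun k => exp (I * k * x) * halfLineFourier r₀ (-k)),
    contourIntegral_exp_mul_hat_neg hγ,
    contourIntegral_congr (F := contourIntegrandR₂ g₀ x 0) (G := fun _ => 0), contourIntegral_zero]
  · have := two_pi_ne_zero'
    field_simp
    ring
  · intro u _; rw [contourIntegrandR₂_eq_forcing, forcingR_zero, mul_zero]
  · intro u hu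
    rw [contourIntegrandR₁_eq _ _ _ _ (one_add_sq_ne_zero (hγ.mem_puncturedUpper hu))]; simp

theorem IsFormulaValueQ.eq_initial (hγ : IsContourAroundI γ) {x : ℝ} (hx : 0 < x) {v : ℂ}
    (h : IsFormulaValueQ r₀ q₀ g₀ γ x 0 v) : v = q₀ x := by
  obtain ⟨J, hJ, rfl⟩ := h
  have e1 : lineIntegrandQ r₀ q₀ x 0 = fun k : ℝ => exp (I * k * x) * halfLineFourier q₀ k := by
    ext k; rw [lineIntegrandQ_eq]; simp
  rw [e1] at hJ
  have hc : Continuous (fun k : ℝ => halfLineFourier q₀ k) :=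
    (continuousOn_halfLineFourier q₀).comp_continuous continuous_ofReal fun k => by simp
  -- The improper integral is converted to a Gaussian one, so that the same inversion theorem serves
  -- `r` and `q`.
  have hG := hJ.hasGaussIntegral (by fun_prop) ⟨∫ y in Ioi (0 : ℝ), ‖q₀ y‖, fun k => by
    rw [norm_mul, norm_exp_I_mul_ofReal, one_mul]
    exact norm_halfLineFourier_le q₀ (by simp)⟩
  rw [tendsto_nhds_unique hG (hasGaussIntegral_halfLineFourier q₀ hx),
    contourIntegral_congr (F := contourIntegrandQ₁ r₀ q₀ x 0)
      (G := fun k => exp (I * k * x) * halfLineFourier q₀ (-k)),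
    contourIntegral_exp_mul_hat_neg hγ,
    contourIntegral_congr (F := contourIntegrandQ₂ g₀ x 0) (G := fun _ => 0), contourIntegral_zero]
  · have := two_pi_ne_zero'
    field_simp
    ring
  · intro u _; rw [contourIntegrandQ₂_eq_forcing, forcingQ_zero, mul_zero, mul_zero]
  · intro u _
    rw [contourIntegrandQ₁_eq]; simp

theorem eq_on_Ici_of_eq_on_Ioi {u v : ℝ → ℂ} (hu : Continuous u) (hv : Continuous v)
    (h : ∀ x, 0 < x → u x = v x) {x : ℝ} (hx : 0 ≤ x) : u x = v x := by
  have h1 : EqOn u v (closure (Ioi 0)) := EqOn.closure (fun x hx => h x hx) hu hv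
  rw [closure_Ioi] at h1
  exact h1 hx

/-! #### The boundary value -/

/-- The point `ω² = 1` is the limit at `k = ∞`. Integrating `g₀'` by parts there cancels the sine
convolution. -/
theorem forcingQ_one (t : ℝ) : forcingQ g₀ 1 t = g₀ t - Real.cos t * g₀ 0 := by
  rw [forcingQ, cosConv_deriv (g := g₀) (fun s => g₀.differentiableAt.hasDerivAt)
    (continuous_deriv_schwartz g₀), cosTime_one]
  ring

theorem rectContour_mul_div_mul {w E : ℂ → ℂ} (hγ : IsContourAroundI γ)
    (hc : ContinuousOn w closedUpper) (hd : DifferentiableOn ℂ w upper) (hE : Differentiable ℂ E) :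
    RectContour γ (fun k => k / (1 + k ^ 2) * w k * E (omegaSq k)) := by
  refine (rectContour_entire hγ hE (f := fun k => k / (k + I) * w k)
    (ContinuousOn.mul (ContinuousOn.div (by fun_prop) (by fun_prop) fun k hk => add_I_ne_zero hk) hc)
    (DifferentiableOn.mul (DifferentiableOn.div (by fun_prop) (by fun_prop)
      fun k hk => add_I_ne_zero (upper_subset_closedUpper hk)) hd) 1).congr hγ fun k hk => ?_
  have h3 := sub_I_ne_zero hk
  have h4 := add_I_ne_zero hk.1
  simp only [one_add_sq_eq, pow_one]
  field_simp

/-- The amplitude of the decaying part of `q`, reflected to the upper half-plane. -/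
def reflectedTailQ (r₀ q₀ : 𝓢(ℝ, ℂ)) (t : ℝ) (k : ℂ) : ℂ :=
  tailFourier q₀ 6 (-k) * cosTime (omegaSq k) t
    + I * (k / (1 + k ^ 2) * tailFourier r₀ 6 (-k) * sinTime (omegaSq k) t)

theorem rectContour_reflectedTailQ (hγ : IsContourAroundI γ) (t : ℝ) :
    RectContour γ (reflectedTailQ r₀ q₀ t) := by
  have h1 := rectContour_entire hγ (differentiable_cosTime t) (continuousOn_tailFourier_neg q₀ 6)
    (differentiableOn_tailFourier_neg q₀ 6) 0
  have h2 := (rectContour_mul_div_mul hγ (continuousOn_tailFourier_neg r₀ 6)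
    (differentiableOn_tailFourier_neg r₀ 6) (differentiable_sinTime t)).const_mul I
  simp only [pow_zero, div_one] at h1
  exact h1.add hγ h2

theorem tendsto_mul_reflectedTailQ (t : ℝ) :
    Tendsto (fun k => k * reflectedTailQ r₀ q₀ t k) upperInfty (𝓝 0) := by
  have h := ((tendsto_mul_tailFourier_neg q₀ 4).mul ((tendsto_cosTime_omegaSq t).mono_left upperInfty_le)).add
    (((tendsto_div.mono_left upperInfty_le).mul (tendsto_mul_tailFourier_neg r₀ 4)).mul
      (((tendsto_sinTime_omegaSq t).mono_left upperInfty_le)) |>.const_mul I)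
  simp only [zero_mul, mul_zero, add_zero] at h
  refine h.congr fun k => ?_
  rw [reflectedTailQ]; ring

/-- At `x = 0` no exponential decay is left, but `k → -k` makes the tails holomorphic in the upper
half-plane, where they decay faster than `1/k`; the line can be closed without Jordan's lemma. -/
theorem lineQ_zero (hγ : IsContourAroundI γ) (t : ℝ) :
    lineQ r₀ q₀ g₀ (0, t) = contourIntegral γ (reflectedTailQ r₀ q₀ t) := by
  have h1 := tendsto_integral_of_mul_tendsto_zero (rectContour_reflectedTailQ hγ t)
    (tendsto_mul_reflectedTailQ (r₀ := r₀) (q₀ := q₀) t)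
  have e : ∀ k : ℝ, reflectedTailQ r₀ q₀ t k = (fun k : ℝ => exp (I * k * (0 : ℝ)) *
      (cosTime (omegaSq k) t * tailFourier q₀ 6 k
      - I * (k / (1 + k ^ 2)) * sinTime (omegaSq k) t * tailFourier r₀ 6 k)) (-k) := by
    intro k
    have hz : omegaSq (-(k : ℂ)) = omegaSq k := by simp [omegaSq]
    simp only [ofReal_neg, hz, reflectedTailQ]
    simp
    ring
  have hi := (integrable_lineQ (r₀ := r₀) (q₀ := q₀) 0 t).comp_neg
  have h2 := intervalIntegral_tendsto_integral hi tendsto_neg_atTop_atBot tendsto_id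
  simp only [e] at h1
  rw [lineQ_apply, tendsto_nhds_unique h1 h2, integral_neg_eq_self
    (fun k : ℝ => exp (I * k * (0 : ℝ)) * (cosTime (omegaSq k) t * tailFourier q₀ 6 k
      - I * (k / (1 + k ^ 2)) * sinTime (omegaSq k) t * tailFourier r₀ 6 k))]

/-- The amplitude of `q` on the contour at `x = 0`, after cancellation of the decaying part. -/
def boundaryAmplitude (r₀ q₀ g₀ : 𝓢(ℝ, ℂ)) (t : ℝ) (k : ℂ) : ℂ :=
  (jetFourier q₀ 6 k - jetFourier q₀ 6 (-k)) * cosTime (omegaSq k) t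
    - I * (k / (1 + k ^ 2)) * (jetFourier r₀ 6 k + jetFourier r₀ 6 (-k)) * sinTime (omegaSq k) t
    - 2 * I * (k / (1 + k ^ 2)) * forcingQ g₀ (omegaSq k) t

theorem rectContour_boundaryAmplitude (hγ : IsContourAroundI γ) (t : ℝ) :
    RectContour γ (boundaryAmplitude r₀ q₀ g₀ t) := by
  have h1 := rectContour_exp_mul_jetQ (r₀ := r₀) (q₀ := q₀) hγ 0 t
  have h2 := rectContour_entire hγ (differentiable_cosTime t) (continuousOn_jetFourier_neg q₀ 6)
    (differentiableOn_jetFourier_neg q₀ 6) 0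
  have h3 := rectContour_mul_div_mul hγ (continuousOn_jetFourier_neg r₀ 6)
    (differentiableOn_jetFourier_neg r₀ 6) (differentiable_sinTime t)
  have h4 := rectContour_mul_div_mul hγ (w := fun _ => 1) continuousOn_const
    (differentiableOn_const 1) (differentiable_forcingQ g₀ t)
  refine (((h1.sub hγ h2).sub hγ (h3.const_mul I)).sub hγ (h4.const_mul (2 * I))).congr hγ
    fun k _ => ?_
  simp only [boundaryAmplitude, jetQ, pow_zero, div_one, ofReal_zero, mul_zero, exp_zero]
  ring

/-- `ω²` is even and `k/(1+k²)` is odd; the jets occur as an odd difference for `q₀` and an even sum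
for `r₀`. -/
theorem boundaryAmplitude_neg (t : ℝ) (k : ℂ) :
    boundaryAmplitude r₀ q₀ g₀ t (-k) = -boundaryAmplitude r₀ q₀ g₀ t k := by
  have hz : omegaSq (-k) = omegaSq k := by simp [omegaSq]
  rw [boundaryAmplitude, boundaryAmplitude, hz, neg_neg, neg_sq]
  ring

/-- The jets of `q₀` give `-2i q₀(0) cos t` and the forcing gives `-2i (g₀(t) - g₀(0) cos t)`. The
cosines cancel exactly because of the compatibility condition. -/
theorem tendsto_mul_boundaryAmplitude (hcompat : q₀ 0 = g₀ 0) (t : ℝ) :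
    Tendsto (fun k => k * boundaryAmplitude r₀ q₀ g₀ t k) upperInfty (𝓝 (-2 * I * g₀ t)) := by
  have hf : Tendsto (fun k => forcingQ g₀ (omegaSq k) t) upperInfty (𝓝 (forcingQ g₀ 1 t)) :=
    (((differentiable_forcingQ g₀ t).continuous.tendsto 1).comp tendsto_omegaSq).mono_left upperInfty_le
  have hq := ((tendsto_mul_jetFourier q₀ 5).mono_left upperInfty_le).add
    ((tendsto_mul_jetFourier q₀ 5).comp tendsto_neg_upperInfty)
  have hr := ((tendsto_jetFourier r₀ 5).mono_left upperInfty_le).add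
    ((tendsto_jetFourier r₀ 5).comp tendsto_neg_upperInfty)
  have hm := tendsto_mul_div.mono_left upperInfty_le
  have h := ((hq.mul ((tendsto_cosTime_omegaSq t).mono_left upperInfty_le)).sub
    (((hm.const_mul I).mul hr).mul ((tendsto_sinTime_omegaSq t).mono_left upperInfty_le))).sub
    ((hm.const_mul (2 * I)).mul hf)
  have e : (-I * q₀ 0 + -I * q₀ 0) * Real.cos t - I * 1 * (0 + 0) * Real.sin t
      - 2 * I * 1 * forcingQ g₀ 1 t = -2 * I * g₀ t := by
    rw [forcingQ_one, hcompat]; ring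
  rw [e] at h
  refine h.congr fun k => ?_
  simp only [boundaryAmplitude, Function.comp_apply]; ring

theorem solQ_boundary (hγ : IsContourAroundI γ) (hcompat : q₀ 0 = g₀ 0) (t : ℝ) :
    solQ r₀ q₀ g₀ γ 0 t = g₀ t := by
  have hB := rectContour_boundaryAmplitude (r₀ := r₀) (q₀ := q₀) (g₀ := g₀) hγ t
  have hT := rectContour_reflectedTailQ (r₀ := r₀) (q₀ := q₀) hγ t
  have h1 := contourIntegral_of_odd hγ hB (fun k => boundaryAmplitude_neg t k)
    (tendsto_mul_boundaryAmplitude hcompat t)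
  -- Splitting the transforms at `-k` into jet and tail isolates the reflected tails, which cancel
  -- the contribution of the real line.
  have h2 : contourQ r₀ q₀ g₀ γ (0, t) = contourIntegral γ (boundaryAmplitude r₀ q₀ g₀ t)
      - contourIntegral γ (reflectedTailQ r₀ q₀ t) := by
    rw [← hγ.contourIntegral_sub hB.continuousOn hT.continuousOn, contourQ_eq_integral]
    refine contourIntegral_congr fun u hu => ?_
    have him := neg_mem_im_nonpos (hγ.mem_puncturedUpper hu).1
    rw [contourA, contourB, halfLineFourier_eq_jet_add_tail r₀ 6 him,
      halfLineFourier_eq_jet_add_tail q₀ 6 him, boundaryAmplitude, reflectedTailQ]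
    simp only [ofReal_zero, mul_zero, exp_zero]
    ring
  rw [solQ, lineQ_zero hγ, h2, h1]
  have := two_pi_ne_zero'
  have hpi : (Real.pi : ℂ) ≠ 0 := by exact_mod_cast Real.pi_ne_zero
  field_simp
  linear_combination (-2 * Real.pi * g₀ t) * I_sq

/-- The functions `solR`, `solQ` solve the initial-boundary value problem. -/
theorem isClassicalSolution_sol (hγ : IsContourAroundI γ) (hcompat : q₀ 0 = g₀ 0) :
    IsClassicalSolution r₀ q₀ g₀ (solR r₀ q₀ g₀ γ) (solQ r₀ q₀ g₀ γ) where
  continuousOn_r := (contDiff_solR hγ).continuous.continuousOn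
  continuousOn_q := (contDiff_solQ hγ).continuous.continuousOn
  contDiffOn_r := ((contDiff_solR hγ).of_le (by norm_num)).contDiffOn
  contDiffOn_q := (contDiff_solQ hγ).contDiffOn
  eq_one x t _ _ := solution_first_equation hγ x t
  eq_two x t _ _ := solution_second_equation hγ x t
  initial_r _ hx := by
    have h := (contDiff_solR (r₀ := r₀) (q₀ := q₀) (g₀ := g₀) hγ).continuous
    have hc : Continuous fun x => solR r₀ q₀ g₀ γ x 0 :=
      h.comp (f := fun x : ℝ => (x, (0 : ℝ))) (by fun_prop)
    exact eq_on_Ici_of_eq_on_Ioi hc r₀.continuous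
      (fun _ hx => (isFormulaValueR_solR hγ hx 0).eq_initial hγ hx) hx
  initial_q _ hx := by
    have h := (contDiff_solQ (r₀ := r₀) (q₀ := q₀) (g₀ := g₀) hγ).continuous
    have hc : Continuous fun x => solQ r₀ q₀ g₀ γ x 0 :=
      h.comp (f := fun x : ℝ => (x, (0 : ℝ))) (by fun_prop)
    exact eq_on_Ici_of_eq_on_Ioi hc q₀.continuous
      (fun _ hx => (isFormulaValueQ_solQ hγ hx 0).eq_initial hγ hx) hx
  boundary_q t _ := solQ_boundary hγ hcompat t

end Properties

end Boussinesq

end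

/-- For `x > 0`, `t ≥ 0` the functions `r`, `q` are (uniquely) given by the formula; their values
on the boundary `x = 0` are the limits as `x → 0+`, by the continuity in `IsClassicalSolution`. -/
theorem mainTheorem1 (r₀ q₀ g₀ : 𝓢(ℝ, ℂ)) (hcompat : q₀ 0 = g₀ 0)
    (γ : ℝ → ℂ) (hγ : Boussinesq.IsContourAroundI γ) :
    ∃ r q : ℝ → ℝ → ℂ,
      (∀ x t : ℝ, 0 < x → 0 ≤ t →
        Boussinesq.IsFormulaValueR r₀ q₀ g₀ γ x t (r x t) ∧
        Boussinesq.IsFormulaValueQ r₀ q₀ g₀ γ x t (q x t)) ∧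
      Boussinesq.IsClassicalSolution r₀ q₀ g₀ r q :=
  ⟨Boussinesq.solR r₀ q₀ g₀ γ, Boussinesq.solQ r₀ q₀ g₀ γ,
    fun _ t hx _ => ⟨Boussinesq.isFormulaValueR_solR hγ hx t, Boussinesq.isFormulaValueQ_solQ hγ hx t⟩,
    Boussinesq.isClassicalSolution_sol hγ hcompat⟩
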